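/- Let $\Bbbk$ be an algebraically closed field; all categories and functors are $\Bbbk$-linear. **Bilax-unital 2-categories.** Let $\mathcal C$ be a 2-semicategory (2-category without identity 1-morphisms): it has categories $\mathcal C(i,j)$ and an associative bilinear horizontal composition $(G,F)\mapsto GF$. It is *bilax-unital* if every object $i$ carries a lax unit $I_i\in\mathcal C(i,i)$ with natural 2-morphisms $l_F:I_iF\to F$, $r_G:GI_i\to G$ satisfying $\mathrm{id}_G l_F=r_G\mathrm{id}_F$, $l_{FH}=l_F\mathrm{id}_H$, $r_{KG}=\mathrm{id}_Kr_G$, and an oplax unit $I'_i\in\mathcal C(i,i)$ with natural $l'_F:F\to I'_iF$, $r'_G:G\to GI'_i$ satisfying the dual equations. A *bilax 2-representation* $\mathbf M$ of $\mathcal C$ consists of categories $\mathbf M(i)$, functors $\mathcal C(i,j)\to\mathrm{Fun}(\mathbf M(i),\mathbf M(j))$ compatible with composition, and natural transformations $u_i:\mathbf M(I_i)\to\mathrm{id}$, $u'_i:\mathrm{id}\to\mathbf M(I'_i)$ with $u\,\mathrm{id}_{\mathbf M(F)}=\mathbf M(l_F)$, $\mathrm{id}_{\mathbf M(G)}u=\mathbf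 M(r_G)$, $u'\mathrm{id}_{\mathbf M(F)}=\mathbf M(l'_F)$, $\mathrm{id}_{\mathbf M(G)}u'=\mathbf M(r'_G)$. An *equivalence* $\mathbf M\to\mathbf N$ consists of equivalences $\Phi_i:\mathbf M(i)\to\mathbf N(i)$ and natural isomorphisms $\mathbf N(F)\Phi_i\cong\Phi_j\mathbf M(F)$, natural also in $F$ and compatible with composition of 1-morphisms, with $u$ and with $u'$. **Finitary, fiax, generated.** A category is *finitary* if it is additive and idempotent split, has finite-dimensional morphism spaces and has finitely many indecomposable objects up to isomorphism. $\mathcal C$ is *finitary* if it has finitely many objects, all $\mathcal C(i,j)$ are finitary and all $I_i,I'_i$ are indecomposable; $\mathbf M$ is *finitary* if all $\mathbf M(i)$ are. A finitary $\mathcal C$ is *fiax* if there is an equivalence $(-)^\star:\mathcal C\to\mathcal C^{\mathrm{op},\mathrm{op}}$ (reversing 1- and 2-morphisms, identity on objects) such that (1) $I_i^\star=I'_i$, $l_F^\star=r'_{F^\star}$, $r_G^\star=l'_{G^\star}$; (2) every $F\in\mathcal C(j,i)$ has 2-morphisms $\alpha_F:I'_j\to F^\star F$ and $\beta_F:FF^\star\to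 I_i$ such that the composites $F\to FI'_j\to FF^\star F\to I_iF\to F$ and $F^\star\to I'_jF^\star\to F^\star FF^\star\to F^\star I_i\to F^\star$ are identities; (3) for $\gamma:F\to G$, $\gamma^\star$ is the composite $G^\star\to I'_jG^\star\to F^\star FG^\star\to F^\star GG^\star\to F^\star I_i\to F^\star$ formed with $\alpha_F,\gamma,\beta_G$; (4) $(-)^{\star\star}\cong\mathrm{Id}$. An object $X\in\mathbf M(i)$ *generates* $\mathbf M$ if every $Y\in\mathbf M(j)$, for every $j$, is isomorphic to a direct summand of $\mathbf M(F)X$ for some $F\in\mathcal C(i,j)$. **Injective abelianization.** For a category $\mathcal A$, the objects of $\underline{\mathcal A}$ are finite families $(f_s:X\to Y_s)_{s=1}^n$ in $\mathcal A$; morphisms to $(f'_t:X'\to Y'_t)_t$ are tuples $(g:X\to X',\,h_{s,t}:Y_s\to Y'_t)$ with $f'_tg=\sum_s h_{s,t}f_s$, modulo those with $g=\sum_s q_sf_s$ for some $q_s:Y_s\to X'$. Set $\underline{\mathcal C}(i,j)=\underline{\mathcal C(i,j)}$ and $\underline{\mathbf M}(i)=\underline{\mathbf M(i)}$, with $(\alpha_s:F\to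 G_s)_s\,(\alpha'_t:F'\to G'_t)_t=(\mathrm{id}_F\alpha'_t,\ \alpha_s\mathrm{id}_{F'})_{t,s}$ and the analogous action; then $\underline{\mathcal C}\supseteq\mathcal C$ is bilax-unital with the same (op)lax units, and $\underline{\mathbf M}$ is a bilax 2-representation of $\underline{\mathcal C}$, hence of $\mathcal C$. **Internal homs.** For $X\in\mathbf M(i)$ and $Y\in\underline{\mathbf M}(j)$, an internal hom $\underline{\mathrm{Hom}}(X,Y)\in\underline{\mathcal C}(i,j)$ is a 1-morphism with a morphism $\mathrm{coev}_{X,Y}:Y\to\underline{\mathbf M}(\underline{\mathrm{Hom}}(X,Y))X$ inducing bijections $\mathrm{Hom}_{\underline{\mathcal C}(i,j)}(\underline{\mathrm{Hom}}(X,Y),F)\cong\mathrm{Hom}_{\underline{\mathbf M}(j)}(Y,\underline{\mathbf M}(F)X)$ for all $F\in\underline{\mathcal C}(i,j)$. Given internal homs for all $Y$, $C_X=\underline{\mathrm{Hom}}(X,X)$ is a coalgebra in $\underline{\mathcal C}(i,i)$, with comultiplication corresponding to $\underline{\mathbf M}(C_X)(\mathrm{coev}_{X,X})\circ\mathrm{coev}_{X,X}$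 and counit $C_X\to I'_i$ corresponding to $(u'_i)_X$; each $\underline{\mathrm{Hom}}(X,Y)$ is a right $C_X$-comodule, with coaction corresponding to $\underline{\mathbf M}(\underline{\mathrm{Hom}}(X,Y))(\mathrm{coev}_{X,X})\circ\mathrm{coev}_{X,Y}$, and $\Theta_j=\underline{\mathrm{Hom}}(X,-)$ is a functor from $\underline{\mathbf M}(j)$ to the category $(\mathrm{comod}_{\underline{\mathcal C}}\text{-}C_X)(j)$ of right $C_X$-comodules in $\underline{\mathcal C}(i,j)$. Here a counit $\epsilon:A\to I'_i$ of a coalgebra is required to satisfy $(\epsilon\,\mathrm{id}_A)\Delta=l'_A$ and $(\mathrm{id}_A\epsilon)\Delta=r'_A$, and a comodule $(N,\rho)$ to satisfy $(\mathrm{id}_N\epsilon)\rho=r'_N$, besides coassociativity. The comodule categories form a bilax 2-representation of $\mathcal C$ by left composition. **Theorem.** Let $\mathbf M$ be a finitary bilax 2-representation of a fiax category $\mathcal C$, generated by a nonzero object $X\in\mathbf M(i)$. Then the internal homs $\underline{\mathrm{Hom}}(X,Y)$ exist for all $Y\in\underline{\mathbf M}(j)$ and all $j$ and, for every choice of them,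 the functors $\Theta_j$, together with the isomorphisms $F\,\underline{\mathrm{Hom}}(X,Y)\cong\underline{\mathrm{Hom}}(X,\underline{\mathbf M}(F)Y)$ whose inverses correspond to $\underline{\mathbf M}(F)(\mathrm{coev}_{X,Y})$, form an equivalence of bilax 2-representations of $\mathcal C$ between $\underline{\mathbf M}$ and $\mathrm{comod}_{\underline{\mathcal C}}\text{-}C_X$. The injective objects of the categories $(\mathrm{comod}_{\underline{\mathcal C}}\text{-}C_X)(j)$ form a finitary bilax 2-representation $\mathrm{inj}_{\underline{\mathcal C}}\text{-}C_X$ of $\mathcal C$, stable under the action, and this equivalence restricts to an equivalence of bilax 2-representations between $\mathbf M$ and $\mathrm{inj}_{\underline{\mathcal C}}\text{-}C_X$. -/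

import Mathlib

open CategoryTheory CategoryTheory.Limits

set_option linter.unusedSectionVars false

universe uk w u v u₁ v₁ u₂ v₂ u₃ v₃ u₄ v₄ u₅ v₅

/-! ### Injective abelianization of a linear category -/

/-- Objects of the injective abelianization of `A`: finite families of morphisms `f i : X ⟶ Y i`
with a common source. Such an object is a formal kernel of `(f i)ᵢ : X ⟶ ⨁ᵢ Y i`. -/
structure InjAb (𝕜 : Type uk) [Field 𝕜] (A : Type u) [Category.{v} A] [Preadditive A]
    [Linear 𝕜 A] where
  n : ℕ
  X : A
  Y : Fin n → A
  f : ∀ i, X ⟶ Y i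

namespace InjAb

variable {𝕜 : Type uk} [Field 𝕜] {A : Type u} [Category.{v} A] [Preadditive A] [Linear 𝕜 A]

/-- The morphisms `P.X ⟶ Z` of the form `∑ i, q i ∘ f i`. -/
def factors (P : InjAb 𝕜 A) (Z : A) : Submodule 𝕜 (P.X ⟶ Z) where
  carrier := {g | ∃ q : ∀ i, P.Y i ⟶ Z, g = ∑ i, P.f i ≫ q i}
  add_mem' := by
    rintro a b ⟨q, rfl⟩ ⟨q', rfl⟩
    exact ⟨fun i => q i + q' i, by simp [Finset.sum_add_distrib]⟩
  zero_mem' := ⟨fun _ => 0, by simp⟩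
  smul_mem' := by
    rintro c a ⟨q, rfl⟩
    exact ⟨fun i => c • q i, by simp [Finset.smul_sum]⟩

lemma comp_mem_factors {P : InjAb 𝕜 A} {Z W : A} {g : P.X ⟶ Z} (hg : g ∈ P.factors Z)
    (t : Z ⟶ W) : g ≫ t ∈ P.factors W := by
  obtain ⟨q, rfl⟩ := hg
  exact ⟨fun i => q i ≫ t, by simp [Preadditive.sum_comp]⟩

lemma f_mem_factors (P : InjAb 𝕜 A) (i : Fin P.n) : P.f i ∈ P.factors (P.Y i) := by
  classical
  refine ⟨fun j => if h : j = i then eqToHom (by rw [h]) else 0, ?_⟩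
  rw [Finset.sum_eq_single i]
  · simp
  · intro j _ hj; simp [hj]
  · simp

/-- The morphisms `g : P.X ⟶ Q.X` which are the first component of a tuple `(g, h)` with
`f'ᵢ ∘ g = ∑ j, h j i ∘ f j` for all `i`. -/
def compat (P Q : InjAb 𝕜 A) : Submodule 𝕜 (P.X ⟶ Q.X) where
  carrier := {g | ∀ i, g ≫ Q.f i ∈ P.factors (Q.Y i)}
  add_mem' := by
    intro a b ha hb i
    rw [Preadditive.add_comp]
    exact add_mem (ha i) (hb i)
  zero_mem' := by
    intro i
    rw [zero_comp]
    exact zero_mem _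
  smul_mem' := by
    intro c a ha i
    rw [Linear.smul_comp]
    exact Submodule.smul_mem _ _ (ha i)

lemma compat_comp_factors {P Q : InjAb 𝕜 A} {g : P.X ⟶ Q.X} (hg : g ∈ compat P Q) {Z : A}
    {t : Q.X ⟶ Z} (ht : t ∈ Q.factors Z) : g ≫ t ∈ P.factors Z := by
  obtain ⟨q, rfl⟩ := ht
  rw [Preadditive.comp_sum]
  refine Submodule.sum_mem _ fun i _ => ?_
  rw [← Category.assoc]
  exact comp_mem_factors (hg i) _

lemma compat_comp {P Q R : InjAb 𝕜 A} {g : P.X ⟶ Q.X} {g' : Q.X ⟶ R.X} (hg : g ∈ compat P Q)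
    (hg' : g' ∈ compat Q R) : g ≫ g' ∈ compat P R := by
  intro i
  rw [Category.assoc]
  exact compat_comp_factors hg (hg' i)

lemma id_mem_compat (P : InjAb 𝕜 A) : 𝟙 P.X ∈ compat P P := by
  intro i
  rw [Category.id_comp]
  exact P.f_mem_factors i

/-- Homotopy classes of tuples `(g, h)`. Two tuples are homotopic exactly if the difference of
their first components is of the form `∑ i, q i ∘ f i`, so that the class of `(g, h)` only
depends on `g`. -/
def Hom (P Q : InjAb 𝕜 A) : Type v :=
  ↥(compat P Q) ⧸ (P.factors Q.X).submoduleOf (compat P Q)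

noncomputable instance (P Q : InjAb 𝕜 A) : AddCommGroup (Hom P Q) :=
  inferInstanceAs (AddCommGroup (↥(compat P Q) ⧸ (P.factors Q.X).submoduleOf (compat P Q)))

noncomputable instance (P Q : InjAb 𝕜 A) : Module 𝕜 (Hom P Q) :=
  inferInstanceAs (Module 𝕜 (↥(compat P Q) ⧸ (P.factors Q.X).submoduleOf (compat P Q)))

/-- The class of a tuple with first component `g`. -/
def Hom.mk {P Q : InjAb 𝕜 A} (g : P.X ⟶ Q.X) (hg : g ∈ compat P Q) : Hom P Q :=
  Submodule.Quotient.mk ⟨g, hg⟩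

lemma Hom.mk_eq_mk {P Q : InjAb 𝕜 A} {g g' : P.X ⟶ Q.X} {hg : g ∈ compat P Q}
    {hg' : g' ∈ compat P Q} : Hom.mk g hg = Hom.mk g' hg' ↔ g - g' ∈ P.factors Q.X :=
  Submodule.Quotient.eq _

lemma Hom.mk_congr {P Q : InjAb 𝕜 A} {g g' : P.X ⟶ Q.X} {hg : g ∈ compat P Q}
    {hg' : g' ∈ compat P Q} (h : g = g') : Hom.mk g hg = Hom.mk g' hg' := by
  subst h; rfl

lemma Hom.exists_rep {P Q : InjAb 𝕜 A} (a : Hom P Q) : ∃ g hg, a = Hom.mk g hg := by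
  obtain ⟨x, rfl⟩ := Submodule.Quotient.mk_surjective _ a
  exact ⟨x.1, x.2, rfl⟩

/-- Composition of classes of tuples. -/
def Hom.comp {P Q R : InjAb 𝕜 A} (a : Hom P Q) (b : Hom Q R) : Hom P R :=
  Quotient.liftOn₂' a b (fun x y => Hom.mk (x.1 ≫ y.1) (compat_comp x.2 y.2)) (by
    rintro ⟨g₁, hg₁⟩ ⟨g₁', hg₁'⟩ ⟨g₂, hg₂⟩ ⟨g₂', hg₂'⟩ h h'
    have h : Hom.mk g₁ hg₁ = Hom.mk g₂ hg₂ := Quotient.sound' h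
    have h' : Hom.mk g₁' hg₁' = Hom.mk g₂' hg₂' := Quotient.sound' h'
    rw [Hom.mk_eq_mk] at h h' ⊢
    have e : g₁ ≫ g₁' - g₂ ≫ g₂' = (g₁ - g₂) ≫ g₁' + g₂ ≫ (g₁' - g₂') := by simp
    rw [e]
    exact add_mem (comp_mem_factors h _) (compat_comp_factors hg₂ h'))

lemma Hom.mk_comp_mk {P Q R : InjAb 𝕜 A} {g : P.X ⟶ Q.X} {hg : g ∈ compat P Q}
    {g' : Q.X ⟶ R.X} {hg' : g' ∈ compat Q R} :
    (Hom.mk g hg).comp (Hom.mk g' hg') = Hom.mk (g ≫ g') (compat_comp hg hg') := rfl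

instance : Category.{v} (InjAb 𝕜 A) where
  Hom P Q := Hom P Q
  id P := Hom.mk (𝟙 P.X) P.id_mem_compat
  comp a b := Hom.comp a b
  id_comp a := by
    obtain ⟨g, hg, rfl⟩ := Hom.exists_rep a
    exact Hom.mk_congr (Category.id_comp _)
  comp_id a := by
    obtain ⟨g, hg, rfl⟩ := Hom.exists_rep a
    exact Hom.mk_congr (Category.comp_id _)
  assoc a b c := by
    obtain ⟨g, hg, rfl⟩ := Hom.exists_rep a
    obtain ⟨g', hg', rfl⟩ := Hom.exists_rep b
    obtain ⟨g'', hg'', rfl⟩ := Hom.exists_rep c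
    exact Hom.mk_congr (Category.assoc _ _ _)

/-- `Hom.mk` as a morphism of the category. -/
def homMk {P Q : InjAb 𝕜 A} (g : P.X ⟶ Q.X) (hg : g ∈ compat P Q) : P ⟶ Q := Hom.mk g hg

lemma homMk_congr {P Q : InjAb 𝕜 A} {g g' : P.X ⟶ Q.X} {hg : g ∈ compat P Q}
    {hg' : g' ∈ compat P Q} (h : g = g') : homMk g hg = homMk g' hg' := Hom.mk_congr h

lemma homMk_eq_homMk {P Q : InjAb 𝕜 A} {g g' : P.X ⟶ Q.X} {hg : g ∈ compat P Q}
    {hg' : g' ∈ compat P Q} : homMk g hg = homMk g' hg' ↔ g - g' ∈ P.factors Q.X :=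
  Hom.mk_eq_mk

lemma exists_rep {P Q : InjAb 𝕜 A} (a : P ⟶ Q) : ∃ g hg, a = homMk g hg := Hom.exists_rep a

lemma homMk_comp {P Q R : InjAb 𝕜 A} {g : P.X ⟶ Q.X} {hg : g ∈ compat P Q}
    {g' : Q.X ⟶ R.X} {hg' : g' ∈ compat Q R} :
    homMk g hg ≫ homMk g' hg' = homMk (g ≫ g') (compat_comp hg hg') := rfl

lemma homMk_comp_eq {P Q R : InjAb 𝕜 A} {g : P.X ⟶ Q.X} {hg : g ∈ compat P Q}
    {g' : Q.X ⟶ R.X} {hg' : g' ∈ compat Q R} {g'' : P.X ⟶ R.X} {hg'' : g'' ∈ compat P R}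
    (h : g ≫ g' = g'') : homMk g hg ≫ homMk g' hg' = homMk g'' hg'' := homMk_congr h

lemma id_eq_homMk (P : InjAb 𝕜 A) : 𝟙 P = homMk (𝟙 P.X) P.id_mem_compat := rfl

noncomputable instance : Preadditive (InjAb 𝕜 A) where
  homGroup P Q := inferInstanceAs (AddCommGroup (Hom P Q))
  add_comp _ _ _ a b c := by
    obtain ⟨g, hg, rfl⟩ := exists_rep a
    obtain ⟨g', hg', rfl⟩ := exists_rep b
    obtain ⟨g'', hg'', rfl⟩ := exists_rep c
    exact homMk_congr (Preadditive.add_comp _ _ _ _ _ _)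
  comp_add _ _ _ a b c := by
    obtain ⟨g, hg, rfl⟩ := exists_rep a
    obtain ⟨g', hg', rfl⟩ := exists_rep b
    obtain ⟨g'', hg'', rfl⟩ := exists_rep c
    exact homMk_congr (Preadditive.comp_add _ _ _ _ _ _)

lemma homMk_add {P Q : InjAb 𝕜 A} {g g' : P.X ⟶ Q.X} {hg : g ∈ compat P Q}
    {hg' : g' ∈ compat P Q} :
    homMk g hg + homMk g' hg' = homMk (g + g') (add_mem hg hg') := rfl

noncomputable instance : Linear 𝕜 (InjAb 𝕜 A) where
  homModule P Q := inferInstanceAs (Module 𝕜 (Hom P Q))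
  smul_comp _ _ _ r a b := by
    obtain ⟨g, hg, rfl⟩ := exists_rep a
    obtain ⟨g', hg', rfl⟩ := exists_rep b
    exact homMk_congr (Linear.smul_comp _ _ _ _ _ _)
  comp_smul _ _ _ a r b := by
    obtain ⟨g, hg, rfl⟩ := exists_rep a
    obtain ⟨g', hg', rfl⟩ := exists_rep b
    exact homMk_congr (Linear.comp_smul _ _ _ _ _ _)

lemma smul_homMk {P Q : InjAb 𝕜 A} (r : 𝕜) {g : P.X ⟶ Q.X} {hg : g ∈ compat P Q} :
    r • homMk g hg = homMk (r • g) (Submodule.smul_mem _ r hg) := rfl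

/-- The object `(X → ∅)` of the injective abelianization. -/
abbrev ofObj (𝕜 : Type uk) [Field 𝕜] {A : Type u} [Category.{v} A] [Preadditive A] [Linear 𝕜 A]
    (X : A) : InjAb 𝕜 A :=
  ⟨0, X, Fin.elim0, fun i => i.elim0⟩

lemma mem_compat_ofObj {P : InjAb 𝕜 A} {X : A} (g : P.X ⟶ X) : g ∈ compat P (ofObj 𝕜 X) :=
  fun i => i.elim0

/-- The embedding of `A` into its injective abelianization. -/
abbrev incl (𝕜 : Type uk) [Field 𝕜] (A : Type u) [Category.{v} A] [Preadditive A] [Linear 𝕜 A] :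
    A ⥤ InjAb 𝕜 A where
  obj X := ofObj 𝕜 X
  map g := homMk g (mem_compat_ofObj (P := ofObj 𝕜 _) g)
  map_id _ := rfl
  map_comp _ _ := rfl

/-! ### Extension of bilinear functors to injective abelianizations -/

section Bifunctor

variable {A₁ : Type u₁} [Category.{v₁} A₁] [Preadditive A₁] [Linear 𝕜 A₁]
  {A₂ : Type u₂} [Category.{v₂} A₂] [Preadditive A₂] [Linear 𝕜 A₂]
  {A₃ : Type u₃} [Category.{v₃} A₃] [Preadditive A₃] [Linear 𝕜 A₃]
  (B : A₁ ⥤ A₂ ⥤ A₃)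

/-- The targets of the morphisms in `biObj`. -/
def biY (P : InjAb 𝕜 A₁) (P' : InjAb 𝕜 A₂) : Fin P'.n ⊕ Fin P.n → A₃
  | Sum.inl j => (B.obj P.X).obj (P'.Y j)
  | Sum.inr j => (B.obj (P.Y j)).obj P'.X

/-- The morphisms in `biObj`. -/
def biF (P : InjAb 𝕜 A₁) (P' : InjAb 𝕜 A₂) :
    ∀ s : Fin P'.n ⊕ Fin P.n, (B.obj P.X).obj P'.X ⟶ biY B P P' s
  | Sum.inl j => (B.obj P.X).map (P'.f j)
  | Sum.inr j => (B.map (P.f j)).app P'.X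

/-- The value of the extension of `B` at `P = (f i : X ⟶ Y i)` and `P' = (f' i : X' ⟶ Y' i)`: the
family consisting of the `B(X, f' i)` followed by the `B(f i, X')`. -/
abbrev biObj (P : InjAb 𝕜 A₁) (P' : InjAb 𝕜 A₂) : InjAb 𝕜 A₃ where
  n := P'.n + P.n
  X := (B.obj P.X).obj P'.X
  Y i := biY B P P' (finSumFinEquiv.symm i)
  f i := biF B P P' (finSumFinEquiv.symm i)

lemma biObj_compat_iff {B : A₁ ⥤ A₂ ⥤ A₃} {R : InjAb 𝕜 A₃} {P : InjAb 𝕜 A₁} {P' : InjAb 𝕜 A₂}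
    {g : R.X ⟶ (B.obj P.X).obj P'.X} :
    g ∈ compat R (biObj B P P') ↔
      (∀ j, g ≫ (B.obj P.X).map (P'.f j) ∈ R.factors _) ∧
        ∀ j, g ≫ (B.map (P.f j)).app P'.X ∈ R.factors _ := by
  constructor
  · intro h
    have key : ∀ s, g ≫ biF B P P' s ∈ R.factors (biY B P P' s) := fun s => by
      have aux : ∀ t, t = s → g ≫ biF B P P' t ∈ R.factors (biY B P P' t) →
          g ≫ biF B P P' s ∈ R.factors (biY B P P' s) := by
        rintro _ rfl h
        exact h
      exact aux _ (finSumFinEquiv.symm_apply_apply s) (h (finSumFinEquiv s))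
    exact ⟨fun j => key (Sum.inl j), fun j => key (Sum.inr j)⟩
  · rintro ⟨h₁, h₂⟩ i
    have key : ∀ s, g ≫ biF B P P' s ∈ R.factors (biY B P P' s)
      | Sum.inl j => h₁ j
      | Sum.inr j => h₂ j
    exact key _

lemma map_right_f_mem (P : InjAb 𝕜 A₁) (P' : InjAb 𝕜 A₂) (j : Fin P'.n) :
    (B.obj P.X).map (P'.f j) ∈ (biObj B P P').factors _ := by
  have := (biObj_compat_iff.1 (biObj B P P').id_mem_compat).1 j
  rwa [Category.id_comp] at this

lemma map_left_f_mem (P : InjAb 𝕜 A₁) (P' : InjAb 𝕜 A₂) (j : Fin P.n) :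
    (B.map (P.f j)).app P'.X ∈ (biObj B P P').factors _ := by
  have := (biObj_compat_iff.1 (biObj B P P').id_mem_compat).2 j
  rwa [Category.id_comp] at this

lemma map_right_mem [∀ a, (B.obj a).Additive] (P : InjAb 𝕜 A₁) {P' : InjAb 𝕜 A₂} {Z : A₂}
    {t : P'.X ⟶ Z} (ht : t ∈ P'.factors Z) :
    (B.obj P.X).map t ∈ (biObj B P P').factors _ := by
  obtain ⟨q, rfl⟩ := ht
  rw [Functor.map_sum]
  refine Submodule.sum_mem _ fun i _ => ?_
  rw [Functor.map_comp]
  exact comp_mem_factors (map_right_f_mem B P P' i) _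

lemma map_left_mem [B.Additive] {P : InjAb 𝕜 A₁} (P' : InjAb 𝕜 A₂) {Z : A₁}
    {t : P.X ⟶ Z} (ht : t ∈ P.factors Z) :
    (B.map t).app P'.X ∈ (biObj B P P').factors _ := by
  obtain ⟨q, rfl⟩ := ht
  rw [Functor.map_sum, NatTrans.app_sum]
  refine Submodule.sum_mem _ fun i _ => ?_
  rw [Functor.map_comp, NatTrans.comp_app]
  exact comp_mem_factors (map_left_f_mem B P P' i) _

lemma map_right_compat [∀ a, (B.obj a).Additive] (P : InjAb 𝕜 A₁) {P' Q' : InjAb 𝕜 A₂}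
    {g : P'.X ⟶ Q'.X} (hg : g ∈ compat P' Q') :
    (B.obj P.X).map g ∈ compat (biObj B P P') (biObj B P Q') := by
  refine biObj_compat_iff.2 ⟨fun j => ?_, fun j => ?_⟩
  · rw [← Functor.map_comp]
    exact map_right_mem B P (hg j)
  · rw [NatTrans.naturality]
    exact comp_mem_factors (map_left_f_mem B P P' j) _

lemma map_left_compat [B.Additive] {P Q : InjAb 𝕜 A₁} (P' : InjAb 𝕜 A₂)
    {g : P.X ⟶ Q.X} (hg : g ∈ compat P Q) :
    (B.map g).app P'.X ∈ compat (biObj B P P') (biObj B Q P') := by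
  refine biObj_compat_iff.2 ⟨fun j => ?_, fun j => ?_⟩
  · rw [← NatTrans.naturality]
    exact comp_mem_factors (map_right_f_mem B P P' j) _
  · rw [← NatTrans.comp_app, ← Functor.map_comp]
    exact map_left_mem B P' (hg j)

variable [B.Additive] [∀ a, (B.obj a).Additive]

/-- The extension of `B` in the second variable, on morphisms. -/
def biRight (P : InjAb 𝕜 A₁) {P' Q' : InjAb 𝕜 A₂} (a : P' ⟶ Q') :
    biObj B P P' ⟶ biObj B P Q' :=
  Quotient.liftOn' (s₁ := Submodule.quotientRel _) (a : Hom P' Q')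
    (fun x => homMk ((B.obj P.X).map x.1) (map_right_compat B P x.2)) (by
      rintro ⟨g, hg⟩ ⟨g', hg'⟩ h
      have h : Hom.mk g hg = Hom.mk g' hg' := Quotient.sound' h
      rw [Hom.mk_eq_mk] at h
      rw [homMk_eq_homMk, ← Functor.map_sub]
      exact map_right_mem B P h)

lemma biRight_homMk (P : InjAb 𝕜 A₁) {P' Q' : InjAb 𝕜 A₂} {g : P'.X ⟶ Q'.X}
    {hg : g ∈ compat P' Q'} :
    biRight B P (homMk g hg) = homMk ((B.obj P.X).map g) (map_right_compat B P hg) := rfl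

/-- The extension of `B` in the first variable, on morphisms. -/
def biLeft {P Q : InjAb 𝕜 A₁} (a : P ⟶ Q) (P' : InjAb 𝕜 A₂) : biObj B P P' ⟶ biObj B Q P' :=
  Quotient.liftOn' (s₁ := Submodule.quotientRel _) (a : Hom P Q)
    (fun x => homMk ((B.map x.1).app P'.X) (map_left_compat B P' x.2)) (by
      rintro ⟨g, hg⟩ ⟨g', hg'⟩ h
      have h : Hom.mk g hg = Hom.mk g' hg' := Quotient.sound' h
      rw [Hom.mk_eq_mk] at h
      rw [homMk_eq_homMk, ← NatTrans.app_sub, ← Functor.map_sub]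
      exact map_left_mem B P' h)

lemma biLeft_homMk {P Q : InjAb 𝕜 A₁} (P' : InjAb 𝕜 A₂) {g : P.X ⟶ Q.X}
    {hg : g ∈ compat P Q} :
    biLeft B (homMk g hg) P' = homMk ((B.map g).app P'.X) (map_left_compat B P' hg) := rfl

lemma biRight_id (P : InjAb 𝕜 A₁) (P' : InjAb 𝕜 A₂) : biRight B P (𝟙 P') = 𝟙 _ :=
  homMk_congr ((B.obj P.X).map_id P'.X)

lemma biRight_comp (P : InjAb 𝕜 A₁) {P' Q' R' : InjAb 𝕜 A₂} (a : P' ⟶ Q') (b : Q' ⟶ R') :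
    biRight B P (a ≫ b) = biRight B P a ≫ biRight B P b := by
  obtain ⟨g, hg, rfl⟩ := exists_rep a
  obtain ⟨g', hg', rfl⟩ := exists_rep b
  exact homMk_congr ((B.obj P.X).map_comp _ _)

lemma biLeft_id (P : InjAb 𝕜 A₁) (P' : InjAb 𝕜 A₂) : biLeft B (𝟙 P) P' = 𝟙 _ := by
  have e : (B.map (𝟙 P.X)).app P'.X = 𝟙 ((B.obj P.X).obj P'.X) := by simp
  exact homMk_congr e

lemma biLeft_comp {P Q R : InjAb 𝕜 A₁} (a : P ⟶ Q) (b : Q ⟶ R) (P' : InjAb 𝕜 A₂) :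
    biLeft B (a ≫ b) P' = biLeft B a P' ≫ biLeft B b P' := by
  obtain ⟨g, hg, rfl⟩ := exists_rep a
  obtain ⟨g', hg', rfl⟩ := exists_rep b
  have e : (B.map (g ≫ g')).app P'.X = (B.map g).app P'.X ≫ (B.map g').app P'.X := by simp
  exact homMk_congr e

lemma biRight_biLeft {P Q : InjAb 𝕜 A₁} (a : P ⟶ Q) {P' Q' : InjAb 𝕜 A₂} (b : P' ⟶ Q') :
    biRight B P b ≫ biLeft B a Q' = biLeft B a P' ≫ biRight B Q b := by
  obtain ⟨g, hg, rfl⟩ := exists_rep a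
  obtain ⟨g', hg', rfl⟩ := exists_rep b
  exact homMk_congr ((B.map g).naturality g')

/-- The extension of a bilinear functor to injective abelianizations: on morphisms, it is given
by `B` on the first components of tuples. -/
abbrev biExt : InjAb 𝕜 A₁ ⥤ InjAb 𝕜 A₂ ⥤ InjAb 𝕜 A₃ where
  obj P :=
    { obj := fun P' => biObj B P P'
      map := fun a => biRight B P a
      map_id := fun P' => biRight_id B P P'
      map_comp := fun a b => biRight_comp B P a b }
  map a :=
    { app := fun P' => biLeft B a P'
      naturality := fun _ _ b => biRight_biLeft B a b }
  map_id P := NatTrans.ext (funext fun P' => biLeft_id B P P')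
  map_comp a b := NatTrans.ext (funext fun P' => biLeft_comp B a b P')

instance : (biExt (𝕜 := 𝕜) B).Additive where
  map_add {_ _ a b} := by
    ext P'
    obtain ⟨g, hg, rfl⟩ := exists_rep a
    obtain ⟨g', hg', rfl⟩ := exists_rep b
    have e : (B.map (g + g')).app P'.X = (B.map g).app P'.X + (B.map g').app P'.X := by simp
    exact homMk_congr e

instance (P : InjAb 𝕜 A₁) : ((biExt (𝕜 := 𝕜) B).obj P).Additive where
  map_add {_ _ a b} := by
    obtain ⟨g, hg, rfl⟩ := exists_rep a
    obtain ⟨g', hg', rfl⟩ := exists_rep b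
    exact homMk_congr (Functor.map_add _)

instance [B.Linear 𝕜] : (biExt (𝕜 := 𝕜) B).Linear 𝕜 where
  map_smul a r := by
    ext P'
    obtain ⟨g, hg, rfl⟩ := exists_rep a
    have e : (B.map (r • g)).app P'.X = r • (B.map g).app P'.X := by simp
    exact homMk_congr e

instance [∀ a, (B.obj a).Linear 𝕜] (P : InjAb 𝕜 A₁) :
    ((biExt (𝕜 := 𝕜) B).obj P).Linear 𝕜 where
  map_smul a r := by
    obtain ⟨g, hg, rfl⟩ := exists_rep a
    exact homMk_congr (Functor.map_smul _ _ _)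

end Bifunctor

end InjAb

/-! ### Bilax-unital 2-categories -/

/-- A `𝕜`-linear 2-semicategory: like a bicategory, but without identity 1-morphisms. Horizontal
composition `comp G F = GF` is associative up to a coherent natural isomorphism; the strictly
associative case is the one in which the associators are identities. -/
structure TwoSemicat (𝕜 : Type uk) [Field 𝕜] (Ob : Type w) where
  /-- 1-morphisms and 2-morphisms. -/
  Hom : Ob → Ob → Type u
  [cat : ∀ i j, Category.{v} (Hom i j)]
  [preadditive : ∀ i j, Preadditive (Hom i j)]
  [linear : ∀ i j, Linear 𝕜 (Hom i j)]
  /-- Horizontal composition, as a bilinear functor. -/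
  h : ∀ i j k, Hom j k ⥤ Hom i j ⥤ Hom i k
  [h_additive : ∀ i j k, (h i j k).Additive]
  [h_linear : ∀ i j k, (h i j k).Linear 𝕜]
  [h_obj_additive : ∀ i j k G, ((h i j k).obj G).Additive]
  [h_obj_linear : ∀ i j k G, ((h i j k).obj G).Linear 𝕜]
  assoc : ∀ {i j k l : Ob} (H : Hom k l) (G : Hom j k) (F : Hom i j),
    ((h i j l).obj (((h j k l).obj H).obj G)).obj F ≅ ((h i k l).obj H).obj (((h i j k).obj G).obj F)
  assoc_natural_left : ∀ {i j k l : Ob} {H H' : Hom k l} (a : H ⟶ H') (G : Hom j k) (F : Hom i j),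
    ((h i j l).map (((h j k l).map a).app G)).app F ≫ (assoc H' G F).hom =
      (assoc H G F).hom ≫ ((h i k l).map a).app (((h i j k).obj G).obj F)
  assoc_natural_middle : ∀ {i j k l : Ob} (H : Hom k l) {G G' : Hom j k} (b : G ⟶ G')
    (F : Hom i j),
    ((h i j l).map (((h j k l).obj H).map b)).app F ≫ (assoc H G' F).hom =
      (assoc H G F).hom ≫ ((h i k l).obj H).map (((h i j k).map b).app F)
  assoc_natural_right : ∀ {i j k l : Ob} (H : Hom k l) (G : Hom j k) {F F' : Hom i j} (c : F ⟶ F'),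
    ((h i j l).obj (((h j k l).obj H).obj G)).map c ≫ (assoc H G F').hom =
      (assoc H G F).hom ≫ ((h i k l).obj H).map (((h i j k).obj G).map c)
  pentagon : ∀ {i j k l m : Ob} (K : Hom l m) (H : Hom k l) (G : Hom j k) (F : Hom i j),
    ((h i j m).map (assoc K H G).hom).app F ≫ (assoc K (((h j k l).obj H).obj G) F).hom ≫
        ((h i l m).obj K).map (assoc H G F).hom =
      (assoc (((h k l m).obj K).obj H) G F).hom ≫ (assoc K H (((h i j k).obj G).obj F)).hom

attribute [instance] TwoSemicat.cat TwoSemicat.preadditive TwoSemicat.linear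
  TwoSemicat.h_additive TwoSemicat.h_linear TwoSemicat.h_obj_additive TwoSemicat.h_obj_linear

namespace TwoSemicat

variable {𝕜 : Type uk} [Field 𝕜] {Ob : Type w} (C : TwoSemicat.{uk, w, u, v} 𝕜 Ob)

/-- Horizontal composition `GF` of 1-morphisms. -/
abbrev comp {i j k : Ob} (G : C.Hom j k) (F : C.Hom i j) : C.Hom i k :=
  ((C.h i j k).obj G).obj F

/-- The horizontal composition `id_G a`. -/
abbrev wl {i j k : Ob} (G : C.Hom j k) {F F' : C.Hom i j} (a : F ⟶ F') :
    C.comp G F ⟶ C.comp G F' :=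
  ((C.h i j k).obj G).map a

/-- The horizontal composition `b id_F`. -/
abbrev wr {i j k : Ob} {G G' : C.Hom j k} (b : G ⟶ G') (F : C.Hom i j) :
    C.comp G F ⟶ C.comp G' F :=
  ((C.h i j k).map b).app F

section Whisker

variable {i j k m : Ob} (G : C.Hom j k) (F : C.Hom i j) {F' F'' : C.Hom i j} {G' G'' : C.Hom j k}

@[simp]
lemma wl_id : C.wl G (𝟙 F) = 𝟙 _ := ((C.h i j k).obj G).map_id F

@[simp]
lemma wr_id : C.wr (𝟙 G) F = 𝟙 _ := by simp [wr]

variable {F} in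
lemma wl_comp (a : F ⟶ F') (b : F' ⟶ F'') : C.wl G (a ≫ b) = C.wl G a ≫ C.wl G b :=
  ((C.h i j k).obj G).map_comp a b

variable {G} in
lemma wr_comp (a : G ⟶ G') (b : G' ⟶ G'') : C.wr (a ≫ b) F = C.wr a F ≫ C.wr b F := by
  simp [wr]

variable {G} {F} in
lemma wl_wr (a : F ⟶ F') (b : G ⟶ G') : C.wl G a ≫ C.wr b F' = C.wr b F ≫ C.wl G' a :=
  ((C.h i j k).map b).naturality a

variable {i' : Ob} {H H' : C.Hom k m} (K : C.Hom i' i)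

lemma assoc_inv_natural_left (a : H ⟶ H') :
    (C.assoc H G F).inv ≫ C.wr (C.wr a G) F = C.wr a (C.comp G F) ≫ (C.assoc H' G F).inv := by
  rw [Iso.inv_comp_eq, ← Category.assoc, Iso.eq_comp_inv]
  exact C.assoc_natural_left a G F

variable {G} in
lemma assoc_inv_natural_middle (H : C.Hom k m) (b : G ⟶ G') :
    (C.assoc H G F).inv ≫ C.wr (C.wl H b) F = C.wl H (C.wr b F) ≫ (C.assoc H G' F).inv := by
  rw [Iso.inv_comp_eq, ← Category.assoc, Iso.eq_comp_inv]
  exact C.assoc_natural_middle H b F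

variable {F} in
lemma assoc_inv_natural_right (H : C.Hom k m) (a : F ⟶ F') :
    (C.assoc H G F).inv ≫ C.wl (C.comp H G) a = C.wl H (C.wl G a) ≫ (C.assoc H G F').inv := by
  rw [Iso.inv_comp_eq, ← Category.assoc, Iso.eq_comp_inv]
  exact C.assoc_natural_right H G a

lemma pentagon' {n : Ob} (K : C.Hom m n) (H : C.Hom k m) :
    (C.assoc K (C.comp H G) F).inv ≫ C.wr (C.assoc K H G).inv F ≫
        (C.assoc (C.comp K H) G F).hom =
      C.wl K (C.assoc H G F).hom ≫ (C.assoc K H (C.comp G F)).inv := by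
  have p : C.wr (C.assoc K H G).hom F ≫ (C.assoc K (C.comp H G) F).hom ≫
      C.wl K (C.assoc H G F).hom =
        (C.assoc (C.comp K H) G F).hom ≫ (C.assoc K H (C.comp G F)).hom := C.pentagon K H G F
  rw [Iso.inv_comp_eq]
  have q : C.wr (C.assoc K H G).inv F ≫ C.wr (C.assoc K H G).hom F = 𝟙 _ := by
    rw [← C.wr_comp, Iso.inv_hom_id, C.wr_id]
  rw [← cancel_mono (C.assoc K H (C.comp G F)).hom]
  simp only [Category.assoc, Iso.inv_hom_id, Category.comp_id]
  rw [← p, reassoc_of% q]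

end Whisker

end TwoSemicat

/-- A bilax-unital 2-category: a 2-semicategory with a lax unit `I i` (with unitors `l`, `r`) and
an oplax unit `I' i` (with unitors `l'`, `r'`) for every object `i`. -/
structure BilaxTwoCat (𝕜 : Type uk) [Field 𝕜] (Ob : Type w) extends
    TwoSemicat.{uk, w, u, v} 𝕜 Ob where
  I : ∀ i, Hom i i
  l : ∀ {j i : Ob} (F : Hom j i), toTwoSemicat.comp (I i) F ⟶ F
  r : ∀ {i k : Ob} (G : Hom i k), toTwoSemicat.comp G (I i) ⟶ G
  l_natural : ∀ {j i : Ob} {F F' : Hom j i} (a : F ⟶ F'),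
    toTwoSemicat.wl (I i) a ≫ l F' = l F ≫ a
  r_natural : ∀ {i k : Ob} {G G' : Hom i k} (b : G ⟶ G'),
    toTwoSemicat.wr b (I i) ≫ r G' = r G ≫ b
  l_r : ∀ {j i k : Ob} (G : Hom i k) (F : Hom j i),
    (assoc G (I i) F).hom ≫ toTwoSemicat.wl G (l F) = toTwoSemicat.wr (r G) F
  l_comp : ∀ {m j i : Ob} (F : Hom j i) (H : Hom m j),
    (assoc (I i) F H).hom ≫ l (toTwoSemicat.comp F H) = toTwoSemicat.wr (l F) H
  r_comp : ∀ {i k t : Ob} (K : Hom k t) (G : Hom i k),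
    (assoc K G (I i)).hom ≫ toTwoSemicat.wl K (r G) = r (toTwoSemicat.comp K G)
  I' : ∀ i, Hom i i
  l' : ∀ {j i : Ob} (F : Hom j i), F ⟶ toTwoSemicat.comp (I' i) F
  r' : ∀ {i k : Ob} (G : Hom i k), G ⟶ toTwoSemicat.comp G (I' i)
  l'_natural : ∀ {j i : Ob} {F F' : Hom j i} (a : F ⟶ F'),
    a ≫ l' F' = l' F ≫ toTwoSemicat.wl (I' i) a
  r'_natural : ∀ {i k : Ob} {G G' : Hom i k} (b : G ⟶ G'),
    b ≫ r' G' = r' G ≫ toTwoSemicat.wr b (I' i)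
  l'_r' : ∀ {j i k : Ob} (G : Hom i k) (F : Hom j i),
    toTwoSemicat.wr (r' G) F ≫ (assoc G (I' i) F).hom = toTwoSemicat.wl G (l' F)
  l'_comp : ∀ {m j i : Ob} (F : Hom j i) (H : Hom m j),
    toTwoSemicat.wr (l' F) H ≫ (assoc (I' i) F H).hom = l' (toTwoSemicat.comp F H)
  r'_comp : ∀ {i k t : Ob} (K : Hom k t) (G : Hom i k),
    r' (toTwoSemicat.comp K G) ≫ (assoc K G (I' i)).hom = toTwoSemicat.wl K (r' G)

/-! ### Bilax 2-representations -/

/-- A bilax 2-representation of `C`: a bilax-unital 2-functor from `C` to the 2-category of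
`𝕜`-linear categories, linear functors and natural transformations. -/
structure BilaxRep {𝕜 : Type uk} [Field 𝕜] {Ob : Type w} (C : BilaxTwoCat.{uk, w, u, v} 𝕜 Ob) where
  Obj : Ob → Type u₁
  [cat : ∀ i, Category.{v₁} (Obj i)]
  [preadditive : ∀ i, Preadditive (Obj i)]
  [linear : ∀ i, Linear 𝕜 (Obj i)]
  /-- The functors `C(i,j) → Cat(M(i), M(j))`. -/
  act : ∀ i j, C.Hom i j ⥤ Obj i ⥤ Obj j
  [act_additive : ∀ i j, (act i j).Additive]
  [act_linear : ∀ i j, (act i j).Linear 𝕜]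
  [act_obj_additive : ∀ i j F, ((act i j).obj F).Additive]
  [act_obj_linear : ∀ i j F, ((act i j).obj F).Linear 𝕜]
  /-- The coherence isomorphisms `M(GF) ≅ M(G)M(F)`. -/
  μ : ∀ {i j k : Ob} (G : C.Hom j k) (F : C.Hom i j) (X : Obj i),
    ((act i k).obj (C.comp G F)).obj X ≅ ((act j k).obj G).obj (((act i j).obj F).obj X)
  μ_natural_left : ∀ {i j k : Ob} {G G' : C.Hom j k} (b : G ⟶ G') (F : C.Hom i j) (X : Obj i),
    ((act i k).map (C.wr b F)).app X ≫ (μ G' F X).hom =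
      (μ G F X).hom ≫ ((act j k).map b).app (((act i j).obj F).obj X)
  μ_natural_middle : ∀ {i j k : Ob} (G : C.Hom j k) {F F' : C.Hom i j} (a : F ⟶ F') (X : Obj i),
    ((act i k).map (C.wl G a)).app X ≫ (μ G F' X).hom =
      (μ G F X).hom ≫ ((act j k).obj G).map (((act i j).map a).app X)
  μ_natural_right : ∀ {i j k : Ob} (G : C.Hom j k) (F : C.Hom i j) {X Y : Obj i} (f : X ⟶ Y),
    ((act i k).obj (C.comp G F)).map f ≫ (μ G F Y).hom =
      (μ G F X).hom ≫ ((act j k).obj G).map (((act i j).obj F).map f)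
  μ_assoc : ∀ {i j k l : Ob} (H : C.Hom k l) (G : C.Hom j k) (F : C.Hom i j) (X : Obj i),
    ((act i l).map (C.assoc H G F).hom).app X ≫ (μ H (C.comp G F) X).hom ≫
        ((act k l).obj H).map (μ G F X).hom =
      (μ (C.comp H G) F X).hom ≫ (μ H G (((act i j).obj F).obj X)).hom
  /-- The natural transformation `M(Iᵢ) → id`. -/
  u : ∀ {i : Ob} (X : Obj i), ((act i i).obj (C.I i)).obj X ⟶ X
  u_natural : ∀ {i : Ob} {X Y : Obj i} (f : X ⟶ Y),
    ((act i i).obj (C.I i)).map f ≫ u Y = u X ≫ f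
  u_l : ∀ {i j : Ob} (F : C.Hom i j) (X : Obj i),
    (μ (C.I j) F X).hom ≫ u (((act i j).obj F).obj X) = ((act i j).map (C.l F)).app X
  u_r : ∀ {j k : Ob} (G : C.Hom j k) (X : Obj j),
    (μ G (C.I j) X).hom ≫ ((act j k).obj G).map (u X) = ((act j k).map (C.r G)).app X
  /-- The natural transformation `id → M(I'ᵢ)`. -/
  u' : ∀ {i : Ob} (X : Obj i), X ⟶ ((act i i).obj (C.I' i)).obj X
  u'_natural : ∀ {i : Ob} {X Y : Obj i} (f : X ⟶ Y),
    f ≫ u' Y = u' X ≫ ((act i i).obj (C.I' i)).map f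
  u'_l' : ∀ {i j : Ob} (F : C.Hom i j) (X : Obj i),
    ((act i j).map (C.l' F)).app X ≫ (μ (C.I' j) F X).hom = u' (((act i j).obj F).obj X)
  u'_r' : ∀ {j k : Ob} (G : C.Hom j k) (X : Obj j),
    ((act j k).map (C.r' G)).app X ≫ (μ G (C.I' j) X).hom = ((act j k).obj G).map (u' X)

attribute [instance] BilaxRep.cat BilaxRep.preadditive BilaxRep.linear
  BilaxRep.act_additive BilaxRep.act_linear BilaxRep.act_obj_additive BilaxRep.act_obj_linear

/-- The structure of a bilax 2-natural transformation on a family of functors `Φ i`. -/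
structure BilaxTrans {𝕜 : Type uk} [Field 𝕜] {Ob : Type w} {C : BilaxTwoCat.{uk, w, u, v} 𝕜 Ob}
    (M : BilaxRep.{uk, w, u, v, u₁, v₁} C) (N : BilaxRep.{uk, w, u, v, u₂, v₂} C)
    (Φ : ∀ i, M.Obj i ⥤ N.Obj i) where
  additive : ∀ i, (Φ i).Additive
  linear : ∀ i, (Φ i).Linear 𝕜
  φ : ∀ {i j : Ob} (F : C.Hom i j) (X : M.Obj i),
    ((N.act i j).obj F).obj ((Φ i).obj X) ≅ (Φ j).obj (((M.act i j).obj F).obj X)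
  φ_natural_left : ∀ {i j : Ob} {F F' : C.Hom i j} (a : F ⟶ F') (X : M.Obj i),
    ((N.act i j).map a).app ((Φ i).obj X) ≫ (φ F' X).hom =
      (φ F X).hom ≫ (Φ j).map (((M.act i j).map a).app X)
  φ_natural_right : ∀ {i j : Ob} (F : C.Hom i j) {X Y : M.Obj i} (f : X ⟶ Y),
    ((N.act i j).obj F).map ((Φ i).map f) ≫ (φ F Y).hom =
      (φ F X).hom ≫ (Φ j).map (((M.act i j).obj F).map f)
  φ_comp : ∀ {i j k : Ob} (G : C.Hom j k) (F : C.Hom i j) (X : M.Obj i),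
    (φ (C.comp G F) X).hom ≫ (Φ k).map (M.μ G F X).hom =
      (N.μ G F ((Φ i).obj X)).hom ≫ ((N.act j k).obj G).map (φ F X).hom ≫
        (φ G (((M.act i j).obj F).obj X)).hom
  φ_u : ∀ {i : Ob} (X : M.Obj i),
    (φ (C.I i) X).hom ≫ (Φ i).map (M.u X) = N.u ((Φ i).obj X)
  φ_u' : ∀ {i : Ob} (X : M.Obj i),
    N.u' ((Φ i).obj X) ≫ (φ (C.I' i) X).hom = (Φ i).map (M.u' X)

/-- A bilax 2-natural transformation is an equivalence of bilax 2-representations if all its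
components are equivalences of categories. -/
def BilaxTrans.IsEquivalence {𝕜 : Type uk} [Field 𝕜] {Ob : Type w}
    {C : BilaxTwoCat.{uk, w, u, v} 𝕜 Ob} {M : BilaxRep.{uk, w, u, v, u₁, v₁} C}
    {N : BilaxRep.{uk, w, u, v, u₂, v₂} C} {Φ : ∀ i, M.Obj i ⥤ N.Obj i}
    (_ : BilaxTrans M N Φ) : Prop :=
  ∀ i, (Φ i).IsEquivalence

/-! ### Injective abelianizations of bilax-unital 2-categories and of 2-representations -/

namespace InjAb

section Assoc

variable {𝕜 : Type uk} [Field 𝕜]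
  {A₁ : Type u₁} [Category.{v₁} A₁] [Preadditive A₁] [Linear 𝕜 A₁]
  {A₂ : Type u₂} [Category.{v₂} A₂] [Preadditive A₂] [Linear 𝕜 A₂]
  {A₃ : Type u₃} [Category.{v₃} A₃] [Preadditive A₃] [Linear 𝕜 A₃]
  {A₁₂ : Type u₄} [Category.{v₄} A₁₂] [Preadditive A₁₂] [Linear 𝕜 A₁₂]
  {A₂₃ : Type u₅} [Category.{v₅} A₂₃] [Preadditive A₂₃] [Linear 𝕜 A₂₃]
  {A : Type u} [Category.{v} A] [Preadditive A] [Linear 𝕜 A]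
  {B₁₂ : A₁ ⥤ A₂ ⥤ A₁₂} {B₂₃ : A₂ ⥤ A₃ ⥤ A₂₃} {B : A₁₂ ⥤ A₃ ⥤ A} {B' : A₁ ⥤ A₂₃ ⥤ A}
  [B.Additive] [∀ a, (B.obj a).Additive] [B'.Additive] [∀ a, (B'.obj a).Additive]

/-- An associativity isomorphism `B(B₁₂(a, b), c) ≅ B'(a, B₂₃(b, c))`, natural in all variables,
extends to injective abelianizations. -/
abbrev assocIso
    (θ : ∀ a b c, (B.obj ((B₁₂.obj a).obj b)).obj c ≅ (B'.obj a).obj ((B₂₃.obj b).obj c))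
    (hl : ∀ {a a'} (f : a ⟶ a') b c, (B.map ((B₁₂.map f).app b)).app c ≫ (θ a' b c).hom =
      (θ a b c).hom ≫ (B'.map f).app ((B₂₃.obj b).obj c))
    (hm : ∀ a {b b'} (f : b ⟶ b') c, (B.map ((B₁₂.obj a).map f)).app c ≫ (θ a b' c).hom =
      (θ a b c).hom ≫ (B'.obj a).map ((B₂₃.map f).app c))
    (hr : ∀ a b {c c'} (f : c ⟶ c'), (B.obj ((B₁₂.obj a).obj b)).map f ≫ (θ a b c').hom =
      (θ a b c).hom ≫ (B'.obj a).map ((B₂₃.obj b).map f))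
    (P₁ : InjAb 𝕜 A₁) (P₂ : InjAb 𝕜 A₂) (P₃ : InjAb 𝕜 A₃) :
    biObj B (biObj B₁₂ P₁ P₂) P₃ ≅ biObj B' P₁ (biObj B₂₃ P₂ P₃) where
  hom := homMk (θ P₁.X P₂.X P₃.X).hom (by
    refine biObj_compat_iff.2 ⟨fun j => ?_, fun j => ?_⟩
    · have key : ∀ s, (θ P₁.X P₂.X P₃.X).hom ≫ (B'.obj P₁.X).map (biF B₂₃ P₂ P₃ s) ∈
          (biObj B (biObj B₁₂ P₁ P₂) P₃).factors _
        | Sum.inl j => by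
          have := comp_mem_factors (map_right_f_mem B (biObj B₁₂ P₁ P₂) P₃ j)
            (θ P₁.X P₂.X (P₃.Y j)).hom
          rw [hr] at this
          exact this
        | Sum.inr j => by
          have := comp_mem_factors (map_left_mem B P₃ (map_right_f_mem B₁₂ P₁ P₂ j))
            (θ P₁.X (P₂.Y j) P₃.X).hom
          rw [hm] at this
          exact this
      exact key _
    · have := comp_mem_factors (map_left_mem B P₃ (map_left_f_mem B₁₂ P₁ P₂ j))
        (θ (P₁.Y j) P₂.X P₃.X).hom
      rw [hl] at this
      exact this)
  inv := homMk (θ P₁.X P₂.X P₃.X).inv (by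
    refine biObj_compat_iff.2 ⟨fun j => ?_, fun j => ?_⟩
    · have := comp_mem_factors (map_right_mem B' P₁ (map_right_f_mem B₂₃ P₂ P₃ j))
        (θ P₁.X P₂.X (P₃.Y j)).inv
      have e : (θ P₁.X P₂.X P₃.X).inv ≫ (B.obj ((B₁₂.obj P₁.X).obj P₂.X)).map (P₃.f j) =
          (B'.obj P₁.X).map ((B₂₃.obj P₂.X).map (P₃.f j)) ≫ (θ P₁.X P₂.X (P₃.Y j)).inv := by
        rw [Iso.inv_comp_eq, ← Category.assoc, Iso.eq_comp_inv, hr]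
      exact e ▸ this
    · have key : ∀ s, (θ P₁.X P₂.X P₃.X).inv ≫ (B.map (biF B₁₂ P₁ P₂ s)).app P₃.X ∈
          (biObj B' P₁ (biObj B₂₃ P₂ P₃)).factors _
        | Sum.inl j => by
          have := comp_mem_factors (map_right_mem B' P₁ (map_left_f_mem B₂₃ P₂ P₃ j))
            (θ P₁.X (P₂.Y j) P₃.X).inv
          have e : (θ P₁.X P₂.X P₃.X).inv ≫ (B.map ((B₁₂.obj P₁.X).map (P₂.f j))).app P₃.X =
              (B'.obj P₁.X).map ((B₂₃.map (P₂.f j)).app P₃.X) ≫ (θ P₁.X (P₂.Y j) P₃.X).inv := by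
            rw [Iso.inv_comp_eq, ← Category.assoc, Iso.eq_comp_inv, hm]
          exact e ▸ this
        | Sum.inr j => by
          have := comp_mem_factors (map_left_f_mem B' P₁ (biObj B₂₃ P₂ P₃) j)
            (θ (P₁.Y j) P₂.X P₃.X).inv
          have e : (θ P₁.X P₂.X P₃.X).inv ≫ (B.map ((B₁₂.map (P₁.f j)).app P₂.X)).app P₃.X =
              (B'.map (P₁.f j)).app ((B₂₃.obj P₂.X).obj P₃.X) ≫ (θ (P₁.Y j) P₂.X P₃.X).inv := by
            rw [Iso.inv_comp_eq, ← Category.assoc, Iso.eq_comp_inv, hl]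
          exact e ▸ this
      exact key _)
  hom_inv_id := homMk_congr (θ P₁.X P₂.X P₃.X).hom_inv_id
  inv_hom_id := homMk_congr (θ P₁.X P₂.X P₃.X).inv_hom_id

end Assoc

section Unit

variable {𝕜 : Type uk} [Field 𝕜]
  {A₁ : Type u₁} [Category.{v₁} A₁] [Preadditive A₁] [Linear 𝕜 A₁]
  {A₂ : Type u₂} [Category.{v₂} A₂] [Preadditive A₂] [Linear 𝕜 A₂]

/-- A natural transformation `B(I, -) ⟶ id` extends to injective abelianizations. -/
def unitL {B : A₁ ⥤ A₂ ⥤ A₂} {I : A₁} (t : ∀ a, (B.obj I).obj a ⟶ a)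
    (ht : ∀ {a a'} (f : a ⟶ a'), (B.obj I).map f ≫ t a' = t a ≫ f) (P : InjAb 𝕜 A₂) :
    biObj B (ofObj 𝕜 I) P ⟶ P :=
  homMk (t P.X) (fun j => by
    have := comp_mem_factors (map_right_f_mem B (ofObj 𝕜 I) P j) (t (P.Y j))
    exact ht (P.f j) ▸ this)

/-- A natural transformation `B(-, I) ⟶ id` extends to injective abelianizations. -/
def unitR {B : A₂ ⥤ A₁ ⥤ A₂} {I : A₁} (t : ∀ a, (B.obj a).obj I ⟶ a)
    (ht : ∀ {a a'} (f : a ⟶ a'), (B.map f).app I ≫ t a' = t a ≫ f) (P : InjAb 𝕜 A₂) :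
    biObj B P (ofObj 𝕜 I) ⟶ P :=
  homMk (t P.X) (fun j => by
    have := comp_mem_factors (map_left_f_mem B P (ofObj 𝕜 I) j) (t (P.Y j))
    exact ht (P.f j) ▸ this)

/-- A natural transformation `id ⟶ B(I, -)` extends to injective abelianizations. -/
def counitL {B : A₁ ⥤ A₂ ⥤ A₂} {I : A₁} (t : ∀ a, a ⟶ (B.obj I).obj a)
    (ht : ∀ {a a'} (f : a ⟶ a'), f ≫ t a' = t a ≫ (B.obj I).map f) (P : InjAb 𝕜 A₂) :
    P ⟶ biObj B (ofObj 𝕜 I) P :=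
  homMk (t P.X) (biObj_compat_iff.2 ⟨fun j =>
    ht (P.f j) ▸ comp_mem_factors (P.f_mem_factors j) (t (P.Y j)), fun j => j.elim0⟩)

/-- A natural transformation `id ⟶ B(-, I)` extends to injective abelianizations. -/
def counitR {B : A₂ ⥤ A₁ ⥤ A₂} {I : A₁} (t : ∀ a, a ⟶ (B.obj a).obj I)
    (ht : ∀ {a a'} (f : a ⟶ a'), f ≫ t a' = t a ≫ (B.map f).app I) (P : InjAb 𝕜 A₂) :
    P ⟶ biObj B P (ofObj 𝕜 I) :=
  homMk (t P.X) (biObj_compat_iff.2 ⟨fun j => j.elim0, fun j =>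
    ht (P.f j) ▸ comp_mem_factors (P.f_mem_factors j) (t (P.Y j))⟩)

end Unit

end InjAb

open InjAb

/-- The injective abelianization of a 2-semicategory. -/
noncomputable abbrev TwoSemicat.injAb {𝕜 : Type uk} [Field 𝕜] {Ob : Type w}
    (C : TwoSemicat.{uk, w, u, v} 𝕜 Ob) : TwoSemicat.{uk, w, max u v, v} 𝕜 Ob where
  Hom i j := InjAb 𝕜 (C.Hom i j)
  h i j k := biExt (C.h i j k)
  assoc H G F := assocIso (fun a b c => C.assoc a b c)
    (fun f b c => C.assoc_natural_left f b c) (fun a _ _ f c => C.assoc_natural_middle a f c)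
    (fun a b _ _ f => C.assoc_natural_right a b f) H G F
  assoc_natural_left a G F := by
    obtain ⟨g, hg, rfl⟩ := exists_rep a
    exact homMk_congr (C.assoc_natural_left g G.X F.X)
  assoc_natural_middle H _ _ b F := by
    obtain ⟨g, hg, rfl⟩ := exists_rep b
    exact homMk_congr (C.assoc_natural_middle H.X g F.X)
  assoc_natural_right H G _ _ c := by
    obtain ⟨g, hg, rfl⟩ := exists_rep c
    exact homMk_congr (C.assoc_natural_right H.X G.X g)
  pentagon K H G F := homMk_congr (C.pentagon K.X H.X G.X F.X)

/-- The injective abelianization of a bilax-unital 2-category. -/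
noncomputable abbrev BilaxTwoCat.injAb {𝕜 : Type uk} [Field 𝕜] {Ob : Type w}
    (C : BilaxTwoCat.{uk, w, u, v} 𝕜 Ob) : BilaxTwoCat.{uk, w, max u v, v} 𝕜 Ob where
  toTwoSemicat := C.toTwoSemicat.injAb
  I i := ofObj 𝕜 (C.I i)
  l F := unitL (fun a => C.l a) (fun f => C.l_natural f) F
  r G := unitR (fun a => C.r a) (fun f => C.r_natural f) G
  l_natural a := by
    obtain ⟨g, hg, rfl⟩ := exists_rep a
    exact homMk_congr (C.l_natural g)
  r_natural b := by
    obtain ⟨g, hg, rfl⟩ := exists_rep b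
    exact homMk_congr (C.r_natural g)
  l_r G F := homMk_congr (C.l_r G.X F.X)
  l_comp F H := homMk_comp_eq (C.l_comp F.X H.X)
  r_comp K G := homMk_comp_eq (C.r_comp K.X G.X)
  I' i := ofObj 𝕜 (C.I' i)
  l' F := counitL (fun a => C.l' a) (fun f => C.l'_natural f) F
  r' G := counitR (fun a => C.r' a) (fun f => C.r'_natural f) G
  l'_natural a := by
    obtain ⟨g, hg, rfl⟩ := exists_rep a
    exact homMk_congr (C.l'_natural g)
  r'_natural b := by
    obtain ⟨g, hg, rfl⟩ := exists_rep b
    exact homMk_congr (C.r'_natural g)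
  l'_r' G F := homMk_congr (C.l'_r' G.X F.X)
  l'_comp F H := homMk_congr (C.l'_comp F.X H.X)
  r'_comp K G := homMk_congr (C.r'_comp K.X G.X)

/-- The injective abelianization of a bilax 2-representation of `C`, as a bilax 2-representation
of the injective abelianization of `C`. -/
noncomputable abbrev BilaxRep.injAb {𝕜 : Type uk} [Field 𝕜] {Ob : Type w}
    {C : BilaxTwoCat.{uk, w, u, v} 𝕜 Ob} (M : BilaxRep.{uk, w, u, v, u₁, v₁} C) :
    BilaxRep.{uk, w, max u v, v, max u₁ v₁, v₁} C.injAb where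
  Obj i := InjAb 𝕜 (M.Obj i)
  act i j := biExt (M.act i j)
  μ G F X := assocIso (fun a b c => M.μ a b c)
    (fun f b c => M.μ_natural_left f b c) (fun a _ _ f c => M.μ_natural_middle a f c)
    (fun a b _ _ f => M.μ_natural_right a b f) G F X
  μ_natural_left b F X := by
    obtain ⟨g, hg, rfl⟩ := exists_rep b
    exact homMk_congr (M.μ_natural_left g F.X X.X)
  μ_natural_middle G _ _ a X := by
    obtain ⟨g, hg, rfl⟩ := exists_rep a
    exact homMk_congr (M.μ_natural_middle G.X g X.X)
  μ_natural_right G F _ _ f := by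
    obtain ⟨g, hg, rfl⟩ := exists_rep f
    exact homMk_congr (M.μ_natural_right G.X F.X g)
  μ_assoc H G F X := homMk_congr (M.μ_assoc H.X G.X F.X X.X)
  u X := unitL (fun a => M.u a) (fun f => M.u_natural f) X
  u_natural f := by
    obtain ⟨g, hg, rfl⟩ := exists_rep f
    exact homMk_congr (M.u_natural g)
  u_l F X := homMk_congr (M.u_l F.X X.X)
  u_r G X := homMk_congr (M.u_r G.X X.X)
  u' X := counitL (fun a => M.u' a) (fun f => M.u'_natural f) X
  u'_natural f := by
    obtain ⟨g, hg, rfl⟩ := exists_rep f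
    exact homMk_congr (M.u'_natural g)
  u'_l' F X := homMk_congr (M.u'_l' F.X X.X)
  u'_r' G X := homMk_congr (M.u'_r' G.X X.X)

/-! ### Coalgebras and comodules -/

section Comodules

variable {𝕜 : Type uk} [Field 𝕜] {Ob : Type w}

/-- A coalgebra 1-morphism in `D(i,i)`. -/
structure Coalgebra1 (D : BilaxTwoCat.{uk, w, u, v} 𝕜 Ob) (i : Ob) where
  X : D.Hom i i
  Δ : X ⟶ D.comp X X
  ε : X ⟶ D.I' i
  coassoc : Δ ≫ D.wr Δ X ≫ (D.assoc X X X).hom = Δ ≫ D.wl X Δ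
  counit_left : Δ ≫ D.wr ε X = D.l' X
  counit_right : Δ ≫ D.wl X ε = D.r' X

variable {D : BilaxTwoCat.{uk, w, u, v} 𝕜 Ob} {i : Ob}

/-- A right comodule in `D(i,j)` over the coalgebra `A` in `D(i,i)`. -/
structure Comod1 (A : Coalgebra1 D i) (j : Ob) where
  X : D.Hom i j
  ρ : X ⟶ D.comp X A.X
  coassoc : ρ ≫ D.wr ρ A.X ≫ (D.assoc X A.X A.X).hom = ρ ≫ D.wl X A.Δ
  counit : ρ ≫ D.wl X A.ε = D.r' X

namespace Comod1

variable {A : Coalgebra1 D i} {j k : Ob}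

/-- A homomorphism of right comodules. -/
@[ext]
structure Hom (N N' : Comod1 A j) where
  hom : N.X ⟶ N'.X
  comm : N.ρ ≫ D.wr hom A.X = hom ≫ N'.ρ

instance : Category.{v} (Comod1 A j) where
  Hom N N' := Hom N N'
  id N := ⟨𝟙 N.X, by simp⟩
  comp f g := ⟨f.hom ≫ g.hom, by
    rw [D.wr_comp, ← Category.assoc, f.comm, Category.assoc, g.comm, Category.assoc]⟩

@[ext]
lemma hom_ext {N N' : Comod1 A j} {f g : N ⟶ N'} (h : f.hom = g.hom) : f = g := Hom.ext h

@[simp]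
lemma id_hom (N : Comod1 A j) : Hom.hom (𝟙 N) = 𝟙 N.X := rfl

@[simp]
lemma comp_hom {N N' N'' : Comod1 A j} (f : N ⟶ N') (g : N' ⟶ N'') :
    (f ≫ g).hom = f.hom ≫ g.hom := rfl

/-- The 2-morphisms `N.X ⟶ N'.X` which are homomorphisms of comodules. -/
def homs (N N' : Comod1 A j) : Submodule 𝕜 (N.X ⟶ N'.X) where
  carrier := {f | N.ρ ≫ D.wr f A.X = f ≫ N'.ρ}
  add_mem' := by
    intro f g hf hg
    simp only [Set.mem_ofPred_eq, TwoSemicat.wr] at hf hg ⊢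
    simp [hf, hg]
  zero_mem' := by simp [TwoSemicat.wr]
  smul_mem' := by
    intro r f hf
    simp only [Set.mem_ofPred_eq, TwoSemicat.wr] at hf ⊢
    simp [hf]

/-- Homomorphisms of comodules form a subspace of the space of 2-morphisms. -/
def homEquiv (N N' : Comod1 A j) : (N ⟶ N') ≃ homs N N' where
  toFun f := ⟨f.hom, f.comm⟩
  invFun f := ⟨f.1, f.2⟩
  left_inv _ := rfl
  right_inv _ := rfl

instance : Preadditive (Comod1 A j) where
  homGroup N N' := (homEquiv N N').addCommGroup
  add_comp _ _ _ _ _ _ := hom_ext (Preadditive.add_comp _ _ _ _ _ _)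
  comp_add _ _ _ _ _ _ := hom_ext (Preadditive.comp_add _ _ _ _ _ _)

instance : Linear 𝕜 (Comod1 A j) where
  homModule N N' := (homEquiv N N').module 𝕜
  smul_comp _ _ _ _ _ _ := hom_ext (Linear.smul_comp _ _ _ _ _ _)
  comp_smul _ _ _ _ _ _ := hom_ext (Linear.comp_smul _ _ _ _ _ _)

lemma add_hom {N N' : Comod1 A j} (f g : N ⟶ N') : (f + g).hom = f.hom + g.hom := rfl

lemma smul_hom {N N' : Comod1 A j} (r : 𝕜) (f : N ⟶ N') : (r • f).hom = r • f.hom := rfl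

/-- The comodule `FN`. -/
abbrev actObj (F : D.Hom j k) (N : Comod1 A j) : Comod1 A k where
  X := D.comp F N.X
  ρ := D.wl F N.ρ ≫ (D.assoc F N.X A.X).inv
  coassoc := by
    simp only [D.wr_comp, Category.assoc]
    rw [reassoc_of% D.assoc_inv_natural_middle A.X F N.ρ, D.pentagon' A.X A.X F N.X,
      D.assoc_inv_natural_right N.X F A.Δ]
    simp only [← Category.assoc, ← D.wl_comp]
    rw [Category.assoc, N.coassoc]
  counit := by
    rw [Category.assoc, D.assoc_inv_natural_right N.X F A.ε, ← Category.assoc, ← D.wl_comp,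
      N.counit, ← D.r'_comp, Category.assoc, Iso.hom_inv_id, Category.comp_id]

/-- The homomorphism `id_F f`. -/
abbrev actMap (F : D.Hom j k) {N N' : Comod1 A j} (f : N ⟶ N') : actObj F N ⟶ actObj F N' :=
  Hom.mk (D.wl F f.hom) (by
    rw [Category.assoc, D.assoc_inv_natural_middle A.X F f.hom, ← Category.assoc, ← D.wl_comp,
      f.comm, D.wl_comp, Category.assoc])

/-- The homomorphism `a id_N`. -/
abbrev actMap₂ {F F' : D.Hom j k} (a : F ⟶ F') (N : Comod1 A j) : actObj F N ⟶ actObj F' N :=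
  Hom.mk (D.wr a N.X) (by
    rw [Category.assoc, D.assoc_inv_natural_left N.X A.X a, ← Category.assoc, D.wl_wr,
      Category.assoc])

lemma assoc_comm {m : Ob} (G : D.Hom k m) (F : D.Hom j k) (N : Comod1 A j) :
    (actObj (D.comp G F) N).ρ ≫ D.wr (D.assoc G F N.X).hom A.X =
      (D.assoc G F N.X).hom ≫ (actObj G (actObj F N)).ρ := by
  have p := D.pentagon' N.X A.X G F
  have p' : (D.assoc (D.comp G F) N.X A.X).inv ≫ D.wr (D.assoc G F N.X).hom A.X =
      (D.assoc G F (D.comp N.X A.X)).hom ≫ D.wl G (D.assoc F N.X A.X).inv ≫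
        (D.assoc G (D.comp F N.X) A.X).inv := by
    have q : D.wr (D.assoc G F N.X).inv A.X ≫ D.wr (D.assoc G F N.X).hom A.X = 𝟙 _ := by
      rw [← D.wr_comp, Iso.inv_hom_id, D.wr_id]
    have : IsIso (D.wr (D.assoc G F N.X).inv A.X) := by unfold TwoSemicat.wr; infer_instance
    rw [Iso.inv_comp_eq, ← cancel_epi (D.wr (D.assoc G F N.X).inv A.X), q,
      ← cancel_epi (D.assoc G (D.comp F N.X) A.X).inv, reassoc_of% p, Iso.inv_hom_id_assoc,
      ← reassoc_of% D.wl_comp G (D.assoc F N.X A.X).hom (D.assoc F N.X A.X).inv, Iso.hom_inv_id, D.wl_id]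
    simp
  have n : D.wl (D.comp G F) N.ρ ≫ (D.assoc G F (D.comp N.X A.X)).hom =
      (D.assoc G F N.X).hom ≫ D.wl G (D.wl F N.ρ) := D.assoc_natural_right G F N.ρ
  change (D.wl (D.comp G F) N.ρ ≫ (D.assoc (D.comp G F) N.X A.X).inv) ≫ _ =
    (D.assoc G F N.X).hom ≫ D.wl G (D.wl F N.ρ ≫ (D.assoc F N.X A.X).inv) ≫
      (D.assoc G (D.comp F N.X) A.X).inv
  rw [Category.assoc, p', reassoc_of% n, D.wl_comp, Category.assoc]

lemma assoc_inv_comm {m : Ob} (G : D.Hom k m) (F : D.Hom j k) (N : Comod1 A j) :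
    (actObj G (actObj F N)).ρ ≫ D.wr (D.assoc G F N.X).inv A.X =
      (D.assoc G F N.X).inv ≫ (actObj (D.comp G F) N).ρ := by
  have h := assoc_comm G F N
  generalize (actObj G (actObj F N)).ρ = a at h ⊢
  generalize (actObj (D.comp G F) N).ρ = b at h ⊢
  rw [Iso.eq_inv_comp, ← reassoc_of% h, ← D.wr_comp, Iso.hom_inv_id, D.wr_id, Category.comp_id]

end Comod1

/-- The bilax 2-representation of `D` on the categories of right `A`-comodules, given by left
composition. -/
abbrev comodRep (A : Coalgebra1 D i) : BilaxRep.{uk, w, u, v, max u v, v} D where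
  Obj j := Comod1 A j
  act j k :=
    { obj := fun F =>
        { obj := fun N => Comod1.actObj F N
          map := fun f => Comod1.actMap F f
          map_id := fun N => Comod1.hom_ext (D.wl_id F N.X)
          map_comp := fun f g => Comod1.hom_ext (D.wl_comp F f.hom g.hom) }
      map := fun a =>
        { app := fun N => Comod1.actMap₂ a N
          naturality := fun _ _ f => Comod1.hom_ext (D.wl_wr f.hom a) }
      map_id := fun F => NatTrans.ext (funext fun N => Comod1.hom_ext (D.wr_id F N.X))
      map_comp := fun a b => NatTrans.ext (funext fun N => Comod1.hom_ext (D.wr_comp N.X a b)) }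
  act_additive j k := ⟨fun {_ _ a b} => NatTrans.ext (funext fun N => Comod1.hom_ext (by
    have e : D.wr (a + b) N.X = D.wr a N.X + D.wr b N.X := by simp [TwoSemicat.wr]
    exact e))⟩
  act_linear j k := ⟨fun a r => NatTrans.ext (funext fun N => Comod1.hom_ext (by
    have e : D.wr (r • a) N.X = r • D.wr a N.X := by simp [TwoSemicat.wr]
    exact e))⟩
  act_obj_additive j k F := ⟨fun {_ _ f g} => Comod1.hom_ext (by
    have e : D.wl F (f.hom + g.hom) = D.wl F f.hom + D.wl F g.hom := by simp [TwoSemicat.wl]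
    exact e)⟩
  act_obj_linear j k F := ⟨fun f r => Comod1.hom_ext (by
    have e : D.wl F (r • f.hom) = r • D.wl F f.hom := by simp [TwoSemicat.wl]
    exact e)⟩
  μ G F N :=
    { hom := Comod1.Hom.mk (D.assoc G F N.X).hom (Comod1.assoc_comm G F N)
      inv := Comod1.Hom.mk (D.assoc G F N.X).inv (Comod1.assoc_inv_comm G F N)
      hom_inv_id := Comod1.hom_ext (D.assoc G F N.X).hom_inv_id
      inv_hom_id := Comod1.hom_ext (D.assoc G F N.X).inv_hom_id }
  μ_natural_left b F N := Comod1.hom_ext (D.assoc_natural_left b F N.X)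
  μ_natural_middle G _ _ a N := Comod1.hom_ext (D.assoc_natural_middle G a N.X)
  μ_natural_right G F _ _ f := Comod1.hom_ext (D.assoc_natural_right G F f.hom)
  μ_assoc H G F N := Comod1.hom_ext (D.pentagon H G F N.X)
  u N := Comod1.Hom.mk (D.l N.X) (by
    rw [Category.assoc, ← D.l_comp, Iso.inv_hom_id_assoc, D.l_natural])
  u_natural f := Comod1.hom_ext (D.l_natural f.hom)
  u_l F N := Comod1.hom_ext (D.l_comp F N.X)
  u_r G N := Comod1.hom_ext (D.l_r G N.X)
  u' N := Comod1.Hom.mk (D.l' N.X) (by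
    rw [← Category.assoc, ← D.l'_natural, ← D.l'_comp, Category.assoc, Category.assoc,
      Iso.hom_inv_id, Category.comp_id])
  u'_natural f := Comod1.hom_ext (D.l'_natural f.hom)
  u'_l' F N := Comod1.hom_ext (D.l'_comp F N.X)
  u'_r' G N := Comod1.hom_ext (D.l'_r' G N.X)

end Comodules

/-! ### Restriction from the injective abelianization -/

section Restriction

section

variable {𝕜 : Type uk} [Field 𝕜] {Ob : Type w} {D : BilaxTwoCat.{uk, w, u, v} 𝕜 Ob}
  (N : BilaxRep.{uk, w, u, v, u₁, v₁} D) {i j k m : Ob}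

lemma BilaxRep.restr_left {G G' : D.Hom j k} {F : D.Hom i j} {P P' : D.Hom i k} {p : P ⟶ P'}
    {c : P ⟶ D.comp G F} {c' : P' ⟶ D.comp G' F} {b : G ⟶ G'} (h : p ≫ c' = c ≫ D.wr b F)
    (X : N.Obj i) :
    ((N.act i k).map p).app X ≫ ((N.act i k).map c').app X ≫ (N.μ G' F X).hom =
      (((N.act i k).map c).app X ≫ (N.μ G F X).hom) ≫ ((N.act j k).map b).app _ := by
  rw [Category.assoc, ← N.μ_natural_left, ← Category.assoc, ← Category.assoc, ← NatTrans.comp_app,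
    ← NatTrans.comp_app, ← Functor.map_comp, ← Functor.map_comp, h]

lemma BilaxRep.restr_middle {G : D.Hom j k} {F F' : D.Hom i j} {P P' : D.Hom i k} {p : P ⟶ P'}
    {c : P ⟶ D.comp G F} {c' : P' ⟶ D.comp G F'} {a : F ⟶ F'} (h : p ≫ c' = c ≫ D.wl G a)
    (X : N.Obj i) :
    ((N.act i k).map p).app X ≫ ((N.act i k).map c').app X ≫ (N.μ G F' X).hom =
      (((N.act i k).map c).app X ≫ (N.μ G F X).hom) ≫
        ((N.act j k).obj G).map (((N.act i j).map a).app X) := by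
  rw [Category.assoc, ← N.μ_natural_middle, ← Category.assoc, ← Category.assoc,
    ← NatTrans.comp_app, ← NatTrans.comp_app, ← Functor.map_comp, ← Functor.map_comp, h]

lemma BilaxRep.restr_right {G : D.Hom j k} {F : D.Hom i j} {P : D.Hom i k}
    (c : P ⟶ D.comp G F) {X Y : N.Obj i} (f : X ⟶ Y) :
    ((N.act i k).obj P).map f ≫ ((N.act i k).map c).app Y ≫ (N.μ G F Y).hom =
      (((N.act i k).map c).app X ≫ (N.μ G F X).hom) ≫
        ((N.act j k).obj G).map (((N.act i j).obj F).map f) := by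
  rw [Category.assoc, ← N.μ_natural_right, ← Category.assoc, ← Category.assoc,
    NatTrans.naturality]

lemma BilaxRep.restr_assoc {H : D.Hom k m} {G : D.Hom j k} {F : D.Hom i j} {P P' : D.Hom i m}
    {R : D.Hom j m} {S : D.Hom i k} {p : P ⟶ P'} {c : P' ⟶ D.comp H S} {d : S ⟶ D.comp G F}
    {c' : P ⟶ D.comp R F} {d' : R ⟶ D.comp H G}
    (h : p ≫ c ≫ D.wl H d = c' ≫ D.wr d' F ≫ (D.assoc H G F).hom) (X : N.Obj i) :
    ((N.act i m).map p).app X ≫ (((N.act i m).map c).app X ≫ (N.μ H S X).hom) ≫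
        ((N.act k m).obj H).map (((N.act i k).map d).app X ≫ (N.μ G F X).hom) =
      (((N.act i m).map c').app X ≫ (N.μ R F X).hom) ≫
        ((N.act j m).map d').app (((N.act i j).obj F).obj X) ≫
          (N.μ H G (((N.act i j).obj F).obj X)).hom := by
  have h := congrArg (fun t => ((N.act i m).map t).app X) h
  simp only [Functor.map_comp, NatTrans.comp_app] at h
  simp only [Category.assoc, Functor.map_comp]
  rw [← reassoc_of% N.μ_natural_left d' F X, ← N.μ_assoc H G F X,
    ← reassoc_of% N.μ_natural_middle H d X, reassoc_of% h]

lemma BilaxRep.restr_l {F P : D.Hom i j} {c : P ⟶ D.comp (D.I j) F} {p : P ⟶ F}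
    (h : c ≫ D.l F = p) (X : N.Obj i) :
    (((N.act i j).map c).app X ≫ (N.μ (D.I j) F X).hom) ≫ N.u _ = ((N.act i j).map p).app X := by
  rw [Category.assoc, N.u_l, ← h, Functor.map_comp, NatTrans.comp_app]

lemma BilaxRep.restr_r {G P : D.Hom i j} {c : P ⟶ D.comp G (D.I i)} {p : P ⟶ G}
    (h : c ≫ D.r G = p) (X : N.Obj i) :
    (((N.act i j).map c).app X ≫ (N.μ G (D.I i) X).hom) ≫ ((N.act i j).obj G).map (N.u X) =
      ((N.act i j).map p).app X := by
  rw [Category.assoc, N.u_r, ← h, Functor.map_comp, NatTrans.comp_app]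

lemma BilaxRep.restr_l' {F P : D.Hom i j} {c : P ⟶ D.comp (D.I' j) F} {p : F ⟶ P}
    (h : p ≫ c = D.l' F) (X : N.Obj i) :
    ((N.act i j).map p).app X ≫ ((N.act i j).map c).app X ≫ (N.μ (D.I' j) F X).hom = N.u' _ := by
  rw [← N.u'_l', ← h, Functor.map_comp, NatTrans.comp_app, Category.assoc]

lemma BilaxRep.restr_r' {G P : D.Hom i j} {c : P ⟶ D.comp G (D.I' i)} {p : G ⟶ P}
    (h : p ≫ c = D.r' G) (X : N.Obj i) :
    ((N.act i j).map p).app X ≫ ((N.act i j).map c).app X ≫ (N.μ G (D.I' i) X).hom =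
      ((N.act i j).obj G).map (N.u' X) := by
  rw [← N.u'_r', ← h, Functor.map_comp, NatTrans.comp_app, Category.assoc]

end

variable {𝕜 : Type uk} [Field 𝕜] {Ob : Type w} (C : BilaxTwoCat.{uk, w, u, v} 𝕜 Ob)

/-- The embedding of `C` into its injective abelianization is compatible with compositions. -/
noncomputable abbrev BilaxTwoCat.inclComp {i j k : Ob} (G : C.Hom j k) (F : C.Hom i j) :
    ofObj 𝕜 (C.comp G F) ≅ C.injAb.comp (ofObj 𝕜 G) (ofObj 𝕜 F) where
  hom := homMk (𝟙 (C.comp G F)) (biObj_compat_iff.2 ⟨fun j => j.elim0, fun j => j.elim0⟩)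
  inv := homMk (𝟙 (C.comp G F)) (fun j => j.elim0)
  hom_inv_id := homMk_congr (Category.comp_id _)
  inv_hom_id := homMk_congr (Category.comp_id _)

lemma BilaxTwoCat.inclComp_left {i j k : Ob} {G G' : C.Hom j k} (b : G ⟶ G') (F : C.Hom i j) :
    (incl 𝕜 _).map (C.wr b F) ≫ (C.inclComp G' F).hom =
      (C.inclComp G F).hom ≫ C.injAb.wr ((incl 𝕜 _).map b) (ofObj 𝕜 F) :=
  homMk_congr ((Category.comp_id (C.wr b F)).trans (Category.id_comp (C.wr b F)).symm)

lemma BilaxTwoCat.inclComp_right {i j k : Ob} (G : C.Hom j k) {F F' : C.Hom i j} (a : F ⟶ F') :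
    (incl 𝕜 _).map (C.wl G a) ≫ (C.inclComp G F').hom =
      (C.inclComp G F).hom ≫ C.injAb.wl (ofObj 𝕜 G) ((incl 𝕜 _).map a) :=
  homMk_congr ((Category.comp_id (C.wl G a)).trans (Category.id_comp (C.wl G a)).symm)

lemma BilaxTwoCat.inclComp_assoc {i j k l : Ob} (H : C.Hom k l) (G : C.Hom j k) (F : C.Hom i j) :
    (incl 𝕜 _).map (C.assoc H G F).hom ≫ (C.inclComp H (C.comp G F)).hom ≫
        C.injAb.wl (ofObj 𝕜 H) (C.inclComp G F).hom =
      (C.inclComp (C.comp H G) F).hom ≫ C.injAb.wr (C.inclComp H G).hom (ofObj 𝕜 F) ≫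
        (C.injAb.assoc (ofObj 𝕜 H) (ofObj 𝕜 G) (ofObj 𝕜 F)).hom := by
  have e : (C.assoc H G F).hom ≫ 𝟙 _ ≫ C.wl H (𝟙 (C.comp G F)) =
      𝟙 _ ≫ C.wr (𝟙 (C.comp H G)) F ≫ (C.assoc H G F).hom := by simp
  exact homMk_congr e

lemma BilaxTwoCat.inclComp_l {i j : Ob} (F : C.Hom i j) :
    (C.inclComp (C.I j) F).hom ≫ C.injAb.l (ofObj 𝕜 F) = (incl 𝕜 _).map (C.l F) :=
  homMk_congr (Category.id_comp (C.l F))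

lemma BilaxTwoCat.inclComp_r {i j : Ob} (G : C.Hom i j) :
    (C.inclComp G (C.I i)).hom ≫ C.injAb.r (ofObj 𝕜 G) = (incl 𝕜 _).map (C.r G) :=
  homMk_congr (Category.id_comp (C.r G))

lemma BilaxTwoCat.inclComp_l' {i j : Ob} (F : C.Hom i j) :
    (incl 𝕜 _).map (C.l' F) ≫ (C.inclComp (C.I' j) F).hom = C.injAb.l' (ofObj 𝕜 F) :=
  homMk_congr (Category.comp_id (C.l' F))

lemma BilaxTwoCat.inclComp_r' {i j : Ob} (G : C.Hom i j) :
    (incl 𝕜 _).map (C.r' G) ≫ (C.inclComp G (C.I' i)).hom = C.injAb.r' (ofObj 𝕜 G) :=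
  homMk_congr (Category.comp_id (C.r' G))

/-- The restriction along the embedding of `C` into its injective abelianization. -/
noncomputable abbrev BilaxRep.restr {C : BilaxTwoCat.{uk, w, u, v} 𝕜 Ob}
    (N : BilaxRep.{uk, w, max u v, v, u₁, v₁} C.injAb) : BilaxRep.{uk, w, u, v, u₁, v₁} C where
  Obj i := N.Obj i
  act i j :=
    { obj := fun F => (N.act i j).obj (ofObj 𝕜 F)
      map := fun a => (N.act i j).map ((incl 𝕜 (C.Hom i j)).map a)
      map_id := fun F => (N.act i j).map_id (ofObj 𝕜 F)
      map_comp := fun a b =>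
        (N.act i j).map_comp ((incl 𝕜 (C.Hom i j)).map a) ((incl 𝕜 (C.Hom i j)).map b) }
  act_additive i j := ⟨fun {_ _ a b} =>
    (N.act_additive i j).map_add (f := (incl 𝕜 (C.Hom i j)).map a)
      (g := (incl 𝕜 (C.Hom i j)).map b)⟩
  act_linear i j := ⟨fun a r => (N.act_linear i j).map_smul ((incl 𝕜 (C.Hom i j)).map a) r⟩
  act_obj_additive i j F := N.act_obj_additive i j (ofObj 𝕜 F)
  act_obj_linear i j F := N.act_obj_linear i j (ofObj 𝕜 F)
  μ {i _ k} G F X := ((N.act i k).mapIso (C.inclComp G F)).app X ≪≫ N.μ (ofObj 𝕜 G) (ofObj 𝕜 F) X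
  μ_natural_left b F X := N.restr_left (C.inclComp_left b F) X
  μ_natural_middle G _ _ a X := N.restr_middle (C.inclComp_right G a) X
  μ_natural_right G F _ _ f := N.restr_right (C.inclComp G F).hom f
  μ_assoc H G F X := N.restr_assoc (C.inclComp_assoc H G F) X
  u X := N.u X
  u_natural f := N.u_natural f
  u_l F X := N.restr_l (C.inclComp_l F) X
  u_r G X := N.restr_r (C.inclComp_r G) X
  u' X := N.u' X
  u'_natural f := N.u'_natural f
  u'_l' F X := N.restr_l' (C.inclComp_l' F) X
  u'_r' G X := N.restr_r' (C.inclComp_r' G) X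

end Restriction

/-! ### Full subrepresentations -/

/-- The bilax 2-representation on full subcategories which are stable under the action. -/
abbrev BilaxRep.fullSub {𝕜 : Type uk} [Field 𝕜] {Ob : Type w} {C : BilaxTwoCat.{uk, w, u, v} 𝕜 Ob}
    (N : BilaxRep.{uk, w, u, v, u₁, v₁} C) (P : ∀ j, ObjectProperty (N.Obj j))
    (hP : ∀ {j k : Ob} (F : C.Hom j k) (Y : N.Obj j), P j Y → P k (((N.act j k).obj F).obj Y)) :
    BilaxRep.{uk, w, u, v, u₁, v₁} C where
  Obj j := (P j).FullSubcategory
  act j k :=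
    { obj := fun F =>
        { obj := fun Y => ⟨((N.act j k).obj F).obj Y.obj, hP F Y.obj Y.property⟩
          map := fun f => ObjectProperty.homMk (((N.act j k).obj F).map f.hom)
          map_id := fun Y => ObjectProperty.hom_ext _ (((N.act j k).obj F).map_id Y.obj)
          map_comp := fun f g =>
            ObjectProperty.hom_ext _ (((N.act j k).obj F).map_comp f.hom g.hom) }
      map := fun a =>
        { app := fun Y => ObjectProperty.homMk (((N.act j k).map a).app Y.obj)
          naturality := fun _ _ f =>
            ObjectProperty.hom_ext _ (((N.act j k).map a).naturality f.hom) }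
      map_id := fun F => NatTrans.ext (funext fun Y => ObjectProperty.hom_ext _
        (congrArg (fun t => NatTrans.app t Y.obj) ((N.act j k).map_id F)))
      map_comp := fun a b => NatTrans.ext (funext fun Y => ObjectProperty.hom_ext _
        (congrArg (fun t => NatTrans.app t Y.obj) ((N.act j k).map_comp a b))) }
  act_additive j k := ⟨fun {_ _ _ _} => NatTrans.ext (funext fun Y => ObjectProperty.hom_ext _
    (congrArg (fun t => NatTrans.app t Y.obj) (N.act_additive j k).map_add))⟩
  act_linear j k := ⟨fun a r => NatTrans.ext (funext fun Y => ObjectProperty.hom_ext _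
    (congrArg (fun t => NatTrans.app t Y.obj) ((N.act_linear j k).map_smul a r)))⟩
  act_obj_additive j k F := ⟨fun {_ _ _ _} => ObjectProperty.hom_ext _
    (N.act_obj_additive j k F).map_add⟩
  act_obj_linear j k F := ⟨fun f r => ObjectProperty.hom_ext _
    ((N.act_obj_linear j k F).map_smul f.hom r)⟩
  μ G F Y := ObjectProperty.isoMk _ (N.μ G F Y.obj)
  μ_natural_left b F Y := ObjectProperty.hom_ext _ (N.μ_natural_left b F Y.obj)
  μ_natural_middle G _ _ a Y := ObjectProperty.hom_ext _ (N.μ_natural_middle G a Y.obj)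
  μ_natural_right G F _ _ f := ObjectProperty.hom_ext _ (N.μ_natural_right G F f.hom)
  μ_assoc H G F Y := ObjectProperty.hom_ext _ (N.μ_assoc H G F Y.obj)
  u Y := ObjectProperty.homMk (N.u Y.obj)
  u_natural f := ObjectProperty.hom_ext _ (N.u_natural f.hom)
  u_l F Y := ObjectProperty.hom_ext _ (N.u_l F Y.obj)
  u_r G Y := ObjectProperty.hom_ext _ (N.u_r G Y.obj)
  u' Y := ObjectProperty.homMk (N.u' Y.obj)
  u'_natural f := ObjectProperty.hom_ext _ (N.u'_natural f.hom)
  u'_l' F Y := ObjectProperty.hom_ext _ (N.u'_l' F Y.obj)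
  u'_r' G Y := ObjectProperty.hom_ext _ (N.u'_r' G Y.obj)

/-! ### Internal homs -/

section InternalHoms

variable {𝕜 : Type uk} [Field 𝕜] {Ob : Type w} {D : BilaxTwoCat.{uk, w, u, v} 𝕜 Ob}

/-- An internal hom from `X` to `Y`: a 1-morphism `obj` together with a universal morphism
`coev : Y ⟶ N(obj)X`, so that `g ↦ N(g)_X ∘ coev` is a natural isomorphism
`Hom(obj, F) ≅ Hom(Y, N(F)X)`. -/
structure InternalHom (N : BilaxRep.{uk, w, u, v, u₁, v₁} D) {i j : Ob} (X : N.Obj i)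
    (Y : N.Obj j) where
  obj : D.Hom i j
  coev : Y ⟶ ((N.act i j).obj obj).obj X
  bij : ∀ F : D.Hom i j,
    Function.Bijective (fun g : obj ⟶ F => coev ≫ ((N.act i j).map g).app X)

namespace InternalHom

variable {N : BilaxRep.{uk, w, u, v, u₁, v₁} D} {i j : Ob} {X : N.Obj i} {Y Y' Y'' : N.Obj j}

section Lift

variable (e : InternalHom N X Y) {F : D.Hom i j}

/-- The 2-morphism corresponding to a morphism `Y ⟶ N(F)X`. -/
noncomputable def lift (f : Y ⟶ ((N.act i j).obj F).obj X) : e.obj ⟶ F :=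
  ((e.bij F).2 f).choose

lemma coev_lift (f : Y ⟶ ((N.act i j).obj F).obj X) :
    e.coev ≫ ((N.act i j).map (e.lift f)).app X = f :=
  ((e.bij F).2 f).choose_spec

lemma hom_ext {g g' : e.obj ⟶ F}
    (h : e.coev ≫ ((N.act i j).map g).app X = e.coev ≫ ((N.act i j).map g').app X) : g = g' :=
  (e.bij F).1 h

end Lift

section Coaction

variable (e : InternalHom N X Y) (c : InternalHom N X X)

/-- The 2-morphism `Hom(X,Y) ⟶ Hom(X,Y)Hom(X,X)` corresponding to `N(id)coev ∘ coev`. -/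
noncomputable def coact : e.obj ⟶ D.comp e.obj c.obj :=
  e.lift (e.coev ≫ ((N.act i j).obj e.obj).map c.coev ≫ (N.μ e.obj c.obj X).inv)

lemma coev_coact : e.coev ≫ ((N.act i j).map (e.coact c)).app X =
    e.coev ≫ ((N.act i j).obj e.obj).map c.coev ≫ (N.μ e.obj c.obj X).inv :=
  e.coev_lift _

/-- The 2-morphism `Hom(X,X) ⟶ I'` corresponding to `u'`. -/
noncomputable def counit : c.obj ⟶ D.I' i := c.lift (N.u' X)

lemma coev_counit : c.coev ≫ ((N.act i i).map c.counit).app X = N.u' X := c.coev_lift _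

lemma μ_inv_left {k : Ob} {G G' : D.Hom i k} (b : G ⟶ G') (F : D.Hom i i) :
    (N.μ G F X).inv ≫ ((N.act i k).map (D.wr b F)).app X =
      ((N.act i k).map b).app _ ≫ (N.μ G' F X).inv := by
  rw [Iso.inv_comp_eq, ← Category.assoc, Iso.eq_comp_inv, N.μ_natural_left]

lemma μ_inv_middle {k : Ob} (G : D.Hom i k) {F F' : D.Hom i i} (a : F ⟶ F') :
    (N.μ G F X).inv ≫ ((N.act i k).map (D.wl G a)).app X =
      ((N.act i k).obj G).map (((N.act i i).map a).app X) ≫ (N.μ G F' X).inv := by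
  rw [Iso.inv_comp_eq, ← Category.assoc, Iso.eq_comp_inv, N.μ_natural_middle]

lemma μ_inv_right {k : Ob} (G : D.Hom i k) (F : D.Hom i i) {X' : N.Obj i} (f : X ⟶ X') :
    (N.μ G F X).inv ≫ ((N.act i k).obj (D.comp G F)).map f =
      ((N.act i k).obj G).map (((N.act i i).obj F).map f) ≫ (N.μ G F X').inv := by
  rw [Iso.inv_comp_eq, ← Category.assoc, Iso.eq_comp_inv, N.μ_natural_right]

lemma μ_inv_assoc {k : Ob} (H : D.Hom i k) (G F : D.Hom i i) :
    (N.μ H G (((N.act i i).obj F).obj X)).inv ≫ (N.μ (D.comp H G) F X).inv ≫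
        ((N.act i k).map (D.assoc H G F).hom).app X =
      ((N.act i k).obj H).map (N.μ G F X).inv ≫ (N.μ H (D.comp G F) X).inv := by
  rw [Iso.inv_comp_eq, Iso.inv_comp_eq, ← reassoc_of% N.μ_assoc H G F X,
    ← reassoc_of% ((N.act i k).obj H).map_comp, Iso.hom_inv_id, (((N.act i k).obj H)).map_id,
    Category.id_comp, Iso.hom_inv_id, Category.comp_id]

lemma coact_coassoc : e.coact c ≫ D.wr (e.coact c) c.obj ≫ (D.assoc e.obj c.obj c.obj).hom =
    e.coact c ≫ D.wl e.obj (c.coact c) := by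
  apply e.hom_ext
  simp only [Functor.map_comp, NatTrans.comp_app]
  rw [reassoc_of% e.coev_coact c, reassoc_of% e.coev_coact c, reassoc_of% μ_inv_left,
    μ_inv_middle, reassoc_of% ((N.act i j).map (e.coact c)).naturality c.coev,
    reassoc_of% e.coev_coact c, reassoc_of% μ_inv_right, μ_inv_assoc,
    ← reassoc_of% ((N.act i j).obj e.obj).map_comp c.coev (((N.act i i).map (c.coact c)).app X),
    c.coev_coact c]
  simp only [Functor.map_comp, Category.assoc]

lemma coact_counit : e.coact c ≫ D.wl e.obj c.counit = D.r' e.obj := by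
  apply e.hom_ext
  simp only [Functor.map_comp, NatTrans.comp_app]
  rw [reassoc_of% e.coev_coact c, μ_inv_middle,
    ← reassoc_of% ((N.act i j).obj e.obj).map_comp c.coev (((N.act i i).map c.counit).app X),
    c.coev_counit, ← N.u'_r', Category.assoc, Iso.hom_inv_id, Category.comp_id]

lemma counit_coact : c.coact c ≫ D.wr c.counit c.obj = D.l' c.obj := by
  apply c.hom_ext
  simp only [Functor.map_comp, NatTrans.comp_app]
  rw [reassoc_of% c.coev_coact c, μ_inv_left,
    reassoc_of% ((N.act i i).map c.counit).naturality c.coev, reassoc_of% c.coev_counit,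
    ← reassoc_of% N.u'_natural c.coev, ← N.u'_l', Category.assoc, Iso.hom_inv_id,
    Category.comp_id]

/-- The coalgebra `Hom(X,X)`. -/
noncomputable abbrev coalg : Coalgebra1 D i where
  X := c.obj
  Δ := c.coact c
  ε := c.counit
  coassoc := c.coact_coassoc c
  counit_left := c.counit_coact
  counit_right := c.coact_counit c

/-- The comodule `Hom(X,Y)` over the coalgebra `Hom(X,X)`. -/
noncomputable abbrev comod : Comod1 c.coalg j where
  X := e.obj
  ρ := e.coact c
  coassoc := e.coact_coassoc c
  counit := e.coact_counit c

end Coaction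

/-- The 2-morphism `Hom(X,f)`. -/
noncomputable def map (e : InternalHom N X Y) (e' : InternalHom N X Y') (f : Y ⟶ Y') :
    e.obj ⟶ e'.obj :=
  e.lift (f ≫ e'.coev)

lemma coev_map (e : InternalHom N X Y) (e' : InternalHom N X Y') (f : Y ⟶ Y') :
    e.coev ≫ ((N.act i j).map (map e e' f)).app X = f ≫ e'.coev := e.coev_lift _

lemma map_comm (c : InternalHom N X X) (e : InternalHom N X Y) (e' : InternalHom N X Y')
    (f : Y ⟶ Y') : e.coact c ≫ D.wr (map e e' f) c.obj = map e e' f ≫ e'.coact c := by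
  apply e.hom_ext
  simp only [Functor.map_comp, NatTrans.comp_app]
  rw [reassoc_of% e.coev_coact c, μ_inv_left, reassoc_of% coev_map e e' f, e'.coev_coact c,
    reassoc_of% ((N.act i j).map (map e e' f)).naturality c.coev, reassoc_of% coev_map e e' f]

end InternalHom

/-- The functor `Hom(X, -)` from `N(j)` to comodules over `Hom(X,X)`. -/
noncomputable abbrev InternalHom.theta {N : BilaxRep.{uk, w, u, v, u₁, v₁} D} {i : Ob} {X : N.Obj i}
    (E : ∀ (j : Ob) (Y : N.Obj j), InternalHom N X Y) (j : Ob) :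
    N.Obj j ⥤ Comod1 (E i X).coalg j where
  obj Y := (E j Y).comod (E i X)
  map {Y Y'} f := Comod1.Hom.mk (map (E j Y) (E j Y') f) (map_comm (E i X) (E j Y) (E j Y') f)
  map_id Y := Comod1.hom_ext ((E j Y).hom_ext (by
    refine ((E j Y).coev_map (E j Y) (𝟙 Y)).trans ?_
    rw [Comod1.id_hom, (N.act i j).map_id, NatTrans.id_app, Category.id_comp, Category.comp_id]))
  map_comp {Y Y' Y''} f g := Comod1.hom_ext ((E j Y).hom_ext (by
    refine ((E j Y).coev_map (E j Y'') (f ≫ g)).trans ?_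
    rw [Comod1.comp_hom, (N.act i j).map_comp, NatTrans.comp_app,
      reassoc_of% (E j Y).coev_map (E j Y') f, (E j Y').coev_map (E j Y'') g, Category.assoc]))

end InternalHoms

/-! ### Finitary and fiax -/

/-- Finitary categories: additive, idempotent split, `𝕜`-linear categories with finite dimensional
morphism spaces and finitely many indecomposable objects up to isomorphism. -/
class IsFinitaryCat (𝕜 : Type uk) [Field 𝕜] (A : Type u) [Category.{v} A] [Preadditive A]
    [Linear 𝕜 A] : Prop where
  hasZeroObject : HasZeroObject A
  [hasBinaryBiproducts : HasBinaryBiproducts A]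
  isIdempotentComplete : IsIdempotentComplete A
  finite_hom : ∀ X Y : A, Module.Finite 𝕜 (X ⟶ Y)
  finite_indecomposables : ∃ (n : ℕ) (B : Fin n → A),
    ∀ X : A, Indecomposable X → ∃ t, Nonempty (X ≅ B t)

/-- Finitary bilax-unital 2-categories. -/
structure BilaxTwoCat.IsFinitary {𝕜 : Type uk} [Field 𝕜] {Ob : Type w}
    (C : BilaxTwoCat.{uk, w, u, v} 𝕜 Ob) : Prop where
  finite_ob : Finite Ob
  finitary : ∀ i j, IsFinitaryCat 𝕜 (C.Hom i j)
  indecomposable_I : ∀ i, haveI := (finitary i i).hasBinaryBiproducts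
    Indecomposable (C.I i)
  indecomposable_I' : ∀ i, haveI := (finitary i i).hasBinaryBiproducts
    Indecomposable (C.I' i)

/-- Finitary bilax 2-representations. -/
def BilaxRep.IsFinitary {𝕜 : Type uk} [Field 𝕜] {Ob : Type w}
    {C : BilaxTwoCat.{uk, w, u, v} 𝕜 Ob} (M : BilaxRep.{uk, w, u, v, u₁, v₁} C) : Prop :=
  ∀ i, IsFinitaryCat 𝕜 (M.Obj i)

/-- `X` generates `M` if every object of every `M(j)` is isomorphic to a direct summand of
`M(F)X`, for some 1-morphism `F`. -/
def BilaxRep.Generates {𝕜 : Type uk} [Field 𝕜] {Ob : Type w}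
    {C : BilaxTwoCat.{uk, w, u, v} 𝕜 Ob} (M : BilaxRep.{uk, w, u, v, u₁, v₁} C) {i : Ob}
    (X : M.Obj i) : Prop :=
  ∀ (j : Ob) (Y : M.Obj j), ∃ (F : C.Hom i j) (Z : M.Obj j) (b : BinaryBicone Y Z),
    Nonempty b.IsBilimit ∧ Nonempty (b.pt ≅ ((M.act i j).obj F).obj X)

/-- The data making a bilax-unital 2-category weakly fiax: an equivalence `star` from `C` to the
2-category with 1- and 2-morphisms reversed, which is compatible with the units and unitors and
which is given by adjunctions. -/
structure WeaklyFiaxStr {𝕜 : Type uk} [Field 𝕜] {Ob : Type w}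
    (C : BilaxTwoCat.{uk, w, u, v} 𝕜 Ob) where
  star : ∀ i j, (C.Hom i j)ᵒᵖ ⥤ C.Hom j i
  star_additive : ∀ i j, (star i j).Additive
  star_linear : ∀ {i j : Ob} {F G : C.Hom i j} (r : 𝕜) (a : F ⟶ G),
    (star i j).map (r • a).op = r • (star i j).map a.op
  star_equiv : ∀ i j, (star i j).IsEquivalence
  /-- `(GF)⋆ ≅ F⋆G⋆`. -/
  starComp : ∀ {i j k : Ob} (G : C.Hom j k) (F : C.Hom i j),
    (star i k).obj (.op (C.comp G F)) ≅ C.comp ((star i j).obj (.op F)) ((star j k).obj (.op G))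
  starComp_natural_left : ∀ {i j k : Ob} {G G' : C.Hom j k} (b : G ⟶ G') (F : C.Hom i j),
    (star i k).map (C.wr b F).op ≫ (starComp G F).hom =
      (starComp G' F).hom ≫ C.wl ((star i j).obj (.op F)) ((star j k).map b.op)
  starComp_natural_right : ∀ {i j k : Ob} (G : C.Hom j k) {F F' : C.Hom i j} (a : F ⟶ F'),
    (star i k).map (C.wl G a).op ≫ (starComp G F).hom =
      (starComp G F').hom ≫ C.wr ((star i j).map a.op) ((star j k).obj (.op G))
  starComp_assoc : ∀ {i j k m : Ob} (H : C.Hom k m) (G : C.Hom j k) (F : C.Hom i j),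
    (star i m).map (C.assoc H G F).hom.op ≫ (starComp (C.comp H G) F).hom ≫
        C.wl ((star i j).obj (.op F)) (starComp H G).hom =
      (starComp H (C.comp G F)).hom ≫ C.wr (starComp G F).hom ((star k m).obj (.op H)) ≫
        (C.assoc ((star i j).obj (.op F)) ((star j k).obj (.op G)) ((star k m).obj (.op H))).hom
  /-- `(Iᵢ)⋆ ≅ I'ᵢ`. -/
  starUnit : ∀ i, (star i i).obj (.op (C.I i)) ≅ C.I' i
  star_l : ∀ {j i : Ob} (F : C.Hom j i),
    (star j i).map (C.l F).op ≫ (starComp (C.I i) F).hom ≫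
      C.wl ((star j i).obj (.op F)) (starUnit i).hom = C.r' ((star j i).obj (.op F))
  star_r : ∀ {i k : Ob} (G : C.Hom i k),
    (star i k).map (C.r G).op ≫ (starComp G (C.I i)).hom ≫
      C.wr (starUnit i).hom ((star i k).obj (.op G)) = C.l' ((star i k).obj (.op G))
  /-- The adjunction morphism `I'ⱼ ⟶ F⋆F`. -/
  α : ∀ {j i : Ob} (F : C.Hom j i), C.I' j ⟶ C.comp ((star j i).obj (.op F)) F
  /-- The adjunction morphism `FF⋆ ⟶ Iᵢ`. -/
  β : ∀ {j i : Ob} (F : C.Hom j i), C.comp F ((star j i).obj (.op F)) ⟶ C.I i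
  triangle_left : ∀ {j i : Ob} (F : C.Hom j i),
    C.r' F ≫ C.wl F (α F) ≫ (C.assoc F ((star j i).obj (.op F)) F).inv ≫ C.wr (β F) F ≫ C.l F =
      𝟙 F
  triangle_right : ∀ {j i : Ob} (F : C.Hom j i),
    C.l' ((star j i).obj (.op F)) ≫ C.wr (α F) ((star j i).obj (.op F)) ≫
        (C.assoc ((star j i).obj (.op F)) F ((star j i).obj (.op F))).hom ≫
        C.wl ((star j i).obj (.op F)) (β F) ≫ C.r ((star j i).obj (.op F)) =
      𝟙 ((star j i).obj (.op F))
  star_map : ∀ {j i : Ob} {F G : C.Hom j i} (γ : F ⟶ G),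
    (star j i).map γ.op =
      C.l' ((star j i).obj (.op G)) ≫ C.wr (α F) ((star j i).obj (.op G)) ≫
        (C.assoc ((star j i).obj (.op F)) F ((star j i).obj (.op G))).hom ≫
        C.wl ((star j i).obj (.op F)) (C.wr γ ((star j i).obj (.op G))) ≫
        C.wl ((star j i).obj (.op F)) (β G) ≫ C.r ((star j i).obj (.op F))

/-- The data making a bilax-unital 2-category fiax: in addition, `star` is a weak involution. -/
structure FiaxStr {𝕜 : Type uk} [Field 𝕜] {Ob : Type w}
    (C : BilaxTwoCat.{uk, w, u, v} 𝕜 Ob) extends WeaklyFiaxStr C where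
  /-- `F ≅ F⋆⋆`. -/
  inv : ∀ {i j : Ob} (F : C.Hom i j), F ≅ (star j i).obj (.op ((star i j).obj (.op F)))
  inv_natural : ∀ {i j : Ob} {F G : C.Hom i j} (a : F ⟶ G),
    a ≫ (inv G).hom = (inv F).hom ≫ (star j i).map ((star i j).map a.op).op
  inv_comp : ∀ {i j k : Ob} (G : C.Hom j k) (F : C.Hom i j),
    (inv (C.comp G F)).hom ≫ (star k i).map (starComp G F).inv.op ≫
        (starComp ((star i j).obj (.op F)) ((star j k).obj (.op G))).hom =
      C.wr (inv G).hom F ≫ C.wl ((star k j).obj (.op ((star j k).obj (.op G)))) (inv F).hom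

/-- Fiax categories. -/
def BilaxTwoCat.IsFiax {𝕜 : Type uk} [Field 𝕜] {Ob : Type w}
    (C : BilaxTwoCat.{uk, w, u, v} 𝕜 Ob) : Prop :=
  C.IsFinitary ∧ Nonempty (FiaxStr C)

/-! ### The 2-representations in the theorem -/

section Comod

variable {𝕜 : Type uk} [Field 𝕜] {Ob : Type w} {C : BilaxTwoCat.{uk, w, u, v} 𝕜 Ob} {i : Ob}

/-- The bilax 2-representation of `C` on the right comodules over a coalgebra `A` in the injective
abelianization of `C`. -/
noncomputable abbrev comodInjAb (A : Coalgebra1 C.injAb i) :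
    BilaxRep.{uk, w, u, v, max u v, v} C :=
  (comodRep A).restr

/-- Injective comodules over `A` are stable under the action of `C`. -/
def InjStable (A : Coalgebra1 C.injAb i) : Prop :=
  ∀ {j k : Ob} (F : C.Hom j k) (N : Comod1 A j),
    Injective N → Injective ((((comodInjAb A).act j k).obj F).obj N)

/-- The bilax 2-representation of `C` on the injective right comodules over `A`. -/
noncomputable abbrev injInjAb (A : Coalgebra1 C.injAb i) (h : InjStable A) :
    BilaxRep.{uk, w, u, v, max u v, v} C :=
  (comodInjAb A).fullSub (fun j => isInjective (Comod1 A j)) h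

/-- The embedding of `M` into its injective abelianization is compatible with the action. -/
noncomputable abbrev BilaxRep.inclAct (M : BilaxRep.{uk, w, u, v, u₁, v₁} C) {j k : Ob}
    (F : C.Hom j k) (Y : M.Obj j) :
    ofObj 𝕜 (((M.act j k).obj F).obj Y) ≅ ((M.injAb.restr.act j k).obj F).obj (ofObj 𝕜 Y) where
  hom := homMk (𝟙 (((M.act j k).obj F).obj Y))
    (biObj_compat_iff.2 ⟨fun j => j.elim0, fun j => j.elim0⟩)
  inv := homMk (𝟙 (((M.act j k).obj F).obj Y)) (fun j => j.elim0)
  hom_inv_id := homMk_congr (Category.comp_id _)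
  inv_hom_id := homMk_congr (Category.comp_id _)

end Comod

/-! ### Monomorphisms, kernels and injectives in the injective abelianization -/

namespace InjAb

section Basic

variable {𝕜 : Type uk} [Field 𝕜] {A : Type u} [Category.{v} A] [Preadditive A] [Linear 𝕜 A]

/-! Existence. For fixed `Y`, the functor `F ↦ Hom(Y, FX)` on the finitary category `C(i,j)` is
additive with finite-dimensional values. Finitely many indecomposables suffice to generate it, and
likewise its relations (`exists_finite_generators`, `exists_presentation`). Such a presentation is
an object of the injective abelianization, and left exactness of the action on `X` makes it an
internal hom (`nonempty_internalHom`).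

Compatibility with the action. The 2-morphisms `α` and `β` make `F` act as a left adjoint of `F⋆` in
every bilax 2-representation (`BilaxRep.dualAdj`). Using this adjunction both in the regular
representation and in `M` shows that `F Hom(X,Y)` is an internal hom from `X` to `FY`
(`InternalHom.act`). The coherence equations of the resulting isomorphisms become equations between
morphisms out of `Y` or `FY`, by universality.

Full faithfulness. Oplax unitors need not be invertible, but a triangle identity splits `r' F`, and
this is enough for `F C_X` to be the cofree comodule on `F`. Hence `Hom(Y, FX)`, `Hom(Hom(X,Y), F)`,
the homomorphisms from `Hom(X,Y)` to `F C_X` and those to `Hom(X, FX)` are all in bijection, and the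
composite bijection is `Θ` (`theta_bijective_act`). Generation extends this to targets in `M` by
retracts, and kernels extend it to all targets (`theta_bijective`).

Essential surjectivity. A comodule `N` embeds in a cofree comodule `N₀ C_X` as the joint kernel of
maps to objects of `C`. These induce homomorphisms to cofree comodules, which come from morphisms
`N₀X → R_sX` in `M`. The formal kernel of the latter is sent to `N` because `Θ` preserves such
kernels (`theta_essSurj`).

Injectives. The injectives of the abelianization of an idempotent complete category are, up to
isomorphism, its original objects, so the equivalence restricts to `M` and the injective comodules.
Stability under `F ≅ F⋆⋆` holds because `F⋆⋆` acts as right adjoint of the mono-preserving action of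
`F⋆`. -/

lemma homMk_eq_zero_iff {P Q : InjAb 𝕜 A} {g : P.X ⟶ Q.X} {hg : g ∈ compat P Q} :
    homMk g hg = 0 ↔ g ∈ P.factors Q.X := by
  have : (0 : P ⟶ Q) = homMk 0 (zero_mem _) := rfl
  rw [this, homMk_eq_homMk, sub_zero]

/-- The canonical monomorphism from `P` to its ambient object. -/
def ι (P : InjAb 𝕜 A) : P ⟶ ofObj 𝕜 P.X := homMk (𝟙 P.X) (mem_compat_ofObj _)

lemma homMk_ι {P Q : InjAb 𝕜 A} {g : P.X ⟶ Q.X} (hg : g ∈ compat P Q) :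
    homMk g hg ≫ Q.ι = homMk (Q := ofObj 𝕜 Q.X) g (mem_compat_ofObj g) :=
  homMk_congr (Category.comp_id g)

lemma ι_incl {P : InjAb 𝕜 A} {Z : A} (g : P.X ⟶ Z) :
    P.ι ≫ (incl 𝕜 A).map g = homMk (Q := ofObj 𝕜 Z) g (mem_compat_ofObj g) :=
  homMk_congr (Category.id_comp g)

lemma ι_f (P : InjAb 𝕜 A) (s : Fin P.n) : P.ι ≫ (incl 𝕜 A).map (P.f s) = 0 := by
  rw [ι_incl, homMk_eq_zero_iff]
  exact P.f_mem_factors s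

lemma exists_ι_incl {P : InjAb 𝕜 A} {Z : A} (a : P ⟶ ofObj 𝕜 Z) :
    ∃ g : P.X ⟶ Z, a = P.ι ≫ (incl 𝕜 A).map g := by
  obtain ⟨g, hg, rfl⟩ := exists_rep a
  exact ⟨g, (ι_incl g).symm⟩

/-- Homotopy is factorization through the family `f`, so a map to an object of `A` that vanishes on
the kernel comes from the targets `Y s`. This exactness is what `Hom(X, -)` will preserve. -/
lemma ι_incl_eq_zero {P : InjAb 𝕜 A} {Z : A} {g : P.X ⟶ Z}
    (h : P.ι ≫ (incl 𝕜 A).map g = 0) : ∃ q : ∀ s, P.Y s ⟶ Z, g = ∑ s, P.f s ≫ q s := by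
  rw [ι_incl, homMk_eq_zero_iff] at h
  exact h

/-- With `ι_f` and monicity of `ι`, this makes `P` the actual joint kernel of its family: vanishing
of the composites is literally the condition for a representative to lie in `compat T P`. -/
lemma exists_lift {T P : InjAb 𝕜 A} (h : T ⟶ ofObj 𝕜 P.X)
    (hh : ∀ s, h ≫ (incl 𝕜 A).map (P.f s) = 0) : ∃ t : T ⟶ P, t ≫ P.ι = h := by
  obtain ⟨g, hg, rfl⟩ := exists_rep h
  refine ⟨homMk (Q := P) g fun s => homMk_eq_zero_iff.1 (hh s), homMk_ι _⟩

instance (P : InjAb 𝕜 A) : Mono P.ι := by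
  refine Preadditive.mono_of_cancel_zero _ fun {T} t ht => ?_
  obtain ⟨g, hg, rfl⟩ := exists_rep t
  rw [homMk_ι, homMk_eq_zero_iff] at ht
  exact homMk_eq_zero_iff.2 ht

/-- The kernel of a morphism with representative `g`. -/
abbrev ker (P : InjAb 𝕜 A) {Z : A} (g : P.X ⟶ Z) : InjAb 𝕜 A where
  n := P.n + 1
  X := P.X
  Y := Fin.cons (α := fun _ => A) Z P.Y
  f := Fin.cons (α := fun s => P.X ⟶ Fin.cons (α := fun _ => A) Z P.Y s) g P.f

lemma mem_factors_ker {P : InjAb 𝕜 A} {Z : A} (g : P.X ⟶ Z) {W : A} (t : P.X ⟶ W) :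
    t ∈ (P.ker g).factors W ↔ ∃ q : Z ⟶ W, t - g ≫ q ∈ P.factors W := by
  constructor
  · rintro ⟨q, rfl⟩
    refine ⟨q 0, fun s => q s.succ, ?_⟩
    have e : ∑ s, (P.ker g).f s ≫ q s = g ≫ q 0 + ∑ s, P.f s ≫ q s.succ := Fin.sum_univ_succ _
    rw [e, add_sub_cancel_left]
  · rintro ⟨q, q', h⟩
    refine ⟨Fin.cons (α := fun s => Fin.cons (α := fun _ => A) Z P.Y s ⟶ W) q q', ?_⟩
    exact (sub_eq_iff_eq_add'.1 h).trans (Fin.sum_univ_succ (fun s : Fin (P.n + 1) =>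
      (P.ker g).f s ≫ Fin.cons (α := fun s => Fin.cons (α := fun _ => A) Z P.Y s ⟶ W) q q' s)).symm

/-- Monicity is tested on the formal kernel `P.ker g`: the map to `P` represented by the identity is
killed by `g`, hence zero, which says that `𝟙` factors through `g` and the family of `P`.
Monomorphisms are thus split up to homotopy on ambient objects. -/
lemma mono_homMk_iff {P Q : InjAb 𝕜 A} {g : P.X ⟶ Q.X} {hg : g ∈ compat P Q} :
    Mono (homMk g hg) ↔ ∃ q : Q.X ⟶ P.X, 𝟙 P.X - g ≫ q ∈ P.factors P.X := by
  constructor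
  · intro h
    rw [← mem_factors_ker]
    have hk : 𝟙 P.X ∈ compat (P.ker g) P := fun s => by
      rw [Category.id_comp, mem_factors_ker]
      exact ⟨0, by simpa using P.f_mem_factors s⟩
    refine homMk_eq_zero_iff.1 (zero_of_comp_mono
      (f := homMk (P := P.ker g) (Q := P) (𝟙 P.X) hk) (homMk g hg) ?_)
    rw [homMk_comp, homMk_eq_zero_iff, mem_factors_ker]
    exact ⟨𝟙 _, by simp⟩
  · rintro ⟨q, hq⟩
    refine Preadditive.mono_of_cancel_zero _ fun {T} t ht => ?_
    obtain ⟨h, hh, rfl⟩ := exists_rep t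
    rw [homMk_comp, homMk_eq_zero_iff] at ht
    rw [homMk_eq_zero_iff]
    have e : h = h ≫ (𝟙 P.X - g ≫ q) + (h ≫ g) ≫ q := by simp
    rw [e]
    exact add_mem (compat_comp_factors hh hq) (comp_mem_factors ht q)

/-- The homotopy retraction `q` from `mono_homMk_iff` extends a map `t` as `q ≫ t`; every such
composite is a morphism because an object of `A` imposes no compatibility condition. -/
lemma exists_factor_of_mono {P Q : InjAb 𝕜 A} (m : P ⟶ Q) [hm : Mono m] {Z : A}
    (a : P ⟶ ofObj 𝕜 Z) : ∃ b : Q ⟶ ofObj 𝕜 Z, m ≫ b = a := by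
  obtain ⟨g, hg, rfl⟩ := exists_rep m
  obtain ⟨q, hq⟩ := mono_homMk_iff.1 hm
  obtain ⟨t, ht, rfl⟩ := exists_rep a
  refine ⟨homMk (Q := ofObj 𝕜 Z) (q ≫ t) (mem_compat_ofObj _), ?_⟩
  rw [homMk_comp, homMk_eq_homMk]
  have e : g ≫ q ≫ t - t = -((𝟙 P.X - g ≫ q) ≫ t) := by simp
  rw [e]
  exact neg_mem (comp_mem_factors hq t)

instance injective_ofObj (Z : A) : Injective (ofObj 𝕜 Z) where
  factors a m _ := exists_factor_of_mono m a

/-- A monomorphism is the joint kernel of a finite family of morphisms to objects of `A`. -/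
lemma exists_isJointKernel {P Q : InjAb 𝕜 A} (m : P ⟶ Q) [hm : Mono m] :
    ∃ (n : ℕ) (S : Fin n → A) (a : ∀ s, Q ⟶ ofObj 𝕜 (S s)), (∀ s, m ≫ a s = 0) ∧
      ∀ {T : InjAb 𝕜 A} (t : T ⟶ Q), (∀ s, t ≫ a s = 0) → ∃ t' : T ⟶ P, t' ≫ m = t := by
  obtain ⟨g, hg, rfl⟩ := exists_rep m
  obtain ⟨q, hq⟩ := mono_homMk_iff.1 hm
  have h₀ : g ≫ (𝟙 Q.X - q ≫ g) ∈ P.factors Q.X := by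
    have e : g ≫ (𝟙 Q.X - q ≫ g) = (𝟙 P.X - g ≫ q) ≫ g := by simp
    rw [e]
    exact comp_mem_factors hq g
  have h₁ : ∀ s, g ≫ q ≫ P.f s ∈ P.factors (P.Y s) := fun s => by
    have e : g ≫ q ≫ P.f s = P.f s - (𝟙 P.X - g ≫ q) ≫ P.f s := by simp
    rw [e]
    exact sub_mem (P.f_mem_factors s) (comp_mem_factors hq _)
  -- If `t` is killed by `𝟙 - q ≫ g`, it equals `t ≫ q ≫ g` up to homotopy; if it is killed by the
  -- `q ≫ P.f s`, then `t ≫ q` is a legitimate map to `P`. These are the `P.n + 1` equations.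
  refine ⟨P.n + 1, Fin.cons (α := fun _ => A) Q.X P.Y, Fin.cons
    (α := fun s => Q ⟶ ofObj 𝕜 (Fin.cons (α := fun _ => A) Q.X P.Y s))
    (homMk (Q := ofObj 𝕜 Q.X) (𝟙 Q.X - q ≫ g) (mem_compat_ofObj _))
    (fun s => homMk (Q := ofObj 𝕜 (P.Y s)) (q ≫ P.f s) (mem_compat_ofObj _)), ?_, ?_⟩
  · refine Fin.cases ?_ fun s => ?_
    · exact homMk_eq_zero_iff.2 h₀
    · exact homMk_eq_zero_iff.2 (h₁ s)
  · intro T t ht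
    obtain ⟨h, hh, rfl⟩ := exists_rep t
    have ht₀ : h ≫ (𝟙 Q.X - q ≫ g) ∈ T.factors Q.X := 
      (homMk_eq_zero_iff (Q := ofObj 𝕜 Q.X) (hg := mem_compat_ofObj _)).1 (ht 0)
    have ht₁ : ∀ s, h ≫ q ≫ P.f s ∈ T.factors (P.Y s) := fun s =>
      (homMk_eq_zero_iff (Q := ofObj 𝕜 (P.Y s)) (hg := mem_compat_ofObj _)).1 (ht s.succ)
    have hq' : h ≫ q ∈ compat T P := fun s => by simpa using ht₁ s
    refine ⟨homMk (h ≫ q) hq', ?_⟩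
    rw [homMk_comp, homMk_eq_homMk, ← neg_mem_iff]
    simpa using ht₀

/-- Over an idempotent complete category, the injective objects are those of `A`. -/
lemma exists_iso_ofObj_of_injective [IsIdempotentComplete A] (P : InjAb 𝕜 A) [Injective P] :
    ∃ Z : A, Nonempty (P ≅ ofObj 𝕜 Z) := by
  -- Injectivity splits `P.ι`. A representative `e` of the retraction satisfies `e ≫ P.f s = 0`
  -- strictly, since sums over the empty family of `ofObj` vanish.
  let r : ofObj 𝕜 P.X ⟶ P := Injective.factorThru (𝟙 P) P.ι
  have hr : P.ι ≫ r = 𝟙 P := Injective.comp_factorThru _ _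
  obtain ⟨e, he, h⟩ := exists_rep r
  have hf : ∀ s, e ≫ P.f s = 0 := fun s => by
    obtain ⟨q, hq⟩ := he s
    simpa using hq
  rw [h] at hr
  obtain ⟨q, hq⟩ := homMk_eq_homMk.1 hr
  have hq : e - 𝟙 P.X = ∑ s, P.f s ≫ q s := by simpa using hq
  -- Since `e - 𝟙` factors through the `P.f s`, composing it with `e` on the left gives zero. The
  -- object sought is the image of this idempotent.
  have hidem : e ≫ e = e := by
    have := congrArg (fun t => e ≫ t) hq
    simpa [Preadditive.comp_sum, reassoc_of% hf, sub_eq_zero] using this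
  obtain ⟨Z, i, p, hip, hpi⟩ := IsIdempotentComplete.idempotents_split P.X e hidem
  refine ⟨Z, ⟨⟨homMk (Q := ofObj 𝕜 Z) p (mem_compat_ofObj _), homMk (P := ofObj 𝕜 Z) (Q := P) i
    fun s => ?_, ?_, homMk_congr hip⟩⟩⟩
  · have : i ≫ P.f s = 0 := by
      rw [← Category.id_comp i, ← hip, Category.assoc, Category.assoc, reassoc_of% hpi, hf,
        comp_zero]
    rw [this]
    exact zero_mem _
  · exact homMk_eq_homMk.2 ⟨q, by rw [hpi, hq]⟩

instance : (incl 𝕜 A).Faithful where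
  map_injective {X Y f g} h := by
    obtain ⟨q, hq⟩ := homMk_eq_homMk.1 h
    simpa [sub_eq_zero] using hq

instance : (incl 𝕜 A).Full where
  map_surjective a := by
    obtain ⟨g, hg, rfl⟩ := exists_rep a
    exact ⟨g, rfl⟩

instance : (incl 𝕜 A).Additive := ⟨rfl⟩

instance : (incl 𝕜 A).Linear 𝕜 := ⟨fun _ _ => rfl⟩

instance [h : ∀ X Y : A, Module.Finite 𝕜 (X ⟶ Y)] (P Q : InjAb 𝕜 A) : Module.Finite 𝕜 (P ⟶ Q) :=
  inferInstanceAs (Module.Finite 𝕜 (↥(compat P Q) ⧸ (P.factors Q.X).submoduleOf (compat P Q)))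

end Basic

/-! ### Exactness of extended bilinear functors in the first variable. -/

section Bifunctor

variable {𝕜 : Type uk} [Field 𝕜] {A₁ : Type u₁} [Category.{v₁} A₁] [Preadditive A₁] [Linear 𝕜 A₁]
  {A₂ : Type u₂} [Category.{v₂} A₂] [Preadditive A₂] [Linear 𝕜 A₂]
  {A₃ : Type u₃} [Category.{v₃} A₃] [Preadditive A₃] [Linear 𝕜 A₃]
  (B : A₁ ⥤ A₂ ⥤ A₃) [B.Additive] [∀ a, (B.obj a).Additive]

lemma biLeft_zero (P Q : InjAb 𝕜 A₁) (P' : InjAb 𝕜 A₂) : biLeft B (0 : P ⟶ Q) P' = 0 :=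
  congrArg (fun t => NatTrans.app t P') ((biExt (𝕜 := 𝕜) B).map_zero P Q)

lemma biLeft_sub {P Q : InjAb 𝕜 A₁} (a b : P ⟶ Q) (P' : InjAb 𝕜 A₂) :
    biLeft B (a - b) P' = biLeft B a P' - biLeft B b P' :=
  congrArg (fun t => NatTrans.app t P') ((biExt (𝕜 := 𝕜) B).map_sub (f := a) (g := b))

instance (P' : InjAb 𝕜 A₂) : ((biExt (𝕜 := 𝕜) B).flip.obj P').Additive where
  map_add {_ _ a b} :=
    congrArg (fun t => NatTrans.app t P') ((biExt (𝕜 := 𝕜) B).map_add (f := a) (g := b))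

instance [B.Linear 𝕜] (P' : InjAb 𝕜 A₂) : ((biExt (𝕜 := 𝕜) B).flip.obj P').Linear 𝕜 where
  map_smul a r := congrArg (fun t => NatTrans.app t P') ((biExt (𝕜 := 𝕜) B).map_smul r a)

/-- The criterion `mono_homMk_iff` is an equation up to homotopy, and the bilinear functor carries
its witness `q` to a witness for the image. -/
instance mono_biLeft {P Q : InjAb 𝕜 A₁} (m : P ⟶ Q) [hm : Mono m] (P' : InjAb 𝕜 A₂) :
    Mono (biLeft B m P') := by
  obtain ⟨g, hg, rfl⟩ := exists_rep m
  obtain ⟨q, hq⟩ := mono_homMk_iff.1 hm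
  refine mono_homMk_iff.2 ⟨(B.map q).app P'.X, ?_⟩
  have := map_left_mem B P' hq
  rwa [Functor.map_sub, Functor.map_comp, CategoryTheory.Functor.map_id] at this

/-- The extension of `B` is left exact in the first variable. -/
lemma exists_biLeft_lift {P : InjAb 𝕜 A₁} {Z : A₂} {T : InjAb 𝕜 A₃}
    (h : T ⟶ biObj B (ofObj 𝕜 P.X) (ofObj 𝕜 Z))
    (hh : ∀ s, h ≫ biLeft B ((incl 𝕜 A₁).map (P.f s)) (ofObj 𝕜 Z) = 0) :
    ∃ t : T ⟶ biObj B P (ofObj 𝕜 Z), t ≫ biLeft B P.ι (ofObj 𝕜 Z) = h := by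
  obtain ⟨g, hg, rfl⟩ := exists_rep h
  refine ⟨homMk (Q := biObj B P (ofObj 𝕜 Z)) g
    (biObj_compat_iff.2 ⟨fun s => s.elim0, fun s => homMk_eq_zero_iff.1 (hh s)⟩), ?_⟩
  refine homMk_congr ?_
  simp

end Bifunctor

end InjAb

/-! ### Representability over finitary categories -/

section Finitary

variable (𝕜 : Type uk) [Field 𝕜] {A : Type u} [Category.{v} A] [Preadditive A] [Linear 𝕜 A]

/-- Extension by zero embeds `End Y` in `End Z`. Equality of dimensions would put `𝟙 Z` in the
image, which vanishes on `W`. -/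
lemma finrank_end_lt_of_biprod [HasBinaryBiproducts A] [∀ X Y : A, Module.Finite 𝕜 (X ⟶ Y)]
    {Z Y W : A} (e : Z ≅ Y ⊞ W) (hW : ¬ IsZero W) :
    Module.finrank 𝕜 (Y ⟶ Y) < Module.finrank 𝕜 (Z ⟶ Z) := by
  let L : (Y ⟶ Y) →ₗ[𝕜] (Z ⟶ Z) :=
    { toFun := fun g => (e.hom ≫ biprod.fst) ≫ g ≫ biprod.inl ≫ e.inv
      map_add' := by simp
      map_smul' := by simp }
  have hL : Function.Injective L := fun g g' h => by
    have := congrArg (fun t => biprod.inl ≫ e.inv ≫ t ≫ e.hom ≫ biprod.fst) h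
    simpa [L] using this
  refine lt_of_le_of_ne (LinearMap.finrank_le_finrank_of_injective hL) fun h => hW ?_
  obtain ⟨g, hg⟩ := (LinearMap.injective_iff_surjective_of_finrank_eq_finrank h).1 hL (𝟙 Z)
  have := congrArg (fun t => biprod.inr ≫ e.inv ≫ t ≫ e.hom ≫ biprod.snd) hg
  rw [IsZero.iff_id_eq_zero]
  simpa [L] using this.symm

/-- An isomorphism-invariant property of the objects of a finitary category which is closed under
binary biproducts holds for all objects as soon as it holds for zero and all indecomposables. -/
lemma induction_of_finite_hom [HasBinaryBiproducts A] [∀ X Y : A, Module.Finite 𝕜 (X ⟶ Y)]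
    (p : A → Prop) (zero : ∀ Z, IsZero Z → p Z) (indec : ∀ Z, Indecomposable Z → p Z)
    (sum : ∀ Z Y W : A, (Z ≅ Y ⊞ W) → p Y → p W → p Z) (Z : A) : p Z := by
  induction h : Module.finrank 𝕜 (Z ⟶ Z) using Nat.strong_induction_on generalizing Z with
  | _ n ih =>
    subst h
    by_cases hZ : IsZero Z
    · exact zero Z hZ
    by_cases hi : Indecomposable Z
    · exact indec Z hi
    · simp only [Indecomposable, hZ, not_false_eq_true, true_and, not_forall, not_or] at hi
      obtain ⟨Y, W, e, hY, hW⟩ := hi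
      -- Both summands are nonzero, so each has a strictly smaller endomorphism algebra than `Z`.
      exact sum Z Y W e (ih _ (finrank_end_lt_of_biprod 𝕜 e hW) Y rfl)
        (ih _ (finrank_end_lt_of_biprod 𝕜 (e ≪≫ biprod.braiding Y W) hY) W rfl)

variable {D : Type u₁} [Category.{v₁} D] [Preadditive D] [Linear 𝕜 D]
  [∀ X Y : D, Module.Finite 𝕜 (X ⟶ Y)]

/-- A subfunctor `S` of a finite dimensional functor `F ↦ Hom(Y, T F)` on a finitary category is
finitely generated. -/
lemma exists_finite_generators [IsFinitaryCat 𝕜 A] (T : A ⥤ D) [T.Additive] [T.Linear 𝕜] (Y : D)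
    (S : ∀ Z, Submodule 𝕜 (Y ⟶ T.obj Z))
    (hS : ∀ {Z Z' : A} (g : Z ⟶ Z') (y : Y ⟶ T.obj Z), y ∈ S Z → y ≫ T.map g ∈ S Z') :
    ∃ (n : ℕ) (B : Fin n → A) (s : ∀ k, Y ⟶ T.obj (B k)), (∀ k, s k ∈ S (B k)) ∧
      ∀ {Z : A} (y : Y ⟶ T.obj Z), y ∈ S Z → ∃ q : ∀ k, B k ⟶ Z, y = ∑ k, s k ≫ T.map (q k) := by
  have : HasBinaryBiproducts A := IsFinitaryCat.hasBinaryBiproducts 𝕜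
  have : ∀ X Y : A, Module.Finite 𝕜 (X ⟶ Y) := IsFinitaryCat.finite_hom
  obtain ⟨n, B, hB⟩ := IsFinitaryCat.finite_indecomposables (𝕜 := 𝕜) (A := A)
  -- The generators are finite spanning sets of `S` at the finitely many indecomposables, reindexed
  -- below by a single `Fin N`.
  choose m c hc using fun t => Module.Finite.exists_fin (R := 𝕜) (M := S (B t))
  obtain ⟨N, ⟨e⟩⟩ := Finite.exists_equiv_fin (Σ t, Fin (m t))
  let s : ∀ k, Y ⟶ T.obj (B (e.symm k).1) := fun k => (c (e.symm k).1 (e.symm k).2 : Y ⟶ _)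
  refine ⟨N, fun k => B (e.symm k).1, s, fun k => (c _ _).2, ?_⟩
  -- `G` is the subfunctor generated by the `s k`; the claim `S ≤ G` then reduces to indecomposable
  -- objects.
  let G : ∀ Z, Submodule 𝕜 (Y ⟶ T.obj Z) := fun Z =>
    { carrier := {y | ∃ q : ∀ k, B (e.symm k).1 ⟶ Z, y = ∑ k, s k ≫ T.map (q k)}
      add_mem' := by
        rintro _ _ ⟨q, rfl⟩ ⟨q', rfl⟩
        exact ⟨fun k => q k + q' k, by simp [Finset.sum_add_distrib]⟩
      zero_mem' := ⟨fun _ => 0, by simp⟩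
      smul_mem' := by
        rintro r _ ⟨q, rfl⟩
        exact ⟨fun k => r • q k, by simp [Finset.smul_sum]⟩ }
  have hG : ∀ {Z Z' : A} (g : Z ⟶ Z') (y : Y ⟶ T.obj Z), y ∈ G Z → y ≫ T.map g ∈ G Z' := by
    rintro Z Z' g _ ⟨q, rfl⟩
    exact ⟨fun k => q k ≫ g, by simp [Preadditive.sum_comp]⟩
  have hs : ∀ k, s k ∈ G _ := fun k => by
    classical
    refine ⟨fun l => if h : l = k then eqToHom (by rw [h]) else 0, ?_⟩
    rw [Finset.sum_eq_single k]
    · simp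
    · intro j _ hj
      simp [hj]
    · simp
  have hBG : ∀ t, S (B t) ≤ G (B t) := fun t => by
    intro y hy
    have h : (⟨y, hy⟩ : S (B t)) ∈ Submodule.span 𝕜 (Set.range (c t)) := by rw [hc]; trivial
    have h' : Submodule.span 𝕜 (Set.range (c t)) ≤ (G (B t)).comap (S (B t)).subtype := by
      rw [Submodule.span_le]
      rintro _ ⟨k, rfl⟩
      obtain ⟨l, hl⟩ := e.symm.surjective ⟨t, k⟩
      have key : ∀ a, e.symm l = a → (c a.1 a.2 : Y ⟶ _) ∈ G (B a.1) := by
        rintro _ rfl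
        exact hs l
      exact key ⟨t, k⟩ hl
    exact h' h
  refine fun {Z} => induction_of_finite_hom 𝕜 (fun Z => ∀ y, y ∈ S Z → y ∈ G Z) ?_ ?_ ?_ Z
  · intro Z hZ y _
    have : y = 0 := (T.map_isZero hZ).eq_zero_of_tgt y
    rw [this]
    exact zero_mem _
  · intro Z hZ y hy
    obtain ⟨t, ⟨f⟩⟩ := hB Z hZ
    have := hG f.inv _ (hBG t (hS f.hom y hy))
    rwa [Category.assoc, ← T.map_comp, f.hom_inv_id, T.map_id, Category.comp_id] at this
  · intro Z V W f hV hW y hy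
    have h₁ := hG (biprod.inl ≫ f.inv) _ (hV _ (hS (f.hom ≫ biprod.fst) y hy))
    have h₂ := hG (biprod.inr ≫ f.inv) _ (hW _ (hS (f.hom ≫ biprod.snd) y hy))
    have := add_mem h₁ h₂
    rw [Category.assoc, Category.assoc, ← T.map_comp, ← T.map_comp, ← Preadditive.comp_add,
      ← T.map_add] at this
    have e : (f.hom ≫ biprod.fst) ≫ biprod.inl ≫ f.inv + (f.hom ≫ biprod.snd) ≫ biprod.inr ≫ f.inv
        = 𝟙 Z := by
      have := congrArg (fun t => (f.hom ≫ t) ≫ f.inv) (biprod.total (X := V) (Y := W))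
      simp only [Preadditive.comp_add, Preadditive.add_comp, Category.comp_id, f.hom_inv_id,
        Category.assoc] at this
      simpa only [Category.assoc] using this
    rwa [e, T.map_id, Category.comp_id] at this

/-- A finite dimensional functor `F ↦ Hom(Y, T F)` on a finitary category is represented by an
object of the injective abelianization. -/
lemma exists_presentation [IsFinitaryCat 𝕜 A] (T : A ⥤ D) [T.Additive] [T.Linear 𝕜] (Y : D) :
    ∃ (P : InjAb 𝕜 A) (x : Y ⟶ T.obj P.X), (∀ {Z : A} (y : Y ⟶ T.obj Z), ∃ g, x ≫ T.map g = y) ∧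
      ∀ {Z : A} (g : P.X ⟶ Z), x ≫ T.map g = 0 ↔ g ∈ P.factors Z := by
  have : HasBinaryBiproducts A := IsFinitaryCat.hasBinaryBiproducts 𝕜
  have : HasZeroObject A := IsFinitaryCat.hasZeroObject 𝕜
  have : HasFiniteProducts A := hasFiniteProducts_of_has_binary_and_terminal
  have : HasFiniteBiproducts A := .of_hasFiniteProducts
  have : ∀ X Y : A, Module.Finite 𝕜 (X ⟶ Y) := IsFinitaryCat.finite_hom
  obtain ⟨n, B, s, -, hs⟩ := exists_finite_generators 𝕜 T Y (fun _ => ⊤) (fun _ _ _ => trivial)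
  -- The generators assembled into one element at the biproduct, so that `Hom(⨁ B, -)` maps onto
  -- `Hom(Y, T -)`.
  let x : Y ⟶ T.obj (⨁ B) := ∑ k, s k ≫ T.map (biproduct.ι B k)
  have hx : ∀ k, x ≫ T.map (biproduct.π B k) = s k := fun k => by
    rw [Preadditive.sum_comp, Finset.sum_eq_single k]
    · simp [← T.map_comp]
    · intro l _ hl
      rw [Category.assoc, ← T.map_comp, biproduct.ι_π_ne _ hl, T.map_zero, comp_zero]
    · simp
  -- The relations form a subfunctor of `Hom(⨁ B, -)`, again finitely generated. Its generators
  -- become the family `f` of the representing object.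
  obtain ⟨m, B', f, hf, hf'⟩ := exists_finite_generators 𝕜 (𝟭 A) (⨁ B)
    (fun Z =>
      { carrier := {g | x ≫ T.map g = 0}
        add_mem' := fun {a b} ha hb => by
          simp only [Set.mem_ofPred_eq] at ha hb ⊢
          simp [ha, hb]
        zero_mem' := by simp
        smul_mem' := fun r a ha => by
          simp only [Set.mem_ofPred_eq] at ha ⊢
          simp [ha] })
    (fun {Z Z'} g y hy => by
      change x ≫ T.map y = 0 at hy
      change x ≫ T.map (y ≫ g) = 0
      rw [T.map_comp, reassoc_of% hy, zero_comp])
  refine ⟨⟨m, ⨁ B, B', f⟩, x, fun {Z} y => ?_, fun {Z} g => ⟨fun h => hf' g h, ?_⟩⟩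
  · obtain ⟨q, rfl⟩ := hs y trivial
    refine ⟨∑ k, biproduct.π B k ≫ q k, ?_⟩
    simp [T.map_sum, Preadditive.comp_sum, reassoc_of% hx]
  · rintro ⟨q, rfl⟩
    have hf : ∀ k, x ≫ T.map (f k) = 0 := hf
    simp [T.map_sum, Preadditive.comp_sum, reassoc_of% hf]

end Finitary

/-! ### Existence of internal homs. -/

section Existence

variable {𝕜 : Type uk} [Field 𝕜] {Ob : Type w} {C : BilaxTwoCat.{uk, w, u, v} 𝕜 Ob}
  (M : BilaxRep.{uk, w, u, v, u₁, v₁} C) {i : Ob} (X : M.Obj i)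

/-- Internal homs exist in finitary bilax 2-representations. -/
lemma nonempty_internalHom {j : Ob} [IsFinitaryCat 𝕜 (C.Hom i j)] [IsFinitaryCat 𝕜 (M.Obj j)]
    (Y : M.injAb.Obj j) : Nonempty (InternalHom M.injAb (i := i) (ofObj 𝕜 X) Y) := by
  have : ∀ X Y : M.Obj j, Module.Finite 𝕜 (X ⟶ Y) := IsFinitaryCat.finite_hom
  obtain ⟨P, x, hx, hx'⟩ := exists_presentation 𝕜
    (incl 𝕜 (C.Hom i j) ⋙ (biExt (𝕜 := 𝕜) (M.act i j)).flip.obj (ofObj 𝕜 X)) Y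
  -- The universal element `x` lives at the ambient object `P.X`. It kills the relations, so left
  -- exactness lifts it to the coevaluation `c` at `P` itself.
  obtain ⟨c, hc⟩ := exists_biLeft_lift (M.act i j) (P := P) (Z := X) x
    (fun s => (hx' _).2 (P.f_mem_factors s))
  have hx : ∀ {Z : C.Hom i j} (y : Y ⟶ biObj (M.act i j) (ofObj 𝕜 Z) (ofObj 𝕜 X)),
    ∃ g : P.X ⟶ Z, x ≫ biLeft (M.act i j) ((incl 𝕜 _).map g) (ofObj 𝕜 X) = y := hx
  have hx' : ∀ {Z : C.Hom i j} (g : P.X ⟶ Z),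
    x ≫ biLeft (M.act i j) ((incl 𝕜 _).map g) (ofObj 𝕜 X) = 0 ↔ g ∈ P.factors Z := hx'
  have hcx : ∀ {Z : C.Hom i j} (g : P.X ⟶ Z),
      c ≫ biLeft (M.act i j) (P.ι ≫ (incl 𝕜 _).map g) (ofObj 𝕜 X) =
        x ≫ biLeft (M.act i j) ((incl 𝕜 _).map g) (ofObj 𝕜 X) := fun g => by
    rw [biLeft_comp, reassoc_of% hc]
  refine ⟨⟨P, c, fun F => ⟨fun g g' h => ?_, fun f => ?_⟩⟩⟩
  -- Uniqueness: after the monomorphism `F.ι` the target is an object of `C(i,j)`, where the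
  -- presentation applies to `g - g'`.
  · change c ≫ biLeft (M.act i j) g (ofObj 𝕜 X) = c ≫ biLeft (M.act i j) g' (ofObj 𝕜 X) at h
    rw [← cancel_mono F.ι, ← sub_eq_zero, ← Preadditive.sub_comp]
    obtain ⟨t, ht⟩ := exists_ι_incl ((g - g') ≫ F.ι)
    rw [ht, ι_incl, homMk_eq_zero_iff, ← hx', ← hcx, ← ht, Preadditive.sub_comp,
      biLeft_sub, Preadditive.comp_sub, biLeft_comp, biLeft_comp, reassoc_of% h, sub_self]
  -- Existence: the presentation gives a map `t` to the ambient object `F.X`. Its composites with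
  -- the `F.f s` vanish on `P`, so it lifts to `F`.
  · obtain ⟨t, ht⟩ := hx (f ≫ biLeft (M.act i j) F.ι (ofObj 𝕜 X))
    obtain ⟨g, hg⟩ := exists_lift (P := F) (P.ι ≫ (incl 𝕜 _).map t) (fun s => by
      rw [Category.assoc, ← Functor.map_comp, ι_incl, homMk_eq_zero_iff, ← hx', Functor.map_comp,
        biLeft_comp, reassoc_of% ht, ← biLeft_comp, F.ι_f, biLeft_zero, comp_zero])
    refine ⟨g, ?_⟩
    change c ≫ biLeft (M.act i j) g (ofObj 𝕜 X) = f
    rw [← cancel_mono (biLeft (M.act i j) F.ι (ofObj 𝕜 X)), Category.assoc, ← biLeft_comp, hg, hcx,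
      ht]

end Existence

/-! ### Adjunctions from dual 1-morphisms -/

section Dual

variable {𝕜 : Type uk} [Field 𝕜] {Ob : Type w}

/-- Adjunction data between 1-morphisms `F` and `F'` in a bilax-unital 2-category. -/
structure BilaxTwoCat.Dual (D : BilaxTwoCat.{uk, w, u, v} 𝕜 Ob) {j k : Ob} (F : D.Hom j k)
    (F' : D.Hom k j) where
  α : D.I' j ⟶ D.comp F' F
  β : D.comp F F' ⟶ D.I k
  triangle_left : D.r' F ≫ D.wl F α ≫ (D.assoc F F' F).inv ≫ D.wr β F ≫ D.l F = 𝟙 F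
  triangle_right : D.l' F' ≫ D.wr α F' ≫ (D.assoc F' F F').hom ≫ D.wl F' β ≫ D.r F' = 𝟙 F'

namespace BilaxRep

variable {D : BilaxTwoCat.{uk, w, u, v} 𝕜 Ob} (N : BilaxRep.{uk, w, u, v, u₁, v₁} D)
  {i j k m : Ob}

lemma μ_inv_natural_left {G G' : D.Hom j k} (b : G ⟶ G') (F : D.Hom i j) (X : N.Obj i) :
    (N.μ G F X).inv ≫ ((N.act i k).map (D.wr b F)).app X =
      ((N.act j k).map b).app _ ≫ (N.μ G' F X).inv := by
  rw [Iso.inv_comp_eq, ← Category.assoc, Iso.eq_comp_inv, N.μ_natural_left]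

lemma μ_inv_natural_middle (G : D.Hom j k) {F F' : D.Hom i j} (a : F ⟶ F') (X : N.Obj i) :
    (N.μ G F X).inv ≫ ((N.act i k).map (D.wl G a)).app X =
      ((N.act j k).obj G).map (((N.act i j).map a).app X) ≫ (N.μ G F' X).inv := by
  rw [Iso.inv_comp_eq, ← Category.assoc, Iso.eq_comp_inv, N.μ_natural_middle]

lemma μ_inv_natural_right (G : D.Hom j k) (F : D.Hom i j) {X X' : N.Obj i} (f : X ⟶ X') :
    (N.μ G F X).inv ≫ ((N.act i k).obj (D.comp G F)).map f =
      ((N.act j k).obj G).map (((N.act i j).obj F).map f) ≫ (N.μ G F X').inv := by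
  rw [Iso.inv_comp_eq, ← Category.assoc, Iso.eq_comp_inv, N.μ_natural_right]

lemma μ_inv_assoc (H : D.Hom k m) (G : D.Hom j k) (F : D.Hom i j) (X : N.Obj i) :
    (N.μ (D.comp H G) F X).inv ≫ ((N.act i m).map (D.assoc H G F).hom).app X =
      (N.μ H G (((N.act i j).obj F).obj X)).hom ≫
        ((N.act k m).obj H).map (N.μ G F X).inv ≫ (N.μ H (D.comp G F) X).inv := by
  rw [Iso.inv_comp_eq, ← reassoc_of% N.μ_assoc H G F X,
    ← reassoc_of% ((N.act k m).obj H).map_comp, Iso.hom_inv_id, ((N.act k m).obj H).map_id,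
    Category.id_comp, Iso.hom_inv_id, Category.comp_id]

lemma μ_assoc_inv (H : D.Hom k m) (G : D.Hom j k) (F : D.Hom i j) (X : N.Obj i) :
    (N.μ H (D.comp G F) X).hom ≫ ((N.act k m).obj H).map (N.μ G F X).hom ≫
        (N.μ H G (((N.act i j).obj F).obj X)).inv =
      ((N.act i m).map (D.assoc H G F).inv).app X ≫ (N.μ (D.comp H G) F X).hom := by
  have h : ((N.act i m).map (D.assoc H G F).inv).app X ≫
      ((N.act i m).map (D.assoc H G F).hom).app X = 𝟙 _ := by
    rw [← NatTrans.comp_app, ← Functor.map_comp, Iso.inv_hom_id, (N.act i m).map_id,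
      NatTrans.id_app]
  rw [← Category.assoc, Iso.comp_inv_eq, Category.assoc, ← N.μ_assoc H G F X, reassoc_of% h]

variable {F : D.Hom j k} {F' : D.Hom k j} (d : D.Dual F F')

variable {N} in
lemma act_map_comp {F G H : D.Hom i j} (a : F ⟶ G) (b : G ⟶ H) (X : N.Obj i) :
    ((N.act i j).map (a ≫ b)).app X = ((N.act i j).map a).app X ≫ ((N.act i j).map b).app X := by
  rw [Functor.map_comp, NatTrans.comp_app]

/-- The unit of the adjunction between the actions of dual 1-morphisms. -/
def dualUnit (Y : N.Obj j) : Y ⟶ ((N.act k j).obj F').obj (((N.act j k).obj F).obj Y) :=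
  N.u' Y ≫ ((N.act j j).map d.α).app Y ≫ (N.μ F' F Y).hom

/-- The counit of the adjunction between the actions of dual 1-morphisms. -/
def dualCounit (Z : N.Obj k) : ((N.act j k).obj F).obj (((N.act k j).obj F').obj Z) ⟶ Z :=
  (N.μ F F' Z).inv ≫ ((N.act k k).map d.β).app Z ≫ N.u Z

lemma dualUnit_natural {Y Y' : N.Obj j} (f : Y ⟶ Y') :
    f ≫ N.dualUnit d Y' =
      N.dualUnit d Y ≫ ((N.act k j).obj F').map (((N.act j k).obj F).map f) := by
  simp only [dualUnit, Category.assoc]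
  rw [reassoc_of% N.u'_natural f, reassoc_of% ((N.act j j).map d.α).naturality f,
    N.μ_natural_right]

lemma dualCounit_natural {Z Z' : N.Obj k} (f : Z ⟶ Z') :
    ((N.act j k).obj F).map (((N.act k j).obj F').map f) ≫ N.dualCounit d Z' =
      N.dualCounit d Z ≫ f := by
  simp only [dualCounit, Category.assoc]
  rw [← reassoc_of% N.μ_inv_natural_right F F' f, reassoc_of% ((N.act k k).map d.β).naturality f,
    N.u_natural]

/-- The maps `u` and `u'` stand in for the missing identity 1-morphism. Once they are rewritten
through the unitors, the coherence isomorphisms cancel and the image of `d.triangle_left` remains;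
the other triangle is analogous. -/
lemma dual_left_triangle (Y : N.Obj j) :
    ((N.act j k).obj F).map (N.dualUnit d Y) ≫ N.dualCounit d (((N.act j k).obj F).obj Y) =
      𝟙 _ := by
  simp only [dualUnit, dualCounit, Functor.map_comp, Category.assoc]
  rw [← N.u'_r', Category.assoc, ← reassoc_of% N.μ_natural_middle F d.α Y,
    reassoc_of% N.μ_assoc_inv, ← reassoc_of% N.μ_natural_left d.β F Y, N.u_l]
  simp only [← act_map_comp]
  rw [d.triangle_left, (N.act j k).map_id, NatTrans.id_app]

lemma dual_right_triangle (Z : N.Obj k) :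
    N.dualUnit d (((N.act k j).obj F').obj Z) ≫ ((N.act k j).obj F').map (N.dualCounit d Z) =
      𝟙 _ := by
  simp only [dualUnit, dualCounit, Functor.map_comp, Category.assoc]
  rw [← N.u'_l', Category.assoc, ← reassoc_of% N.μ_natural_left d.α F' Z,
    ← reassoc_of% N.μ_assoc F' F F' Z, ← reassoc_of% ((N.act k j).obj F').map_comp,
    Iso.hom_inv_id, ((N.act k j).obj F').map_id, Category.id_comp,
    ← reassoc_of% N.μ_natural_middle F' d.β Z, N.u_r]
  simp only [← act_map_comp]
  rw [d.triangle_right, (N.act k j).map_id, NatTrans.id_app]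

/-- The actions of dual 1-morphisms are adjoint functors. -/
def dualAdj : (N.act j k).obj F ⊣ (N.act k j).obj F' :=
  Adjunction.mkOfUnitCounit
    { unit := { app := fun Y => N.dualUnit d Y, naturality := fun _ _ f => N.dualUnit_natural d f }
      counit :=
        { app := fun Z => N.dualCounit d Z, naturality := fun _ _ f => N.dualCounit_natural d f }
      left_triangle := by
        ext Y
        simpa using N.dual_left_triangle d Y
      right_triangle := by
        ext Z
        simpa using N.dual_right_triangle d Z }

end BilaxRep

/-- The bilax 2-representation of `D` on the categories `D(i, -)`, by left composition. -/
abbrev BilaxTwoCat.leftReg (D : BilaxTwoCat.{uk, w, u, v} 𝕜 Ob) (i : Ob) :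
    BilaxRep.{uk, w, u, v, u, v} D where
  Obj j := D.Hom i j
  act j k := D.h i j k
  μ G F H := D.assoc G F H
  μ_natural_left b F H := D.assoc_natural_left b F H
  μ_natural_middle G _ _ a H := D.assoc_natural_middle G a H
  μ_natural_right G F _ _ f := D.assoc_natural_right G F f
  μ_assoc K H G F := D.pentagon K H G F
  u H := D.l H
  u_natural f := D.l_natural f
  u_l F H := D.l_comp F H
  u_r G H := D.l_r G H
  u' H := D.l' H
  u'_natural f := D.l'_natural f
  u'_l' F H := D.l'_comp F H
  u'_r' G H := D.l'_r' G H

/-- Compares the adjunction units on `D(i, -)` and on `N`, so that transposition along `F` can be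
moved past evaluation at `X`. -/
lemma leftReg_dualUnit {D : BilaxTwoCat.{uk, w, u, v} 𝕜 Ob} {i j k : Ob} {F : D.Hom j k}
    {F' : D.Hom k j} (d : D.Dual F F') (N : BilaxRep.{uk, w, u, v, u₁, v₁} D) (H : D.Hom i j)
    (X : N.Obj i) :
    ((N.act i j).map ((D.leftReg i).dualUnit d H)).app X ≫ (N.μ F' (D.comp F H) X).hom =
      N.dualUnit d (((N.act i j).obj H).obj X) ≫ ((N.act k j).obj F').map (N.μ F H X).inv := by
  change ((N.act i j).map (D.l' H ≫ D.wr d.α H ≫ (D.assoc F' F H).hom)).app X ≫ _ = _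
  rw [← cancel_mono (((N.act k j).obj F').map (N.μ F H X).hom)]
  simp only [Category.assoc, BilaxRep.act_map_comp, BilaxRep.dualUnit]
  rw [← ((N.act k j).obj F').map_comp, Iso.inv_hom_id, ((N.act k j).obj F').map_id,
    Category.comp_id, N.μ_assoc, reassoc_of% N.μ_natural_left d.α H X, reassoc_of% N.u'_l']

/-! ### Internal homs and the action of 1-morphisms with duals. -/

namespace InternalHom

variable {D : BilaxTwoCat.{uk, w, u, v} 𝕜 Ob} {N : BilaxRep.{uk, w, u, v, u₁, v₁} D}
  {i j k m : Ob} {X : N.Obj i}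

section Act

variable {F : D.Hom j k} {F' : D.Hom k j} (d : D.Dual F F') {Y : N.Obj j} (e : InternalHom N X Y)

/-- If `F` has a dual, `F Hom(X,Y)` is an internal hom from `X` to `N(F)Y`. -/
abbrev act : InternalHom N X (((N.act j k).obj F).obj Y) where
  obj := D.comp F e.obj
  coev := ((N.act j k).obj F).map e.coev ≫ (N.μ F e.obj X).inv
  bij G := by
    -- The evaluation map is a chain of bijections: transpose `F` to `F'` in `D(i, -)`, use
    -- universality of `e`, apply `μ`, and transpose back in `N`.
    have h : (fun g : D.comp F e.obj ⟶ G =>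
        (((N.act j k).obj F).map e.coev ≫ (N.μ F e.obj X).inv) ≫ ((N.act i k).map g).app X) =
      ((N.dualAdj d).homEquiv _ _).symm ∘ (fun f => f ≫ (N.μ F' G X).hom) ∘
        (fun g => e.coev ≫ ((N.act i j).map g).app X) ∘
          (((D.leftReg i).dualAdj d).homEquiv e.obj G) := by
      funext g
      rw [Function.comp_apply, Equiv.eq_symm_apply]
      simp only [Function.comp_apply, Adjunction.homEquiv_unit]
      change N.dualUnit d Y ≫ _ = (e.coev ≫
        ((N.act i j).map ((D.leftReg i).dualUnit d e.obj ≫ D.wl F' g)).app X) ≫ _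
      simp only [NatTrans.comp_app, Category.assoc, Functor.map_comp]
      rw [N.μ_natural_middle, reassoc_of% leftReg_dualUnit, reassoc_of% N.dualUnit_natural]
    rw [h]
    refine ((Equiv.bijective _).comp (Function.Bijective.comp ?_ ((e.bij _).comp
      (Equiv.bijective _))))
    exact (Iso.homToEquiv (N.μ F' G X)).bijective

/-- The coaction coming from universality of `F Hom(X,Y)` is the one induced from `Hom(X,Y)`; this
is why the comparison `phi` is a comodule isomorphism. -/
lemma act_coact (c : InternalHom N X X) :
    (e.act d).coact c = D.wl F (e.coact c) ≫ (D.assoc F e.obj c.obj).inv := by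
  rw [Iso.eq_comp_inv]
  apply (e.act d).hom_ext
  simp only [Functor.map_comp, NatTrans.comp_app, Category.assoc]
  rw [reassoc_of% (e.act d).coev_coact c, N.μ_inv_assoc, N.μ_inv_natural_middle,
    reassoc_of% N.μ_inv_natural_right, Iso.inv_hom_id_assoc,
    ← reassoc_of% ((N.act j k).obj F).map_comp, ← reassoc_of% ((N.act j k).obj F).map_comp,
    ← reassoc_of% ((N.act j k).obj F).map_comp, e.coev_coact c]
  simp only [Category.assoc]

end Act

lemma map_id_comp_map_id {Y : N.Obj j} (e e' : InternalHom N X Y) :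
    map e e' (𝟙 Y) ≫ map e' e (𝟙 Y) = 𝟙 e.obj := by
  apply e.hom_ext
  rw [(N.act i j).map_id, NatTrans.id_app, Category.comp_id, BilaxRep.act_map_comp,
    reassoc_of% coev_map, coev_map, Category.id_comp, Category.id_comp]

section Theta

variable (E : ∀ (j : Ob) (Y : N.Obj j), InternalHom N X Y) {F : D.Hom j k} {F' : D.Hom k j}
  (d : D.Dual F F') (Y : N.Obj j)

/-- The isomorphism `F Hom(X,Y) ≅ Hom(X,N(F)Y)`. -/
noncomputable abbrev phi : Comod1.actObj F ((theta E j).obj Y) ≅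
    (theta E k).obj (((N.act j k).obj F).obj Y) where
  hom := Comod1.Hom.mk (map ((E j Y).act d) (E k _) (𝟙 _)) (by
    have h := map_comm (E i X) ((E j Y).act d) (E k _) (𝟙 _)
    rwa [act_coact] at h)
  inv := Comod1.Hom.mk (map (E k _) ((E j Y).act d) (𝟙 _)) (by
    have h := map_comm (E i X) (E k _) ((E j Y).act d) (𝟙 _)
    rwa [act_coact] at h)
  hom_inv_id := Comod1.hom_ext (map_id_comp_map_id _ _)
  inv_hom_id := Comod1.hom_ext (map_id_comp_map_id _ _)

lemma coev_phi_hom : ((N.act j k).obj F).map (E j Y).coev ≫ (N.μ F (E j Y).obj X).inv ≫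
    ((N.act i k).map (phi E d Y).hom.hom).app X = (E k _).coev := by
  have h := coev_map ((E j Y).act d) (E k _) (𝟙 _)
  rw [Category.id_comp, Category.assoc] at h
  exact h

lemma coev_phi_inv : (E k _).coev ≫ ((N.act i k).map (phi E d Y).inv.hom).app X =
    ((N.act j k).obj F).map (E j Y).coev ≫ (N.μ F (E j Y).obj X).inv := by
  have h := coev_map (E k _) ((E j Y).act d) (𝟙 _)
  rw [Category.id_comp] at h
  exact h

variable {E Y} in
-- Universality of `F Hom(X,Y)`, in the form used to check the coherence of `phi` on 2-morphisms out
-- of it.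
lemma act_hom_ext {F' : D.Hom k j} (d : D.Dual F F') {G : D.Hom i k}
    {g g' : D.comp F (E j Y).obj ⟶ G}
    (h : ((N.act j k).obj F).map (E j Y).coev ≫ (N.μ F (E j Y).obj X).inv ≫
      ((N.act i k).map g).app X = ((N.act j k).obj F).map (E j Y).coev ≫
        (N.μ F (E j Y).obj X).inv ≫ ((N.act i k).map g').app X) : g = g' :=
  ((E j Y).act d).hom_ext (by simpa only [Category.assoc] using h)

lemma phi_natural_left {G : D.Hom j k} {G' : D.Hom k j} (d' : D.Dual G G') (a : F ⟶ G) :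
    D.wr a (E j Y).obj ≫ (phi E d' Y).hom.hom =
      (phi E d Y).hom.hom ≫ map (E k _) (E k _) (((N.act j k).map a).app Y) := by
  apply act_hom_ext d
  rw [BilaxRep.act_map_comp, BilaxRep.act_map_comp, reassoc_of% coev_phi_hom E d, coev_map,
    reassoc_of% N.μ_inv_natural_left, reassoc_of% ((N.act j k).map a).naturality, coev_phi_hom]

lemma phi_natural_right {Y Y' : N.Obj j} (f : Y ⟶ Y') :
    D.wl F (map (E j Y) (E j Y') f) ≫ (phi E d Y').hom.hom =
      (phi E d Y).hom.hom ≫ map (E k _) (E k _) (((N.act j k).obj F).map f) := by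
  apply act_hom_ext d
  rw [BilaxRep.act_map_comp, BilaxRep.act_map_comp, reassoc_of% coev_phi_hom E d, coev_map,
    reassoc_of% N.μ_inv_natural_middle, ← reassoc_of% ((N.act j k).obj F).map_comp, coev_map,
    Functor.map_comp, Category.assoc, coev_phi_hom]

/-- The extra map `c` is needed because the embedding of `C` in its abelianization respects
composition only up to `inclComp`, which is the case in which this is applied. -/
lemma phi_comp {G : D.Hom k m} {G' : D.Hom m k} (dG : D.Dual G G') {P : D.Hom j m}
    {P' : D.Hom m j} (dP : D.Dual P P') (c : P ⟶ D.comp G F) :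
    (phi E dP Y).hom.hom ≫
        map (E m _) (E m _) (((N.act j m).map c).app Y ≫ (N.μ G F Y).hom) =
      (D.wr c (E j Y).obj ≫ (D.assoc G F (E j Y).obj).hom) ≫ D.wl G (phi E d Y).hom.hom ≫
        (phi E dG _).hom.hom := by
  apply act_hom_ext dP
  simp only [BilaxRep.act_map_comp]
  rw [reassoc_of% coev_phi_hom E dP, coev_map]
  simp only [Category.assoc]
  rw [reassoc_of% N.μ_inv_natural_left, reassoc_of% N.μ_inv_assoc,
    reassoc_of% ((N.act j m).map c).naturality, reassoc_of% N.μ_natural_right,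
    reassoc_of% N.μ_inv_natural_middle, ← reassoc_of% ((N.act k m).obj G).map_comp,
    ← reassoc_of% ((N.act k m).obj G).map_comp, Category.assoc, coev_phi_hom E d,
    coev_phi_hom E dG]

lemma phi_u {I' : D.Hom j j} (dI : D.Dual (D.I j) I') :
    (phi E dI Y).hom.hom ≫ map (E j _) (E j Y) (N.u Y) = D.l (E j Y).obj := by
  apply act_hom_ext dI
  rw [BilaxRep.act_map_comp, reassoc_of% coev_phi_hom E dI, coev_map, ← N.u_l,
    Iso.inv_hom_id_assoc, N.u_natural]

lemma phi_u' {J : D.Hom j j} (dI : D.Dual (D.I' j) J) :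
    D.l' (E j Y).obj ≫ (phi E dI Y).hom.hom = map (E j Y) (E j _) (N.u' Y) := by
  apply (E j Y).hom_ext
  rw [coev_map, BilaxRep.act_map_comp, ← coev_phi_hom E dI, ← reassoc_of% N.u'_natural,
    ← N.u'_l', Category.assoc, Iso.hom_inv_id_assoc]

end Theta

end InternalHom

end Dual

/-! ### The bilax 2-natural transformation given by internal homs -/

section Transformation

variable {𝕜 : Type uk} [Field 𝕜] {Ob : Type w} {C : BilaxTwoCat.{uk, w, u, v} 𝕜 Ob}

/-- Adjunctions in `C` remain adjunctions in the injective abelianization. -/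
noncomputable abbrev WeaklyFiaxStr.dual (S : WeaklyFiaxStr C) {j k : Ob} (F : C.Hom j k) :
    C.injAb.Dual (ofObj 𝕜 F) (ofObj 𝕜 ((S.star j k).obj (.op F))) where
  α := homMk (P := ofObj 𝕜 (C.I' j)) (S.α F)
    (biObj_compat_iff.2 ⟨fun s => s.elim0, fun s => s.elim0⟩)
  β := homMk (Q := ofObj 𝕜 (C.I k)) (S.β F) (mem_compat_ofObj _)
  triangle_left := homMk_congr (S.triangle_left F)
  triangle_right := homMk_congr (S.triangle_right F)

/-- Right adjoints of mono-preserving functors preserve injectives. The action of `F⋆` is right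
adjoint to that of `F`, hence preserves monomorphisms, and it has the action of `F⋆⋆` as right
adjoint. The isomorphism `F ≅ F⋆⋆`, supplied by the involution, finishes the argument. -/
lemma FiaxStr.injStable (S : FiaxStr C) {i : Ob} (A : Coalgebra1 C.injAb i) : InjStable A := by
  intro j k F N hN
  have adj := (comodRep A).dualAdj (S.dual ((S.star j k).obj (.op F)))
  have := ((comodRep A).dualAdj (S.dual F)).isRightAdjoint
  have : (((comodRep A).act k j).obj
      (ofObj 𝕜 ((S.star j k).obj (.op F)))).PreservesMonomorphisms :=
    inferInstance
  have h := Injective.injective_of_adjoint adj N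
  refine Injective.of_iso ?_ h
  exact (((comodRep A).act j k).mapIso ((incl 𝕜 _).mapIso (S.inv F).symm)).app N

namespace InternalHom

section

variable {D : BilaxTwoCat.{uk, w, u, v} 𝕜 Ob} {N : BilaxRep.{uk, w, u, v, u₁, v₁} D} {i : Ob}
  {X : N.Obj i} (E : ∀ (j : Ob) (Y : N.Obj j), InternalHom N X Y)

instance theta_additive (j : Ob) : (theta E j).Additive where
  map_add {Y Y' f g} := Comod1.hom_ext ((E j Y).hom_ext (by
    rw [Comod1.add_hom, (N.act i j).map_add, NatTrans.app_add, Preadditive.comp_add]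
    simp only [coev_map, Preadditive.add_comp]))

instance theta_linear (j : Ob) : (theta E j).Linear 𝕜 where
  map_smul {Y Y'} f r := Comod1.hom_ext ((E j Y).hom_ext (by
    rw [Comod1.smul_hom, (N.act i j).map_smul, NatTrans.app_smul, Linear.comp_smul]
    simp only [coev_map, Linear.smul_comp]))

end

variable {N : BilaxRep.{uk, w, max u v, v, u₁, v₁} C.injAb} {i : Ob} {X : N.Obj i}

/-- The bilax 2-natural transformation `Hom(X, -)`. -/
noncomputable abbrev thetaTrans (E : ∀ (j : Ob) (Y : N.Obj j), InternalHom N X Y)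
    (S : WeaklyFiaxStr C) : BilaxTrans N.restr (comodInjAb (E i X).coalg) (theta E) where
  additive j := theta_additive E j
  linear j := theta_linear E j
  φ F Y := phi E (S.dual F) Y
  φ_natural_left a Y := Comod1.hom_ext (phi_natural_left E _ Y _ ((incl 𝕜 _).map a))
  φ_natural_right F _ _ f := Comod1.hom_ext (phi_natural_right E (S.dual F) f)
  φ_comp G F Y := Comod1.hom_ext
    (phi_comp E (S.dual F) Y (S.dual G) (S.dual _) (C.inclComp G F).hom)
  φ_u Y := Comod1.hom_ext (phi_u E Y (S.dual _))
  φ_u' Y := Comod1.hom_ext (phi_u' E Y (S.dual _))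

end InternalHom

end Transformation

/-! ### Cofree comodules -/

section Cofree

variable {𝕜 : Type uk} [Field 𝕜] {Ob : Type w} {D : BilaxTwoCat.{uk, w, u, v} 𝕜 Ob} {i j k : Ob}

/-- The retraction of `r' F` given by a dual of `F`. -/
def BilaxTwoCat.Dual.retraction {F : D.Hom j k} {F' : D.Hom k j} (d : D.Dual F F') :
    D.comp F (D.I' j) ⟶ F :=
  D.wl F d.α ≫ (D.assoc F F' F).inv ≫ D.wr d.β F ≫ D.l F

lemma BilaxTwoCat.Dual.r'_retraction {F : D.Hom j k} {F' : D.Hom k j} (d : D.Dual F F') :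
    D.r' F ≫ d.retraction = 𝟙 F :=
  d.triangle_left

/-- Substitute for invertibility of the unitor: a split monomorphism is enough for the universal
property of cofree comodules. -/
lemma BilaxTwoCat.Dual.mono_r' {F : D.Hom j k} {F' : D.Hom k j} (d : D.Dual F F') :
    Mono (D.r' F) :=
  mono_of_mono_fac d.r'_retraction

/-- A coalgebra as a comodule over itself. -/
abbrev Coalgebra1.toComod (A : Coalgebra1 D i) : Comod1 A i where
  X := A.X
  ρ := A.Δ
  coassoc := A.coassoc
  counit := A.counit_right

namespace Comod1

variable {A : Coalgebra1 D i} {N N' N'' : Comod1 A j} {F : D.Hom i j}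

/-- The homomorphism to the cofree comodule `FA` induced by a 2-morphism to `F`. -/
def cofreeLift (f : N.X ⟶ F) : N ⟶ actObj F A.toComod :=
  Hom.mk (N.ρ ≫ D.wr f A.X) (by
    have h : N.ρ ≫ D.wr N.ρ A.X = N.ρ ≫ D.wl N.X A.Δ ≫ (D.assoc N.X A.X A.X).inv := by
      rw [← Category.assoc, Iso.eq_comp_inv, Category.assoc, N.coassoc]
    rw [D.wr_comp, reassoc_of% h, D.assoc_inv_natural_left, reassoc_of% D.wl_wr, Category.assoc])

lemma cofreeLift_hom (f : N.X ⟶ F) : (cofreeLift f).hom = N.ρ ≫ D.wr f A.X := rfl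

/-- By naturality and the counit axiom, the counit of `A` returns `f` up to `r' F`; hence `f` can be
recovered when `F` has a dual. -/
lemma cofreeLift_counit (f : N.X ⟶ F) : (cofreeLift f).hom ≫ D.wl F A.ε = f ≫ D.r' F := by
  rw [cofreeLift_hom, Category.assoc, ← D.wl_wr, reassoc_of% N.counit, D.r'_natural]

lemma comp_cofreeLift (g : N' ⟶ N) (f : N.X ⟶ F) :
    g ≫ cofreeLift f = cofreeLift (g.hom ≫ f) := by
  apply hom_ext
  rw [comp_hom, cofreeLift_hom, cofreeLift_hom, D.wr_comp, reassoc_of% g.comm]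

lemma cofreeLift_zero : cofreeLift (0 : N.X ⟶ F) = 0 := by
  apply hom_ext
  have h : D.wr (0 : N.X ⟶ F) A.X = 0 := by
    rw [TwoSemicat.wr, Functor.map_zero, NatTrans.app_zero]
  rw [cofreeLift_hom, h, comp_zero]
  rfl

lemma eq_zero_of_cofreeLift_eq_zero {F' : D.Hom j i} (d : D.Dual F F') {f : N.X ⟶ F}
    (h : cofreeLift f = 0) : f = 0 := by
  have := d.mono_r'
  refine zero_of_comp_mono (D.r' F) ?_
  rw [← cofreeLift_counit, h]
  exact zero_comp

/-- The candidate is `g` followed by the counit of `A` and the retraction of `r' F`. Colinearity of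
`g` and the left counit axiom turn its lift into `g` followed by `r' F` and that retraction, both
whiskered with `A`. -/
lemma exists_cofreeLift {F' : D.Hom j i} (d : D.Dual F F') (g : N ⟶ actObj F A.toComod) :
    ∃ f : N.X ⟶ F, cofreeLift f = g := by
  refine ⟨g.hom ≫ D.wl F A.ε ≫ d.retraction, hom_ext ?_⟩
  have h : D.wl F A.Δ ≫ D.wl F (D.wr A.ε A.X) = D.wr (D.r' F) A.X ≫ (D.assoc F _ A.X).hom := by
    rw [← D.wl_comp, A.counit_left, D.l'_r']
  rw [cofreeLift_hom, D.wr_comp, reassoc_of% g.comm, D.wr_comp,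
    reassoc_of% D.assoc_inv_natural_middle, reassoc_of% h, Iso.hom_inv_id_assoc, ← D.wr_comp,
    d.r'_retraction, D.wr_id, Category.comp_id]

/-- A 2-morphism whose composition with a monomorphism of comodules is a homomorphism. -/
lemma comm_of_comp {f : N.X ⟶ N'.X} {g : N' ⟶ N''} {h : N ⟶ N''} (e : f ≫ g.hom = h.hom)
    [Mono (D.wr g.hom A.X)] : N.ρ ≫ D.wr f A.X = f ≫ N'.ρ := by
  rw [← cancel_mono (D.wr g.hom A.X), Category.assoc, Category.assoc, g.comm, ← D.wr_comp,
    reassoc_of% e, e, h.comm]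

/-- Comodules with monomorphisms to the same comodule which factor through each other are
isomorphic. -/
abbrev isoOfMono {f : N ⟶ N''} {g : N' ⟶ N''} [Mono f.hom] [Mono g.hom]
    [Mono (D.wr f.hom A.X)] [Mono (D.wr g.hom A.X)] {a : N.X ⟶ N'.X} {b : N'.X ⟶ N.X}
    (ha : a ≫ g.hom = f.hom) (hb : b ≫ f.hom = g.hom) : N ≅ N' where
  hom := Hom.mk a (comm_of_comp ha)
  inv := Hom.mk b (comm_of_comp hb)
  hom_inv_id := hom_ext (by
    rw [← cancel_mono f.hom]
    change (a ≫ b) ≫ f.hom = 𝟙 _ ≫ f.hom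
    rw [Category.assoc, hb, ha, Category.id_comp])
  inv_hom_id := hom_ext (by
    rw [← cancel_mono g.hom]
    change (b ≫ a) ≫ g.hom = 𝟙 _ ≫ g.hom
    rw [Category.assoc, ha, hb, Category.id_comp])

lemma mono_of_mono_hom (f : N ⟶ N') [Mono f.hom] : Mono f :=
  ⟨fun _ _ h => hom_ext ((cancel_mono f.hom).1 (congrArg Hom.hom h))⟩

end Comod1

/-! ### The functor `Hom(X, -)` on morphisms with target `FX`. -/

namespace InternalHom

variable {N : BilaxRep.{uk, w, u, v, u₁, v₁} D} {X : N.Obj i}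
  (E : ∀ (j : Ob) (Y : N.Obj j), InternalHom N X Y)

lemma theta_map_zero (j : Ob) (Y Y' : N.Obj j) : (theta E j).map (0 : Y ⟶ Y') = 0 :=
  (theta E j).map_zero Y Y'

lemma coev_map_comp {Y Y' : N.Obj j} (e : InternalHom N X Y) (e' : InternalHom N X Y') (f : Y ⟶ Y')
    {F : D.Hom i j} (g : e'.obj ⟶ F) :
    e.coev ≫ ((N.act i j).map (map e e' f ≫ g)).app X =
      f ≫ e'.coev ≫ ((N.act i j).map g).app X := by
  rw [BilaxRep.act_map_comp, reassoc_of% coev_map]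

lemma coev_zero {Y : N.Obj j} (e : InternalHom N X Y) (F : D.Hom i j) :
    e.coev ≫ ((N.act i j).map (0 : e.obj ⟶ F)).app X = 0 := by
  rw [(N.act i j).map_zero, NatTrans.app_zero, comp_zero]

lemma coev_sum {Y : N.Obj j} (e : InternalHom N X Y) {κ : Type*} [Fintype κ] {Z : κ → N.Obj j}
    (e₁ : ∀ s, InternalHom N X (Z s)) {F : D.Hom i j} (f : ∀ s, Y ⟶ Z s)
    (g : ∀ s, Z s ⟶ ((N.act i j).obj F).obj X) :
    e.coev ≫ ((N.act i j).map (∑ s, map e (e₁ s) (f s) ≫ (e₁ s).lift (g s))).app X =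
      ∑ s, f s ≫ g s := by
  rw [(N.act i j).map_sum, NatTrans.app_sum, Preadditive.comp_sum]
  simp only [coev_map_comp, coev_lift]

/-- Under `Hom(X, FX) ≅ F C_X`, the effect of `theta` on `h` is the cofree lift of its transpose. It
is therefore a composite of the two universal properties. -/
lemma theta_map_phi_inv {F : D.Hom i j} {F' : D.Hom j i} (d : D.Dual F F') {Y : N.Obj j}
    (h : Y ⟶ ((N.act i j).obj F).obj X) :
    (theta E j).map h ≫ (phi E d X).inv =
      Comod1.cofreeLift (A := (E i X).coalg) (N := (theta E j).obj Y) ((E j Y).lift h) := by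
  apply Comod1.hom_ext
  apply (E j Y).hom_ext
  change _ ≫ ((N.act i j).map (map _ _ h ≫ (phi E d X).inv.hom)).app X =
    _ ≫ ((N.act i j).map ((E j Y).coact (E i X) ≫ D.wr ((E j Y).lift h) (E i X).obj)).app X
  rw [BilaxRep.act_map_comp, BilaxRep.act_map_comp, reassoc_of% coev_map, coev_phi_inv,
    reassoc_of% coev_coact, N.μ_inv_natural_left,
    reassoc_of% ((N.act i j).map ((E j Y).lift h)).naturality, reassoc_of% (E j Y).coev_lift]

/-- Core of full faithfulness: transposition and cofree lifting are both bijective, the latter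
because `r' F` splits. -/
lemma theta_bijective_act {F : D.Hom i j} {F' : D.Hom j i} (d : D.Dual F F') (Y : N.Obj j) :
    Function.Bijective
      (fun h : Y ⟶ ((N.act i j).obj F).obj X => (theta E j).map h) := by
  have := d.mono_r'
  constructor
  · intro h h' e
    have e : (theta E j).map h ≫ (phi E d X).inv = (theta E j).map h' ≫ (phi E d X).inv :=
      congrArg (fun t => t ≫ (phi E d X).inv) e
    rw [theta_map_phi_inv, theta_map_phi_inv] at e
    have e := (Comod1.cofreeLift_counit _).symm.trans
      ((congrArg (fun t => Comod1.Hom.hom t ≫ D.wl F (E i X).coalg.ε) e).trans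
        (Comod1.cofreeLift_counit _))
    rw [← (E j Y).coev_lift h, (cancel_mono _).1 e, (E j Y).coev_lift]
  · intro g
    obtain ⟨f, hf⟩ := Comod1.exists_cofreeLift (A := (E i X).coalg) d (g ≫ (phi E d X).inv)
    refine ⟨(E j Y).coev ≫ ((N.act i j).map f).app X, ?_⟩
    have : IsIso (phi E d X).inv := Iso.isIso_inv _
    change (theta E j).map _ = g
    rw [← cancel_mono (phi E d X).inv, theta_map_phi_inv, ← hf]
    congr 1
    exact (E j Y).hom_ext ((E j Y).coev_lift _)

end InternalHom

end Cofree

/-! ### The equivalence between a generated 2-representation and comodules -/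

section Equivalence

/-- Passes from the targets `FX` to their direct summands, which is where generation enters. -/
lemma bijective_map_of_retract {A : Type u₁} [Category.{v₁} A] {B : Type u₂} [Category.{v₂} B]
    (Φ : A ⥤ B) {Y Y' Z : A} (r : Retract Y' Z)
    (h : Function.Bijective (fun f : Y ⟶ Z => Φ.map f)) :
    Function.Bijective (fun f : Y ⟶ Y' => Φ.map f) := by
  constructor
  · intro f g e
    have : f ≫ r.i = g ≫ r.i := h.1 (by
      change Φ.map f = Φ.map g at e
      simp only [Φ.map_comp, e])
    rw [← Category.comp_id f, ← r.retract, reassoc_of% this, r.retract, Category.comp_id]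
  · intro g
    obtain ⟨f, hf⟩ := h.2 (g ≫ Φ.map r.i)
    refine ⟨f ≫ r.r, ?_⟩
    change Φ.map f = _ at hf
    change Φ.map (f ≫ r.r) = g
    rw [Φ.map_comp, hf, Category.assoc, ← Φ.map_comp, r.retract, Φ.map_id, Category.comp_id]

namespace InjAb

variable {𝕜 : Type uk} [Field 𝕜] {A : Type u} [Category.{v} A] [Preadditive A] [Linear 𝕜 A]

lemma mono_of_exists_factor {P Q : InjAb 𝕜 A} (m : P ⟶ Q)
    (h : ∀ {Z : A} (x : P ⟶ ofObj 𝕜 Z), ∃ b : Q ⟶ ofObj 𝕜 Z, m ≫ b = x) : Mono m := by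
  obtain ⟨b, hb⟩ := h P.ι
  exact mono_of_mono_fac hb

/-- Lifting along `m : P ⟶ Q` can be tested against morphisms to objects of `A`. -/
lemma exists_lift_of_exact {P Q : InjAb 𝕜 A} (m : P ⟶ Q)
    (h₁ : ∀ {Z : A} (x : P ⟶ ofObj 𝕜 Z), ∃ b : Q ⟶ ofObj 𝕜 Z, m ≫ b = x)
    {T : InjAb 𝕜 A} (t : T ⟶ Q)
    (h₂ : ∀ {Z : A} (b : Q ⟶ ofObj 𝕜 Z), m ≫ b = 0 → t ≫ b = 0) :
    ∃ t' : T ⟶ P, t' ≫ m = t := by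
  obtain ⟨b, hb⟩ := h₁ P.ι
  obtain ⟨t', ht'⟩ := exists_lift (P := P) (t ≫ b) (fun s => by
    rw [Category.assoc]
    exact h₂ _ (by rw [reassoc_of% hb, P.ι_f]))
  refine ⟨t', ?_⟩
  -- Here `b` extends `P.ι` along `m`, so `Q.ι - b ≫ y` is killed by `m`, hence by `t`. This gives
  -- `t' ≫ m = t` after `Q.ι`.
  obtain ⟨y, hy⟩ := exists_ι_incl (m ≫ Q.ι)
  have h := h₂ (Q.ι - b ≫ (incl 𝕜 A).map y) (by
    rw [Preadditive.comp_sub, reassoc_of% hb, hy, sub_self])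
  rw [Preadditive.comp_sub, sub_eq_zero, ← reassoc_of% ht', ← hy] at h
  rw [← cancel_mono Q.ι, Category.assoc, h]

end InjAb

variable {𝕜 : Type uk} [Field 𝕜] {Ob : Type w} {C : BilaxTwoCat.{uk, w, u, v} 𝕜 Ob}
  {M : BilaxRep.{uk, w, u, v, u₁, v₁} C} {i j : Ob} {X : M.Obj i}

instance mono_wr {i j k : Ob} {G G' : C.injAb.Hom j k} (m : G ⟶ G') [Mono m]
    (F : C.injAb.Hom i j) : Mono (C.injAb.wr m F) :=
  mono_biLeft (C.h i j k) m F

namespace InternalHom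

lemma injective_act (F : C.Hom i j) :
    Injective (((M.injAb.act i j).obj (ofObj 𝕜 F)).obj (ofObj 𝕜 X)) :=
  Injective.of_iso (M.inclAct F X) (injective_ofObj _)

/-- Transposing `x` gives a morphism from `Y` to the injective object `FX`; it extends along `m`,
and the extension is transposed back. -/
lemma exists_map_comp_eq {Y Y' : M.injAb.Obj j} (e : InternalHom M.injAb (i := i) (ofObj 𝕜 X) Y)
    (e' : InternalHom M.injAb (i := i) (ofObj 𝕜 X) Y') (m : Y ⟶ Y') [Mono m] {F : C.Hom i j}
    (x : e.obj ⟶ ofObj 𝕜 F) : ∃ b : e'.obj ⟶ ofObj 𝕜 F, map e e' m ≫ b = x := by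
  have := injective_act (M := M) (X := X) F
  refine ⟨e'.lift (Injective.factorThru
    (e.coev ≫ ((M.injAb.act i j).map x).app (ofObj 𝕜 X)) m), e.hom_ext ?_⟩
  rw [BilaxRep.act_map_comp, reassoc_of% coev_map, coev_lift, Injective.comp_factorThru]

lemma mono_map {Y Y' : M.injAb.Obj j} (e : InternalHom M.injAb (i := i) (ofObj 𝕜 X) Y)
    (e' : InternalHom M.injAb (i := i) (ofObj 𝕜 X) Y') (m : Y ⟶ Y') [Mono m] :
    Mono (map e e' m) :=
  mono_of_exists_factor _ fun x => exists_map_comp_eq e e' m x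

/-- The internal hom `Hom(X, -)` preserves the kernel defining an object of the injective
abelianization. -/
lemma exists_lift_map_ι {Y : M.injAb.Obj j} (e : InternalHom M.injAb (i := i) (ofObj 𝕜 X) Y)
    (e₀ : InternalHom M.injAb (i := i) (j := j) (ofObj 𝕜 X) (ofObj 𝕜 Y.X))
    (e₁ : ∀ s, InternalHom M.injAb (i := i) (j := j) (ofObj 𝕜 X) (ofObj 𝕜 (Y.Y s)))
    {T : C.injAb.Hom i j} (t : T ⟶ e₀.obj)
    (ht : ∀ s, t ≫ map e₀ (e₁ s) ((incl 𝕜 _).map (Y.f s)) = 0) :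
    ∃ t' : T ⟶ e.obj, t' ≫ map e e₀ Y.ι = t := by
  refine exists_lift_of_exact (map e e₀ Y.ι) (fun x => exists_map_comp_eq e e₀ Y.ι x) t
    fun {F} b hb => ?_
  -- The transpose of `b` vanishes on the kernel `Y`, hence is a sum of maps through the `Y.f s`.
  -- Transposing this back writes `b` through the maps `Hom(X, Y.f s)`, all killed by `t`.
  have hb : Y.ι ≫ e₀.coev ≫ ((M.injAb.act i j).map b).app (ofObj 𝕜 X) = 0 := by
    exact (coev_map_comp e e₀ Y.ι b).symm.trans (hb ▸ coev_zero e (ofObj 𝕜 F))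
  obtain ⟨g, hg⟩ := (incl 𝕜 (M.Obj j)).map_surjective (X := Y.X) (Y := ((M.act i j).obj F).obj X)
    ((e₀.coev ≫ ((M.injAb.act i j).map b).app (ofObj 𝕜 X)) ≫ (M.inclAct F X).inv)
  obtain ⟨q, hq⟩ := ι_incl_eq_zero (P := Y) (g := g) (by
    rw [hg, ← Category.assoc, hb, zero_comp])
  have key : b = ∑ s, map e₀ (e₁ s) ((incl 𝕜 _).map (Y.f s)) ≫
      (e₁ s).lift ((incl 𝕜 _).map (q s) ≫ (M.inclAct F X).hom) := by
    apply e₀.hom_ext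
    refine Eq.trans ?_ (coev_sum e₀ e₁ _ _).symm
    rw [← Category.comp_id (e₀.coev ≫ _), ← (M.inclAct F X).inv_hom_id, ← Category.assoc, ← hg, hq,
      Functor.map_sum, Preadditive.sum_comp]
    exact Finset.sum_congr rfl fun s _ => by rw [Functor.map_comp, Category.assoc]
  rw [key, Preadditive.comp_sum]
  exact Finset.sum_eq_zero fun s _ => by rw [reassoc_of% ht s, zero_comp]

variable (E : ∀ (j : Ob) (Y : M.injAb.Obj j), InternalHom M.injAb (i := i) (ofObj 𝕜 X) Y)

lemma mono_theta_map {Y Y' : M.injAb.Obj j} (m : Y ⟶ Y') [Mono m] : Mono ((theta E j).map m) :=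
  have : Mono ((theta E j).map m).hom := mono_map _ _ m
  Comod1.mono_of_mono_hom _

lemma theta_bijective_ofObj (S : WeaklyFiaxStr C) (hgen : M.Generates X) (Y : M.injAb.Obj j)
    (Z : M.Obj j) : Function.Bijective (fun h : Y ⟶ ofObj 𝕜 Z => (theta E j).map h) := by
  obtain ⟨F, W, b, -, ⟨f⟩⟩ := hgen j Z
  let r : Retract (ofObj 𝕜 Z) (((M.injAb.act i j).obj (ofObj 𝕜 F)).obj (ofObj 𝕜 X)) :=
    { i := (incl 𝕜 _).map (b.inl ≫ f.hom) ≫ (M.inclAct F X).hom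
      r := (M.inclAct F X).inv ≫ (incl 𝕜 _).map (f.inv ≫ b.fst)
      retract := by
        rw [Category.assoc, Iso.hom_inv_id_assoc, ← Functor.map_comp, Category.assoc,
          Iso.hom_inv_id_assoc, b.inl_fst, CategoryTheory.Functor.map_id] }
  exact bijective_map_of_retract _ r (theta_bijective_act E (S.dual F) Y)

/-- Since `Y'` is the kernel of morphisms in `M` and `theta` preserves the monomorphism `Y'.ι`, maps
into `Y'` reduce to maps into objects of `M`, on both sides. -/
lemma theta_bijective (S : WeaklyFiaxStr C) (hgen : M.Generates X) (Y Y' : M.injAb.Obj j) :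
    Function.Bijective (fun h : Y ⟶ Y' => (theta E j).map h) := by
  have hb := theta_bijective_ofObj E S hgen Y
  constructor
  · intro h h' e
    change (theta E j).map h = (theta E j).map h' at e
    rw [← cancel_mono Y'.ι]
    apply (hb _).1
    change (theta E j).map (h ≫ Y'.ι) = (theta E j).map (h' ≫ Y'.ι)
    rw [Functor.map_comp, Functor.map_comp, e]
  · intro g
    obtain ⟨h, hh⟩ := (hb _).2 (g ≫ (theta E j).map Y'.ι)
    change (theta E j).map h = _ at hh
    obtain ⟨t, ht⟩ := exists_lift (P := Y') h (fun s => by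
      apply (hb _).1
      change (theta E j).map (h ≫ _) = (theta E j).map 0
      rw [Functor.map_comp, hh, Category.assoc, ← Functor.map_comp, Y'.ι_f]
      exact (congrArg (fun t => g ≫ t) (theta_map_zero E j _ _)).trans
        (comp_zero.trans (theta_map_zero E j _ _).symm))
    refine ⟨t, ?_⟩
    have := mono_theta_map E Y'.ι
    change (theta E j).map t = g
    rw [← cancel_mono ((theta E j).map Y'.ι), ← Functor.map_comp, ht, hh]

lemma theta_full (S : WeaklyFiaxStr C) (hgen : M.Generates X) (j : Ob) : (theta E j).Full :=
  ⟨fun {Y Y'} => (theta_bijective E S hgen Y Y').2⟩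

lemma theta_faithful (S : WeaklyFiaxStr C) (hgen : M.Generates X) (j : Ob) :
    (theta E j).Faithful :=
  ⟨fun {Y Y'} => @(theta_bijective E S hgen Y Y').1⟩

/-- Both `N` and the comodule built for it embed in a cofree comodule as the part killed by the same
homomorphisms, so each embedding factors through the other. -/
lemma theta_essSurj (S : WeaklyFiaxStr C) (hgen : M.Generates X) (j : Ob) :
    (theta E j).EssSurj := by
  refine ⟨fun N => ?_⟩
  have := theta_full E S hgen j
  have := theta_faithful E S hgen j
  let N₀ : C.Hom i j := N.X.X
  let A := (E i (ofObj 𝕜 X)).coalg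
  let m : N ⟶ Comod1.actObj (ofObj 𝕜 N₀) A.toComod :=
    Comod1.cofreeLift (A := A) (N := N) (F := ofObj 𝕜 N₀) N.X.ι
  -- Following `m` by the counit yields `N.X.ι ≫ r'`, a composite of monomorphisms.
  have hm : Mono m.hom := by
    have := (S.dual N₀).mono_r'
    have : Mono (N.X.ι ≫ C.injAb.r' (ofObj 𝕜 N₀)) := mono_comp _ _
    exact mono_of_mono_fac (Comod1.cofreeLift_counit (A := A) (N := N) (F := ofObj 𝕜 N₀) N.X.ι)
  obtain ⟨n, R, a, hma, ha⟩ := exists_isJointKernel m.hom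
  let b : ∀ s, Comod1.actObj (ofObj 𝕜 N₀) A.toComod ⟶ Comod1.actObj (ofObj 𝕜 (R s)) A.toComod :=
    fun s => Comod1.cofreeLift (A := A) (F := ofObj 𝕜 (R s)) (a s)
  have hmb : ∀ s, m ≫ b s = 0 := fun s => by
    rw [Comod1.comp_cofreeLift, hma, Comod1.cofreeLift_zero]
  let p := fun F : C.Hom i j => phi E (S.dual F) (ofObj 𝕜 X)
  -- The homomorphisms `b s` between cofree comodules become, by full faithfulness of `theta` and
  -- then of `incl`, morphisms in `M`.
  let G := fun s => (theta E j).preimage ((p N₀).inv ≫ b s ≫ (p (R s)).hom)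
  have hG : ∀ s, (theta E j).map (G s) = (p N₀).inv ≫ b s ≫ (p (R s)).hom := fun s =>
    (theta E j).map_preimage _
  let g : ∀ s, ((M.act i j).obj N₀).obj X ⟶ ((M.act i j).obj (R s)).obj X := fun s =>
    (incl 𝕜 _).preimage ((M.inclAct N₀ X).hom ≫ G s ≫ (M.inclAct (R s) X).inv)
  have hg : ∀ s, (incl 𝕜 _).map (g s) = (M.inclAct N₀ X).hom ≫ G s ≫ (M.inclAct (R s) X).inv :=
    fun s => (incl 𝕜 _).map_preimage _
  -- The preimage of `N`: the formal kernel of the morphisms `N₀X → R_sX`.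
  let Y : InjAb 𝕜 (M.Obj j) :=
    ⟨n, ((M.act i j).obj N₀).obj X, fun s => ((M.act i j).obj (R s)).obj X, g⟩
  have hκ : ∀ s, (Y.ι ≫ (M.inclAct N₀ X).hom) ≫ G s = 0 := fun s => by
    have h := Y.ι_f s
    change Y.ι ≫ (incl 𝕜 _).map (g s) = 0 at h
    rw [hg, ← Category.assoc, ← Category.assoc] at h
    have : IsIso (M.inclAct (R s) X).inv := Iso.isIso_inv _
    exact zero_of_comp_mono _ h
  let K : (theta E j).obj Y ⟶ Comod1.actObj (ofObj 𝕜 N₀) A.toComod :=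
    (theta E j).map (Y.ι ≫ (M.inclAct N₀ X).hom) ≫ (p N₀).inv
  have hpb : ∀ s, (p N₀).inv ≫ b s = (theta E j).map (G s) ≫ (p (R s)).inv := fun s => by
    rw [hG, Category.assoc, Category.assoc, Iso.hom_inv_id, Category.comp_id]
  have hK : ∀ s, K ≫ b s = 0 := fun s => by
    rw [Category.assoc, hpb, ← Category.assoc, ← Functor.map_comp, hκ]
    exact (congrArg (fun t => t ≫ _) (theta_map_zero E j _ _)).trans zero_comp
  -- A cofree lift vanishes only if the original 2-morphism does, so `K ≫ b s = 0` gives `K.hom ≫ a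
  -- s = 0` and `K` factors through `N`.
  obtain ⟨t', ht'⟩ := ha K.hom fun s => by
    have h := hK s
    rw [Comod1.comp_cofreeLift] at h
    exact Comod1.eq_zero_of_cofreeLift_eq_zero (S.dual _) h
  let L : N ⟶ (theta E j).obj (ofObj 𝕜 Y.X) :=
    m ≫ (p N₀).hom ≫ (theta E j).map (M.inclAct N₀ X).inv
  have hL : ∀ s, L ≫ (theta E j).map ((incl 𝕜 _).map (g s)) = 0 := fun s => by
    have h : (M.inclAct N₀ X).inv ≫ (incl 𝕜 _).map (g s) = G s ≫ (M.inclAct (R s) X).inv := by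
      rw [hg, Iso.inv_hom_id_assoc]
    rw [Category.assoc, Category.assoc, ← Functor.map_comp, h, Functor.map_comp, hG,
      Category.assoc, Category.assoc, Iso.hom_inv_id_assoc, reassoc_of% hmb, zero_comp]
  -- Conversely, `N` maps to `Hom(X, Y)` because `Hom(X, -)` preserves the kernel `Y`. As with `t'`,
  -- this is only a 2-morphism; `isoOfMono` supplies colinearity.
  obtain ⟨τ, hτ⟩ := exists_lift_map_ι (E j Y) (E j _) (fun s => E j _) L.hom
    (fun s => congrArg Comod1.Hom.hom (hL s))
  have ht : t' ≫ L.hom = ((theta E j).map Y.ι).hom := by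
    have h : K ≫ (p N₀).hom ≫ (theta E j).map (M.inclAct N₀ X).inv = (theta E j).map Y.ι := by
      rw [Category.assoc, Iso.inv_hom_id_assoc, ← Functor.map_comp, Category.assoc, Iso.hom_inv_id,
        Category.comp_id]
    rw [← h]
    change t' ≫ m.hom ≫ _ = K.hom ≫ _
    rw [reassoc_of% ht']
  have : Mono L.hom := by
    have h : L ≫ (theta E j).map (M.inclAct N₀ X).hom ≫ (p N₀).inv = m := by
      rw [Category.assoc, Category.assoc, ← Functor.map_comp_assoc, Iso.inv_hom_id,
        CategoryTheory.Functor.map_id, Category.id_comp, Iso.hom_inv_id, Category.comp_id]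
    exact mono_of_mono_fac (congrArg Comod1.Hom.hom h)
  have : Mono ((theta E j).map Y.ι).hom := mono_map _ _ _
  have := mono_wr L.hom A.X
  have := mono_wr ((theta E j).map Y.ι).hom A.X
  exact ⟨Y, ⟨(Comod1.isoOfMono (f := L) (g := (theta E j).map Y.ι) hτ ht).symm⟩⟩

end InternalHom

end Equivalence

/-! ### Composition of bilax 2-natural transformations and injective comodules -/

/-- Finitary categories are stable under linear equivalences. -/
lemma IsFinitaryCat.of_equivalence {𝕜 : Type uk} [Field 𝕜] {A : Type u₁} [Category.{v₁} A]
    [Preadditive A] [Linear 𝕜 A] {B : Type u₂} [Category.{v₂} B] [Preadditive B] [Linear 𝕜 B]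
    (Φ : A ⥤ B) [Φ.Additive] [Φ.Linear 𝕜] [Φ.IsEquivalence] (h : IsFinitaryCat 𝕜 A) :
    IsFinitaryCat 𝕜 B := by
  have := h.hasBinaryBiproducts
  obtain ⟨Z₀, hZ₀⟩ := h.hasZeroObject.zero
  have : HasBinaryProducts B := Adjunction.hasLimitsOfShape_of_equivalence Φ.inv
  have : HasBinaryBiproducts B := HasBinaryBiproducts.of_hasBinaryProducts
  have := h.finite_hom
  obtain ⟨n, G, hG⟩ := h.finite_indecomposables
  exact
  { hasZeroObject := ⟨⟨Φ.obj Z₀, Φ.map_isZero hZ₀⟩⟩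
    isIdempotentComplete :=
      (Idempotents.isIdempotentComplete_iff_of_equivalence Φ.asEquivalence).1 h.isIdempotentComplete
    finite_hom := fun X Y => by
      let L : (Φ.objPreimage X ⟶ Φ.objPreimage Y) →ₗ[𝕜] (X ⟶ Y) :=
        { toFun := fun f => (Φ.objObjPreimageIso X).inv ≫ Φ.map f ≫ (Φ.objObjPreimageIso Y).hom
          map_add' := by simp
          map_smul' := by simp }
      refine Module.Finite.of_surjective L fun g => ?_
      refine ⟨Φ.preimage ((Φ.objObjPreimageIso X).hom ≫ g ≫ (Φ.objObjPreimageIso Y).inv), ?_⟩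
      simp [L]
    finite_indecomposables := by
      refine ⟨n, fun t => Φ.obj (G t), fun X hX => ?_⟩
      have e := Φ.objObjPreimageIso X
      have hzero : ∀ {Y : A}, IsZero (Φ.obj Y) → IsZero Y := fun {Y} hY => by
        rw [IsZero.iff_id_eq_zero] at hY ⊢
        exact Φ.map_injective (by rw [Φ.map_id, hY, Φ.map_zero])
      have := preservesBinaryBiproducts_of_preservesBiproducts Φ
      obtain ⟨t, ⟨f⟩⟩ := hG (Φ.objPreimage X) ⟨fun hz => hX.1 ((Φ.map_isZero hz).of_iso e.symm),
        fun Y Z f => (hX.2 _ _ (e.symm ≪≫ Φ.mapIso f ≪≫ Φ.mapBiprod Y Z)).imp hzero hzero⟩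
      exact ⟨t, ⟨e.symm ≪≫ Φ.mapIso f⟩⟩ }

section Transformations

variable {𝕜 : Type uk} [Field 𝕜] {Ob : Type w} {C : BilaxTwoCat.{uk, w, u, v} 𝕜 Ob}

/-- The composition of bilax 2-natural transformations. -/
abbrev BilaxTrans.comp {M : BilaxRep.{uk, w, u, v, u₁, v₁} C} {N : BilaxRep.{uk, w, u, v, u₂, v₂} C}
    {K : BilaxRep.{uk, w, u, v, u₃, v₃} C} {Φ : ∀ i, M.Obj i ⥤ N.Obj i}
    {Ψ : ∀ i, N.Obj i ⥤ K.Obj i} (T : BilaxTrans M N Φ) (T' : BilaxTrans N K Ψ) :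
    BilaxTrans M K (fun i => Φ i ⋙ Ψ i) where
  additive i := have := T.additive i; have := T'.additive i; inferInstance
  linear i := have := T.linear i; have := T'.linear i; inferInstance
  φ {_ j} F X := T'.φ F ((Φ _).obj X) ≪≫ (Ψ j).mapIso (T.φ F X)
  φ_natural_left a X := by
    simp only [Iso.trans_hom, Functor.mapIso_hom, Functor.comp_map, Functor.comp_obj,
      Category.assoc]
    rw [reassoc_of% T'.φ_natural_left, ← Functor.map_comp, T.φ_natural_left, Functor.map_comp]
  φ_natural_right F _ _ f := by
    simp only [Iso.trans_hom, Functor.mapIso_hom, Functor.comp_map, Functor.comp_obj,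
      Category.assoc]
    rw [reassoc_of% T'.φ_natural_right, ← Functor.map_comp, T.φ_natural_right, Functor.map_comp]
  φ_comp G F X := by
    simp only [Iso.trans_hom, Functor.mapIso_hom, Functor.comp_map, Functor.comp_obj,
      Category.assoc, Functor.map_comp]
    rw [← Functor.map_comp, T.φ_comp, Functor.map_comp, Functor.map_comp,
      reassoc_of% T'.φ_comp, reassoc_of% T'.φ_natural_right]
  φ_u' X := by
    simp only [Iso.trans_hom, Functor.mapIso_hom, Functor.comp_map, Functor.comp_obj]
    rw [reassoc_of% T'.φ_u', ← Functor.map_comp, T.φ_u']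
  φ_u X := by
    simp only [Iso.trans_hom, Functor.mapIso_hom, Functor.comp_map, Functor.comp_obj,
      Category.assoc]
    rw [← Functor.map_comp, T.φ_u, T'.φ_u]

/-- A bilax 2-natural transformation with values in a full subrepresentation. -/
abbrev BilaxTrans.lift {M : BilaxRep.{uk, w, u, v, u₁, v₁} C} {N : BilaxRep.{uk, w, u, v, u₂, v₂} C}
    {Φ : ∀ i, M.Obj i ⥤ N.Obj i} (T : BilaxTrans M N Φ) (P : ∀ j, ObjectProperty (N.Obj j))
    (hP : ∀ {j k : Ob} (F : C.Hom j k) (Y : N.Obj j), P j Y → P k (((N.act j k).obj F).obj Y))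
    (h : ∀ j Y, P j ((Φ j).obj Y)) :
    BilaxTrans M (N.fullSub P hP) (fun j => (P j).lift (Φ j) (h j)) where
  additive i := ⟨fun {_ _ _ _} => ObjectProperty.hom_ext _ (T.additive i).map_add⟩
  linear i := ⟨fun f r => ObjectProperty.hom_ext _ ((T.linear i).map_smul f r)⟩
  φ F X := ObjectProperty.isoMk _ (T.φ F X)
  φ_natural_left a X := ObjectProperty.hom_ext _ (T.φ_natural_left a X)
  φ_natural_right F _ _ f := ObjectProperty.hom_ext _ (T.φ_natural_right F f)
  φ_comp G F X := ObjectProperty.hom_ext _ (T.φ_comp G F X)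
  φ_u' X := ObjectProperty.hom_ext _ (T.φ_u' X)
  φ_u X := ObjectProperty.hom_ext _ (T.φ_u X)

/-- The embedding of a bilax 2-representation into its injective abelianization. -/
noncomputable abbrev BilaxRep.inclTrans (M : BilaxRep.{uk, w, u, v, u₁, v₁} C) :
    BilaxTrans M M.injAb.restr (fun j => incl 𝕜 (M.Obj j)) where
  additive _ := inferInstance
  linear _ := inferInstance
  φ F Y := (M.inclAct F Y).symm
  φ_natural_left a X := homMk_congr (by simp)
  φ_natural_right F _ _ f := homMk_congr (by simp)
  φ_comp G F X := homMk_congr (by simp)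
  φ_u X := homMk_congr (by simp)
  φ_u' X := homMk_congr (by simp)

end Transformations

/-- An equivalence from the injective abelianization of `A` restricts to an equivalence between
`A` and the injective objects. -/
lemma isEquivalence_lift_isInjective {𝕜 : Type uk} [Field 𝕜] {A : Type u₁} [Category.{v₁} A]
    [Preadditive A] [Linear 𝕜 A] [IsIdempotentComplete A] {B : Type u₂} [Category.{v₂} B]
    (Φ : InjAb 𝕜 A ⥤ B) [Φ.IsEquivalence]
    (h : ∀ Y : A, Injective (Φ.obj (ofObj 𝕜 Y))) :
    ((isInjective B).lift (incl 𝕜 A ⋙ Φ) h).IsEquivalence where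
  faithful := inferInstance
  full := inferInstance
  essSurj := ⟨fun Y => by
    let e := Φ.objObjPreimageIso Y.obj
    -- Equivalences reflect injectivity, so the preimage of `Y` is injective and hence isomorphic to
    -- an object of `A`.
    have hY : Injective (Φ.asEquivalence.functor.obj (Φ.objPreimage Y.obj)) :=
      Injective.of_iso e.symm Y.property
    have := (Φ.asEquivalence.map_injective_iff _).1 hY
    obtain ⟨Z, ⟨f⟩⟩ := exists_iso_ofObj_of_injective (Φ.objPreimage Y.obj)
    exact ⟨Z, ⟨ObjectProperty.isoMk _ (Φ.mapIso f.symm ≪≫ e)⟩⟩⟩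

/-! ### The main theorem. -/

theorem mainTheorem1 {𝕜 : Type uk} [Field 𝕜] [IsAlgClosed 𝕜] {Ob : Type w}
    (C : BilaxTwoCat.{uk, w, u, v} 𝕜 Ob) (hC : C.IsFiax)
    (M : BilaxRep.{uk, w, u, v, u₁, v₁} C) (hM : M.IsFinitary)
    {i : Ob} (X : M.Obj i) (hX : ¬ IsZero X) (hgen : M.Generates X) :
    Nonempty (∀ (j : Ob) (Y : M.injAb.Obj j), InternalHom M.injAb (i := i) (ofObj 𝕜 X) Y) ∧
    ∀ E : ∀ (j : Ob) (Y : M.injAb.Obj j), InternalHom M.injAb (i := i) (ofObj 𝕜 X) Y,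
      ∃ T : BilaxTrans M.injAb.restr (comodInjAb (E i (ofObj 𝕜 X)).coalg) (InternalHom.theta E),
        T.IsEquivalence ∧
        (∀ {j k : Ob} (F : C.Hom j k) (Y : M.injAb.Obj j),
          (E k (((M.injAb.act j k).obj (ofObj 𝕜 F)).obj Y)).coev ≫
              ((M.injAb.act i k).map (T.φ F Y).inv.hom).app (ofObj 𝕜 X) =
            ((M.injAb.act j k).obj (ofObj 𝕜 F)).map (E j Y).coev ≫
              (M.injAb.μ (ofObj 𝕜 F) (E j Y).obj (ofObj 𝕜 X)).inv) ∧
        ∃ (hstable : InjStable (E i (ofObj 𝕜 X)).coalg)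
          (hinj : ∀ (j : Ob) (Y : M.Obj j), Injective ((InternalHom.theta E j).obj (ofObj 𝕜 Y)))
          (T' : BilaxTrans M (injInjAb (E i (ofObj 𝕜 X)).coalg hstable)
            (fun j => (isInjective _).lift (incl 𝕜 (M.Obj j) ⋙ InternalHom.theta E j) (hinj j))),
          (injInjAb (E i (ofObj 𝕜 X)).coalg hstable).IsFinitary ∧
          T'.IsEquivalence ∧
          ∀ {j k : Ob} (F : C.Hom j k) (Y : M.Obj j),
            (T'.φ F Y).hom.hom =
              (T.φ F (ofObj 𝕜 Y)).hom ≫ (InternalHom.theta E k).map (M.inclAct F Y).inv := by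
  obtain ⟨hCfin, ⟨S⟩⟩ := hC
  have hC' := fun j => hCfin.finitary i j
  refine ⟨⟨fun j Y => (have := hC' j; have := hM j; nonempty_internalHom M X Y).some⟩, fun E => ?_⟩
  have hE : ∀ j, (InternalHom.theta E j).IsEquivalence := fun j =>
    { faithful := InternalHom.theta_faithful E S.toWeaklyFiaxStr hgen j
      full := InternalHom.theta_full E S.toWeaklyFiaxStr hgen j
      essSurj := InternalHom.theta_essSurj E S.toWeaklyFiaxStr hgen j }
  have hinj : ∀ (j : Ob) (Y : M.Obj j), Injective ((InternalHom.theta E j).obj (ofObj 𝕜 Y)) :=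
    fun j Y => ((InternalHom.theta E j).asEquivalence.map_injective_iff _).2 (injective_ofObj Y)
  let T := InternalHom.thetaTrans E S.toWeaklyFiaxStr
  -- The restricted equivalence is the embedding of `M` followed by `T`, corestricted to injectives;
  -- the final formula for its structure isomorphisms thus holds by definition.
  let T' := (M.inclTrans.comp T).lift (fun j => isInjective _) (S.injStable _) hinj
  have hT' : T'.IsEquivalence := fun j =>
    have := (hM j).isIdempotentComplete
    isEquivalence_lift_isInjective (InternalHom.theta E j) (hinj j)
  refine ⟨T, hE, fun F Y => InternalHom.coev_phi_inv E _ Y, S.injStable _, hinj, T', fun j => ?_,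
    hT', fun F Y => rfl⟩
  have := T'.additive j
  have := T'.linear j
  have := hT' j
  exact IsFinitaryCat.of_equivalence
    ((isInjective _).lift (incl 𝕜 (M.Obj j) ⋙ InternalHom.theta E j) (hinj j)) (hM j)
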